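/- A network design universe consists of a finite set $\mathcal E$ of elements with costs $c:\mathcal E\to\mathbb R_{\ge 0}$ and a collection of possible requests. Each request $q$ has an upwards-closed family $X_q\subseteq 2^{\mathcal E}$ of sets that serve it, with $\mathcal E\in X_q$. A network design problem ND is a class of such universes; each universe has a size, at least $|\mathcal E|$ (the length of its description). In the prize-collecting problem PCND on a universe of the class, one is given a set $E_0\subseteq\mathcal E$ of elements whose cost is set to $0$, a finite list $Q$ of requests, and penalties $\pi:Q\to\mathbb R_{\ge 0}$. A solution is a set $S\subseteq\mathcal E$, of cost $\sum_{e\in S\setminus E_0}c(e)+\sum_{q\in Q:\,S\notin X_q}\pi(q)$. Let $\gamma\ge 1$ be a number that may depend on the universe. A $\gamma$-approximation algorithm always returns a solution of cost at most $\gamma$ times the optimum. It may be deterministic, or randomized; in the latter case the guarantee holds in every run. "Polynomial time" means polynomial in the size of the universe plus the number of requests, and refers to the expected running time for randomized algorithms. In ND with delay, the universe is known in advance and $k$ requests arrive over time, where $k$ is not known in advance. Request $q$ is released at time $r_q$, and is revealed at that time together with its continuous nondecreasing delay function $d_q:\mathbb R\to\mathbb R_{\ge 0}$, where $d_q(t)\to\infty$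 as $t\to\infty$. At any time the algorithm may transmit a set $S\subseteq\mathcal E$ at cost $\sum_{e\in S}c(e)$; this serves every released unserved $q$ with $S\in X_q$. A request $q$ served at time $t$ costs $d_q(t)$. The total cost is that of the transmissions plus the delay costs. An algorithm is $\rho$-competitive if its total cost is at most $\rho\cdot\mathrm{OPT}$ on every input, $\mathrm{OPT}$ being the offline optimum. **Theorem.** There is an absolute constant $C$ such that the following holds for every network design problem ND. If there is a deterministic (respectively randomized) $\gamma$-approximation algorithm $A$ for PCND, then there is a deterministic (respectively randomized) online algorithm for ND with delay which uses $A$ as a subroutine and is $$C\,\gamma\,\bigl(1+\log\min\{k,|\mathcal E|\}\bigr)\text{-competitive}$$ (with the convention $\log 0=0$), that is, $O(\gamma\log\min\{k,|\mathcal E|\})$-competitive when $\min\{k,|\mathcal E|\}\ge 2$. In the randomized case the bound holds in every run. Moreover, if $A$ runs in polynomial time (respectively expected polynomial time), then so does the online algorithm. Running time is counted on a random access machine with exact real arithmetic. The online algorithm is one finite program for all universes of the class, with access to $\gamma$ and to the universe's element costs; its access to the families $X_q$ is through $A$ only. It is run whenever a request is released and at times it has itself chosen before. Each of the following is an elementary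 operation: addition and subtraction of naturals and reals, comparison, multiplication or division of a real by a natural number or by $\gamma$, rounding of a real down to a power of two, and evaluation of $d_q$. An operation on sets of elements takes $|\mathcal E|+1$ steps. Finding the first time from now on at which $\sum_{q\in Q'}\max(0,d_q(t)-h_q)$ reaches a given threshold, for given released requests $Q'$ and reals $h_q$, takes one step per released request, plus one. A call to $A$ takes as many steps as $A$ does, in addition to those for passing its input and output. -/

import Mathlib

open scoped NNReal ENNReal

universe u v

namespace NDDelay

noncomputable section

/-! ## Network design, offline (prize-collecting) and online (with delay) -/

/-- A network design universe: a finite set of elements with costs, and the requests that may be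
asked on it.  `serves q S` says that the element set `S` belongs to the upwards-closed
collection `X_q` of sets satisfying `q`; buying everything satisfies every request.
`size` is the length of the description of the universe (elements, nodes, ...). -/
structure Network where
  numElems : ℕ
  cost : Fin numElems → ℝ≥0
  Req : Type u
  serves : Req → Finset (Fin numElems) → Prop
  serves_mono : ∀ q S T, S ⊆ T → serves q S → serves q T
  serves_univ : ∀ q, serves q Finset.univ
  size : ℕ
  numElems_le_size : numElems ≤ size

namespace Network

/-- The sets of elements of a universe. -/
abbrev Sets (N : Network.{u}) : Type := Finset (Fin N.numElems)

/-- Cost of the element set `S`. -/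
def setCost (N : Network.{u}) (S : N.Sets) : ℝ≥0 := ∑ e ∈ S, N.cost e

open Classical in
/-- Cost of the solution `S` in the prize-collecting problem in which the elements of `E₀` are
free and the requests, with their penalties, are listed in `Q`: cost of the elements bought, plus
the penalties of the requests that `S` does not serve. -/
def pcCost (N : Network.{u}) (E₀ : N.Sets) (Q : List (N.Req × ℝ≥0)) (S : N.Sets) : ℝ≥0 :=
  (∑ e ∈ S, if e ∈ E₀ then 0 else N.cost e) +
    (Q.map fun x => if N.serves x.1 S then 0 else x.2).sum

end Network

/-- A request of the online problem: what it asks for, when it is released, and its delay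
function. -/
structure Request (N : Network.{u}) where
  kind : N.Req
  release : ℝ
  delay : ℝ → ℝ≥0
  delay_continuous : Continuous delay
  delay_mono : Monotone delay
  delay_tendsto : Filter.Tendsto delay Filter.atTop Filter.atTop

/-- An input of the online problem lists its requests by order of release. -/
def IsInput {N : Network.{u}} (L : List (Request N)) : Prop :=
  L.Pairwise fun q q' => q.release ≤ q'.release

/-- A schedule: a finite list of transmissions (time, transmitted set). -/
abbrev Schedule (N : Network.{u}) : Type := List (ℝ × N.Sets)

/-- Delay paid by `q` under the schedule `σ`: its delay at the first transmission, at or after its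
release, that serves it (an infimum suffices, as the delay is nondecreasing); `∞` if there is no
such transmission. -/
def delayCost {N : Network.{u}} (σ : Schedule N) (q : Request N) : ℝ≥0∞ :=
  ⨅ s ∈ σ, ⨅ _ : q.release ≤ s.1 ∧ N.serves q.kind s.2, (q.delay s.1 : ℝ≥0∞)

/-- Total cost of a schedule: transmission costs plus delay costs. -/
def scheduleCost {N : Network.{u}} (L : List (Request N)) (σ : Schedule N) : ℝ≥0∞ :=
  (σ.map fun s => (N.setCost s.2 : ℝ≥0∞)).sum + (L.map fun q => delayCost σ q).sum

/-- The offline optimum. -/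
def opt {N : Network.{u}} (L : List (Request N)) : ℝ≥0∞ :=
  ⨅ σ : Schedule N, scheduleCost L σ

/-! ## Algorithms for the prize-collecting problem

An algorithm is seen through what it returns and how many steps it takes: `Solver Id N` for a
deterministic algorithm, `Solver PMF N` for a randomized one (the joint law of the answer and of
the number of steps, in one fresh run).  The arguments are the set of elements made free and the
list of requests with penalties. -/

abbrev Solver (m : Type → Type) (N : Network.{u}) :=
  N.Sets → List (N.Req × ℝ≥0) → m (N.Sets × ℕ)

section Solvers

variable {ι : Type v} {N : ι → Network.{u}}

/-- Deterministic `γ`-approximation. -/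
def DetApprox (A : ∀ i, Solver Id (N i)) (γ : ι → ℝ≥0) : Prop :=
  ∀ i E₀ Q S, (N i).pcCost E₀ Q (Id.run (A i E₀ Q)).1 ≤ γ i * (N i).pcCost E₀ Q S

/-- Randomized `γ`-approximation; the guarantee holds in every run (of positive
probability). -/
def RandApprox (A : ∀ i, Solver PMF (N i)) (γ : ι → ℝ≥0) : Prop :=
  ∀ i E₀ Q S, ∀ x ∈ (A i E₀ Q).support, (N i).pcCost E₀ Q x.1 ≤ γ i * (N i).pcCost E₀ Q S

/-- Polynomial time in the size of the universe plus the number of requests. -/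
def DetSolverPolyTime (A : ∀ i, Solver Id (N i)) : Prop :=
  ∃ p : Polynomial ℕ, ∀ i E₀ Q, (Id.run (A i E₀ Q)).2 ≤ p.eval ((N i).size + Q.length)

/-- Expected polynomial time. -/
def RandSolverPolyTime (A : ∀ i, Solver PMF (N i)) : Prop :=
  ∃ p : Polynomial ℕ, ∀ i E₀ Q,
    ∑' x, A i E₀ Q x * (x.2 : ℝ≥0∞) ≤ (p.eval ((N i).size + Q.length) : ℕ)

end Solvers

/-! ## The machine that online algorithms run on

A random access machine with arrays of natural numbers, of reals and of sets of elements.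
Real arithmetic is exact; a program is a finite syntactic object, the same for every universe and
every input.  Arrays and registers are named by numbers, a register being entry `0` of an
array. -/

/-- Expressions for natural numbers. -/
inductive NatExp where
  | lit (n : ℕ)
  | get (a : ℕ) (i : NatExp)
  | add (x y : NatExp)
  | sub (x y : NatExp)
  /-- the number of elements of the universe -/
  | numElems
  /-- the number of requests released so far -/
  | numReqs

/-- Expressions for reals. -/
inductive RealExp where
  | get (a : ℕ) (i : NatExp)
  | ofNat (n : NatExp)
  | add (x y : RealExp)
  | sub (x y : RealExp)
  | mulNat (x : RealExp) (n : NatExp)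
  | divNat (x : RealExp) (n : NatExp)
  /-- multiplication by the approximation ratio -/
  | mulRatio (x : RealExp)
  /-- division by the approximation ratio -/
  | divRatio (x : RealExp)
  /-- the largest power of two that is at most `x`, for `x > 0` (and `1` otherwise) -/
  | pow2Floor (x : RealExp)
  /-- the cost of the element number `e` -/
  | cost (e : NatExp)
  /-- the delay at time `t` of the request number `q` -/
  | delay (q : NatExp) (t : RealExp)
  /-- the current time -/
  | now

/-- Expressions for sets of elements. -/
inductive SetExp where
  | get (a : ℕ) (i : NatExp)
  | empty
  | single (e : NatExp)
  | union (S T : SetExp)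
  | sdiff (S T : SetExp)

/-- Tests. -/
inductive Test where
  | natLt (x y : NatExp)
  | realLt (x y : RealExp)
  | mem (e : NatExp) (S : SetExp)
  | not (b : Test)
  | and (b b' : Test)

/-- Programs. -/
inductive Prog where
  | skip
  | setNat (a : ℕ) (i : NatExp) (x : NatExp)
  | setReal (a : ℕ) (i : NatExp) (x : RealExp)
  | setSet (a : ℕ) (i : NatExp) (S : SetExp)
  | seq (P P' : Prog)
  | ite (b : Test) (P P' : Prog)
  /-- run `P` for each value `0, ..., count - 1` of the natural register `r` -/
  | loop (r : ℕ) (count : NatExp) (P : Prog)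
  /-- call the prize-collecting algorithm with the elements of `E₀` free, on the released requests
  `q` with a nonzero entry `q` in the natural array `mask`, the penalties being read in the real
  array `pen`; the answer goes to the set register `dest` -/
  | solve (E₀ : SetExp) (mask pen dest : ℕ)
  /-- put in the real register `dest` the first time from now on at which the sum, over the
  released requests `q` in `mask`, of the positive part of delay minus entry `q` of the real array
  `off`, reaches `θ` -/
  | crossing (mask off : ℕ) (θ : RealExp) (dest : ℕ)
  /-- transmit `S`, now -/
  | transmit (S : SetExp)
  /-- ask to be woken up at time `t` (this replaces any earlier such demand) -/
  | setAlarm (t : RealExp)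
  | clearAlarm

/-- Contents of the machine, with the alarm, the transmissions made and the number of steps taken so
far. -/
structure Mem (n : ℕ) where
  nat : ℕ → ℕ → ℕ
  real : ℕ → ℕ → ℝ
  set : ℕ → ℕ → Finset (Fin n)
  alarm : Option ℝ
  sent : List (ℝ × Finset (Fin n))
  steps : ℕ

/-- The array `f` with entry `i` of array `a` replaced by `x`. -/
def store {α : Type} (f : ℕ → ℕ → α) (a i : ℕ) (x : α) : ℕ → ℕ → α :=
  Function.update f a (Function.update (f a) i x)

/-- Count `t` more steps. -/
def Mem.tick {n : ℕ} (s : Mem n) (t : ℕ) : Mem n := { s with steps := s.steps + t }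

/-! Number of steps taken to evaluate an expression: one for each operation, and `n + 1` for each
operation on sets of elements, `n` being the number of elements. -/

def NatExp.steps : NatExp → ℕ
  | lit _ => 1
  | get _ i => i.steps + 1
  | add x y => x.steps + y.steps + 1
  | sub x y => x.steps + y.steps + 1
  | numElems => 1
  | numReqs => 1

def RealExp.steps : RealExp → ℕ
  | get _ i => i.steps + 1
  | ofNat n => n.steps + 1
  | add x y => x.steps + y.steps + 1
  | sub x y => x.steps + y.steps + 1
  | mulNat x n => x.steps + n.steps + 1
  | divNat x n => x.steps + n.steps + 1
  | mulRatio x => x.steps + 1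
  | divRatio x => x.steps + 1
  | pow2Floor x => x.steps + 1
  | cost e => e.steps + 1
  | delay q t => q.steps + t.steps + 1
  | now => 1

def SetExp.steps (n : ℕ) : SetExp → ℕ
  | get _ i => i.steps + (n + 1)
  | empty => n + 1
  | single e => e.steps + (n + 1)
  | union S T => S.steps n + T.steps n + (n + 1)
  | sdiff S T => S.steps n + T.steps n + (n + 1)

def Test.steps (n : ℕ) : Test → ℕ
  | natLt x y => x.steps + y.steps + 1
  | realLt x y => x.steps + y.steps + 1
  | mem e S => e.steps + S.steps n + 1
  | not b => b.steps n + 1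
  | and b b' => b.steps n + b'.steps n + 1

/-! Values.  `γ` is the approximation ratio, `known` lists the requests released so far and `t` is
the current time; an index that is out of range yields `0` or the empty set. -/

section Semantics

variable {N : Network.{u}} (γ : ℝ≥0) (known : List (Request N)) (t : ℝ)

def NatExp.val (s : Mem N.numElems) : NatExp → ℕ
  | lit n => n
  | get a i => s.nat a (i.val s)
  | add x y => x.val s + y.val s
  | sub x y => x.val s - y.val s
  | numElems => N.numElems
  | numReqs => known.length

def RealExp.val (s : Mem N.numElems) : RealExp → ℝ
  | get a i => s.real a (i.val known s)
  | ofNat n => (n.val known s : ℝ)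
  | add x y => x.val s + y.val s
  | sub x y => x.val s - y.val s
  | mulNat x n => x.val s * (n.val known s : ℝ)
  | divNat x n => x.val s / (n.val known s : ℝ)
  | mulRatio x => x.val s * (γ : ℝ)
  | divRatio x => x.val s / (γ : ℝ)
  | pow2Floor x => (2 : ℝ) ^ Int.log 2 (x.val s)
  | cost e => if h : e.val known s < N.numElems then (N.cost ⟨e.val known s, h⟩ : ℝ) else 0
  | delay q x =>
      match known[q.val known s]? with
      | some r => (r.delay (x.val s) : ℝ)
      | none => 0
  | now => t

def SetExp.val (s : Mem N.numElems) : SetExp → N.Sets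
  | get a i => s.set a (i.val known s)
  | empty => ∅
  | single e => Finset.univ.filter fun x : Fin N.numElems => (x : ℕ) = e.val known s
  | union S T => S.val s ∪ T.val s
  | sdiff S T => S.val s \ T.val s

def Test.holds (s : Mem N.numElems) : Test → Prop
  | natLt x y => x.val known s < y.val known s
  | realLt x y => x.val γ known t s < y.val γ known t s
  | mem e S => ∃ x ∈ S.val known s, (x : ℕ) = e.val known s
  | not b => ¬ b.holds s
  | and b b' => b.holds s ∧ b'.holds s

/-- The requests, with penalties, that a call to the prize-collecting algorithm is made on. -/
def callList (s : Mem N.numElems) (mask pen : ℕ) : List (N.Req × ℝ≥0) :=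
  known.zipIdx.filterMap fun x =>
    if s.nat mask x.2 = 0 then none else some (x.1.kind, (s.real pen x.2).toNNReal)

/-- The sum, over the requests in `mask`, of the positive part of delay at time `t'` minus
offset. -/
def excess (s : Mem N.numElems) (mask off : ℕ) (t' : ℝ) : ℝ :=
  (known.zipIdx.map fun x =>
    if s.nat mask x.2 = 0 then 0 else max 0 ((x.1.delay t' : ℝ) - s.real off x.2)).sum

open Classical in
/-- Execution of a program, in the monad of the prize-collecting algorithm `A`. -/
def exec {m : Type → Type} [Monad m] (A : Solver m N) :
    Prog → Mem N.numElems → m (Mem N.numElems)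
  | .skip, s => pure (s.tick 1)
  | .setNat a i x, s =>
      pure { s.tick (i.steps + x.steps + 1) with
        nat := store s.nat a (i.val known s) (x.val known s) }
  | .setReal a i x, s =>
      pure { s.tick (i.steps + x.steps + 1) with
        real := store s.real a (i.val known s) (x.val γ known t s) }
  | .setSet a i S, s =>
      pure { s.tick (i.steps + S.steps N.numElems + 1) with
        set := store s.set a (i.val known s) (S.val known s) }
  | .seq P P', s => do
      let s' ← exec A P s
      exec A P' s'
  | .ite b P P', s =>
      if b.holds γ known t s then exec A P (s.tick (b.steps N.numElems + 1))
      else exec A P' (s.tick (b.steps N.numElems + 1))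
  | .loop r count P, s =>
      (List.range (count.val known s)).foldlM
        (fun s' j => exec A P { s'.tick 1 with nat := store s'.nat r 0 j })
        (s.tick (count.steps + 1))
  | .solve E₀ mask pen dest, s => do
      let ans ← A (E₀.val known s) (callList known s mask pen)
      pure { s.tick (E₀.steps N.numElems + known.length + ans.2 + N.numElems + 1) with
        set := store s.set dest 0 ans.1 }
  | .crossing mask off θ dest, s =>
      pure { s.tick (θ.steps + known.length + 1) with
        real := store s.real dest 0
          (sInf {t' : ℝ | t ≤ t' ∧ θ.val γ known t s ≤ excess known s mask off t'}) }
  | .transmit S, s =>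
      pure { s.tick (S.steps N.numElems + 1) with sent := s.sent ++ [(t, S.val known s)] }
  | .setAlarm x, s =>
      pure { s.tick (x.steps + 1) with alarm := some (x.val γ known t s) }
  | .clearAlarm, s => pure { s.tick 1 with alarm := none }

end Semantics

/-! ## Online algorithms and their runs -/

/-- An online algorithm: what to do when a request is released, and when the alarm goes off. -/
structure OnlineAlg where
  onRequest : Prog
  onAlarm : Prog

/-- A run in progress: contents of the machine, number of requests released, current time. -/
structure Config (n : ℕ) where
  mem : Mem n
  released : ℕ
  clock : ℝ

/-- Before the first event, the memory is blank. -/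
def Config.start (n : ℕ) : Config n :=
  { mem := { nat := fun _ _ => 0, real := fun _ _ => 0, set := fun _ _ => ∅,
             alarm := none, sent := [], steps := 0 }
    released := 0
    clock := 0 }

section Runs

variable {m : Type → Type} [Monad m] {N : Network.{u}}

/-- The next request is released, at time `r`: the program `onRequest` runs, and knows this request
and the previous ones, with their delay functions. -/
def releaseEvent (B : OnlineAlg) (γ : ℝ≥0) (A : Solver m N) (L : List (Request N)) (r : ℝ)
    (c : Config N.numElems) : m (Config N.numElems) := do
  let s ← exec γ (L.take (c.released + 1)) r A B.onRequest c.mem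
  pure { mem := s, released := c.released + 1, clock := r }

/-- The alarm goes off, at time `a`, or at once if this time is past: the program `onAlarm`
runs. -/
def alarmEvent (B : OnlineAlg) (γ : ℝ≥0) (A : Solver m N) (L : List (Request N)) (a : ℝ)
    (c : Config N.numElems) : m (Config N.numElems) := do
  let s ← exec γ (L.take c.released) (max c.clock a) A B.onAlarm { c.mem with alarm := none }
  pure { mem := s, released := c.released, clock := max c.clock a }

open Classical in
/-- The next event: the next release or the alarm, whichever comes first. -/
def nextEvent (B : OnlineAlg) (γ : ℝ≥0) (A : Solver m N) (L : List (Request N))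
    (c : Config N.numElems) : m (Config N.numElems) :=
  match L[c.released]?, c.mem.alarm with
  | none, none => pure c
  | some q, none => releaseEvent B γ A L q.release c
  | none, some a => alarmEvent B γ A L a c
  | some q, some a =>
      if q.release ≤ a then releaseEvent B γ A L q.release c else alarmEvent B γ A L a c

/-- The run after `T` events. -/
def runEvents (B : OnlineAlg) (γ : ℝ≥0) (A : Solver m N) (L : List (Request N)) :
    ℕ → m (Config N.numElems)
  | 0 => pure (Config.start N.numElems)
  | T + 1 => do
      let c ← runEvents B γ A L T
      nextEvent B γ A L c

/-- The run is over: all requests have been released and no alarm is set. -/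
def Finished (L : List (Request N)) (c : Config N.numElems) : Prop :=
  c.released = L.length ∧ c.mem.alarm = none

end Runs

section Guarantees

variable {ι : Type v} {N : ι → Network.{u}}

/-- The online algorithm `B`, with the deterministic subroutine `A`, is `ρ i k`-competitive on the
inputs with `k` requests in the universe `N i`. -/
def DetCompetitive (B : OnlineAlg) (A : ∀ i, Solver Id (N i)) (γ : ι → ℝ≥0)
    (ρ : ι → ℕ → ℝ) : Prop :=
  ∀ i (L : List (Request (N i))), IsInput L →
    ∃ T, Finished L (Id.run (runEvents B (γ i) (A i) L T)) ∧
      scheduleCost L (Id.run (runEvents B (γ i) (A i) L T)).mem.sent ≤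
        ENNReal.ofReal (ρ i L.length) * opt L

/-- The same with a randomized subroutine, whatever the outcome of its calls. -/
def RandCompetitive (B : OnlineAlg) (A : ∀ i, Solver PMF (N i)) (γ : ι → ℝ≥0)
    (ρ : ι → ℕ → ℝ) : Prop :=
  ∀ i (L : List (Request (N i))), IsInput L →
    ∃ T, ∀ c ∈ (runEvents B (γ i) (A i) L T).support, Finished L c ∧
      scheduleCost L c.mem.sent ≤ ENNReal.ofReal (ρ i L.length) * opt L

/-- The total number of steps of the run, those of the subroutine included, is polynomial in the
size of the universe plus the number of requests. -/
def DetPolyTime (B : OnlineAlg) (A : ∀ i, Solver Id (N i)) (γ : ι → ℝ≥0) : Prop :=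
  ∃ p : Polynomial ℕ, ∀ i (L : List (Request (N i))), IsInput L →
    ∀ T, (Id.run (runEvents B (γ i) (A i) L T)).mem.steps ≤ p.eval ((N i).size + L.length)

/-- The same for the expected total number of steps. -/
def RandPolyTime (B : OnlineAlg) (A : ∀ i, Solver PMF (N i)) (γ : ι → ℝ≥0) : Prop :=
  ∃ p : Polynomial ℕ, ∀ i (L : List (Request (N i))), IsInput L →
    ∀ T, ∑' c, runEvents B (γ i) (A i) L T c * (c.mem.steps : ℝ≥0∞) ≤
      (p.eval ((N i).size + L.length) : ℕ)

end Guarantees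

end

end NDDelay

/-!
The online algorithm keeps, for each pending request `q`, an individual solution, found by calling
the subroutine on `q` alone with a prohibitive penalty; an offset, which is the amount of delay
already accounted for, so that only the residual delay, in excess of the offset, matters; and a
level, a power of two, initially the cost of the individual solution divided by `γ`, rounded down.
When, for some level `v = 2 ^ j`, the residual delay of the pending requests of level at most `v`
reaches `v`, there is a service at level `w = 2v`.  It transmits

* the elements whose cost, times the number `n` of elements, is at most `w` (the free elements);
* the individual solutions of the requests of level at most `w` that are cheap, in that this
  solution costs at most `γw / k`, where `k` is the number of requests so far;
* a solution of the prize-collecting problem on the other requests of level at most `w`, with the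
  free elements, for the residual delays at a time `x`.  It is found by forwarding: `x` moves on
  to the moment when the requests not yet served have a residual delay of `2γw`, as long as the
  subroutine then finds a solution of cost at most `γw`.

The requests of level at most `w` that are not served get level `w`, and their offsets are raised
to the delay at `x`.  Such a request is not cheap, so its level can be doubled `O(log k)` times
only, whence the number of events is polynomial; forwarding takes `O(k)` rounds, since each of
them raises by `γw` the sum of the residual delays truncated at `2γw`.  As loop bounds do not
depend on values in memory, each event takes polynomial time (`exists_expect_steps_le`).

A service costs at most `6γw` (`Basic.spent_service`), and is charged to a given offline solution
`σ` as follows (`Charge`).  If requests remain pending after a service at level `w`, then no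
solution of the prize-collecting problem at time `x` costs less than `w`.  Hence
(`Charge.zpow_le`) `w` is at most the cost of what `σ` transmits between the last service
triggered at level `w` and the time `x`, plus the delay of `σ` that the raised offsets newly
cover; here free elements do not count, nor do transmissions of cost at most `w / k`, as the
requests they serve are cheap.  The next service triggered at level `w` is paid for by this
amount, because it occurs after `x` if the residual delay of these requests contributes to it.
Otherwise it is triggered by requests at their initial level, and either `σ` has served one of
them, at a cost of at least that level, or `σ` is still paying for their delay (`Charge.trigger`).

The windows of time used for the services triggered at a given level are disjoint, so a
transmission of `σ` is charged at most its `share` at each level.  The levels below its cost `c`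
add up to at most `2c`. At higher levels it is charged between `c` and `kc` only, and each of its
elements `e` between `c(e)` and `n c(e)` only, so that the total is `O(c (1 + log (min k n)))`
(`tsum_share_le`).

A deterministic subroutine is a randomized one whose outcomes have probability one, so the same
program and the same analysis do for both cases.
-/

namespace NDDelay

noncomputable section

/-! ### Deterministic subroutines as randomized ones -/

/-- A deterministic subroutine, seen as a randomized one. -/
def Solver.toPMF {N : Network.{u}} (A : Solver Id N) : Solver PMF N :=
  fun E₀ Q => PMF.pure (Id.run (A E₀ Q))

theorem pmf_pure_bind {α β : Type} (a : α) (f : α → PMF β) : (pure a >>= f) = f a :=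
  PMF.pure_bind a f

theorem foldlM_pure {α β : Type} (f : β → α → Id β) (l : List α) (b : β) :
    l.foldlM (m := PMF) (fun b a => pure (Id.run (f b a))) b = pure (Id.run (l.foldlM f b)) := by
  induction l generalizing b with
  | nil => rfl
  | cons a l ih =>
    simp only [List.foldlM_cons]
    rw [pmf_pure_bind, ih]
    rfl

section
variable {N : Network.{u}} (γ : ℝ≥0) (known : List (Request N)) (t : ℝ) (A : Solver Id N)

theorem exec_toPMF (P : Prog) (s : Mem N.numElems) :
    exec γ known t A.toPMF P s = pure (Id.run (exec γ known t A P s)) := by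
  induction P generalizing s with
  | seq P P' ih ih' =>
    simp only [exec]
    rw [ih, pmf_pure_bind, ih']
    rfl
  | ite b P P' ih ih' =>
    simp only [exec]
    split_ifs
    · exact ih _
    · exact ih' _
  | loop r c P ih =>
    simp only [exec, ih]
    exact foldlM_pure _ _ _
  | solve E mask pen dest =>
    simp only [exec, Solver.toPMF]
    exact pmf_pure_bind _ _
  | _ => rfl

theorem runEvents_toPMF (B : OnlineAlg) (L : List (Request N)) (T : ℕ) :
    runEvents B γ A.toPMF L T = pure (Id.run (runEvents B γ A L T)) := by
  induction T with
  | zero => rfl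
  | succ T ih =>
    have step : ∀ c, nextEvent B γ A.toPMF L c = pure (Id.run (nextEvent B γ A L c)) := by
      intro c
      have hr : ∀ r, releaseEvent B γ A.toPMF L r c =
          pure (Id.run (releaseEvent B γ A L r c)) := by
        intro r
        simp only [releaseEvent]
        rw [exec_toPMF, pmf_pure_bind]
        rfl
      have ha : ∀ a, alarmEvent B γ A.toPMF L a c = pure (Id.run (alarmEvent B γ A L a c)) := by
        intro a
        simp only [alarmEvent]
        rw [exec_toPMF, pmf_pure_bind]
        rfl
      unfold nextEvent
      split
      · rfl
      · exact hr _
      · exact ha _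
      · split_ifs
        · exact hr _
        · exact ha _
    simp only [runEvents]
    rw [ih, pmf_pure_bind, step]
    rfl
end

/-! ### Expectations and expected running times -/

/-- The expectation of a nonnegative function under a probability mass function. -/
def expect {α : Type} (μ : PMF α) (f : α → ℝ≥0∞) : ℝ≥0∞ := ∑' x, μ x * f x

theorem expect_pure {α : Type} (a : α) (f : α → ℝ≥0∞) : expect (pure a) f = f a := by
  change ∑' x, PMF.pure a x * f x = f a
  rw [tsum_eq_single a]
  · simp
  · intro b hb
    simp [PMF.pure_apply_of_ne _ _ hb]

theorem expect_bind {α β : Type} (μ : PMF α) (g : α → PMF β) (f : β → ℝ≥0∞) :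
    expect (μ >>= g) f = expect μ fun a => expect (g a) f := by
  change ∑' x, (μ.bind g) x * f x = _
  simp only [expect, PMF.bind_apply, ← ENNReal.tsum_mul_right, ← ENNReal.tsum_mul_left]
  rw [ENNReal.tsum_comm]
  simp only [mul_assoc]

theorem expect_mono {α : Type} (μ : PMF α) {f g : α → ℝ≥0∞} (h : ∀ x ∈ μ.support, f x ≤ g x) :
    expect μ f ≤ expect μ g := by
  refine ENNReal.tsum_le_tsum fun x => ?_
  by_cases hx : x ∈ μ.support
  · exact mul_le_mul_right (h x hx) _
  · rw [PMF.mem_support_iff, not_not] at hx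
    simp [hx]

theorem expect_add_const {α : Type} (μ : PMF α) (f : α → ℝ≥0∞) (c : ℝ≥0∞) :
    expect μ (fun x => f x + c) = expect μ f + c := by
  simp only [expect, mul_add, ENNReal.tsum_add, ENNReal.tsum_mul_right, PMF.tsum_coe, one_mul]

theorem polynomial_eval_mono (p : Polynomial ℕ) {x y : ℕ} (h : x ≤ y) : p.eval x ≤ p.eval y := by
  induction p using Polynomial.induction_on' with
  | add p q hp hq => simpa using add_le_add hp hq
  | monomial n a => simpa using Nat.mul_le_mul_left _ (Nat.pow_le_pow_left h n)

/-- No value read from the memory occurs in the expression. -/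
def NatExp.IsStatic : NatExp → Prop
  | .lit _ => True
  | .get _ _ => False
  | .add x y => x.IsStatic ∧ y.IsStatic
  | .sub x y => x.IsStatic ∧ y.IsStatic
  | .numElems => True
  | .numReqs => True

/-- The number of rounds of each loop is read off the universe and the number of requests, not
from the memory. -/
def Prog.IsStatic : Prog → Prop
  | .seq P P' => P.IsStatic ∧ P'.IsStatic
  | .ite _ P P' => P.IsStatic ∧ P'.IsStatic
  | .loop _ c P => c.IsStatic ∧ P.IsStatic
  | _ => True

theorem NatExp.IsStatic.exists_val_le {x : NatExp} (hx : x.IsStatic) : ∃ p : Polynomial ℕ,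
    ∀ (N : Network.{u}) (known : List (Request N)) (s : Mem N.numElems) (y : ℕ),
      N.numElems ≤ y → known.length ≤ y → x.val known s ≤ p.eval y := by
  induction x with
  | lit n => exact ⟨.C n, by intros; simp [NatExp.val]⟩
  | get a i => exact hx.elim
  | add x x' ih ih' =>
    obtain ⟨p, hp⟩ := ih hx.1
    obtain ⟨p', hp'⟩ := ih' hx.2
    refine ⟨p + p', fun N known s y h h' => ?_⟩
    simpa [NatExp.val] using add_le_add (hp N known s y h h') (hp' N known s y h h')
  | sub x x' ih ih' =>
    obtain ⟨p, hp⟩ := ih hx.1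
    exact ⟨p, fun N known s y h h' => (Nat.sub_le _ _).trans (hp N known s y h h')⟩
  | numElems => exact ⟨.X, by intros; simpa [NatExp.val]⟩
  | numReqs => exact ⟨.X, by intros; simpa [NatExp.val]⟩

theorem SetExp.exists_steps_le (S : SetExp) : ∃ p : Polynomial ℕ,
    ∀ n y : ℕ, n ≤ y → S.steps n ≤ p.eval y := by
  induction S with
  | get a i => exact ⟨.C i.steps + (.X + 1), fun n y h => by simpa [SetExp.steps] using h⟩
  | empty => exact ⟨.X + 1, fun n y h => by simpa [SetExp.steps] using h⟩
  | single i => exact ⟨.C i.steps + (.X + 1), fun n y h => by simpa [SetExp.steps] using h⟩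
  | union S T ih ih' =>
    obtain ⟨p, hp⟩ := ih
    obtain ⟨p', hp'⟩ := ih'
    refine ⟨p + p' + (.X + 1), fun n y h => ?_⟩
    have := hp n y h
    have := hp' n y h
    simp [SetExp.steps]
    lia
  | sdiff S T ih ih' =>
    obtain ⟨p, hp⟩ := ih
    obtain ⟨p', hp'⟩ := ih'
    refine ⟨p + p' + (.X + 1), fun n y h => ?_⟩
    have := hp n y h
    have := hp' n y h
    simp [SetExp.steps]
    lia

theorem Test.exists_steps_le (b : Test) : ∃ p : Polynomial ℕ,
    ∀ n y : ℕ, n ≤ y → b.steps n ≤ p.eval y := by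
  induction b with
  | natLt x x' => exact ⟨.C (x.steps + x'.steps + 1), fun n y h => by simp [Test.steps]⟩
  | realLt x x' => exact ⟨.C (x.steps + x'.steps + 1), fun n y h => by simp [Test.steps]⟩
  | mem e S =>
    obtain ⟨p, hp⟩ := S.exists_steps_le
    refine ⟨.C e.steps + p + 1, fun n y h => ?_⟩
    have := hp n y h
    simp [Test.steps]
    lia
  | not b ih =>
    obtain ⟨p, hp⟩ := ih
    refine ⟨p + 1, fun n y h => ?_⟩
    have := hp n y h
    simp [Test.steps]
    lia
  | and b b' ih ih' =>
    obtain ⟨p, hp⟩ := ih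
    obtain ⟨p', hp'⟩ := ih'
    refine ⟨p + p' + 1, fun n y h => ?_⟩
    have := hp n y h
    have := hp' n y h
    simp [Test.steps]
    lia

theorem expect_foldlM_le {α β : Type} (f : β → α → PMF β) (T : β → ℝ≥0∞) (c : ℝ≥0∞)
    (h : ∀ b a, expect (f b a) T ≤ T b + c) (l : List α) (b : β) :
    expect (l.foldlM f b) T ≤ T b + l.length * c := by
  induction l generalizing b with
  | nil => simp [expect_pure]
  | cons a l ih =>
    rw [List.foldlM_cons, expect_bind]
    calc expect (f b a) (fun b' => expect (l.foldlM f b') T)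
        ≤ expect (f b a) (fun b' => T b' + l.length * c) := expect_mono _ fun b' _ => ih b'
      _ = expect (f b a) T + l.length * c := expect_add_const _ _ _
      _ ≤ T b + c + l.length * c := by gcongr; exact h b a
      _ = _ := by rw [List.length_cons]; push_cast; ring

section
variable {ι : Type v} {N : ι → Network.{u}} (A : ∀ i, Solver PMF (N i)) (γ : ι → ℝ≥0)

theorem callList_length_le {N : Network.{u}} (known : List (Request N)) (s : Mem N.numElems)
    (mask pen : ℕ) : (callList known s mask pen).length ≤ known.length := by
  refine (List.length_filterMap_le _ _).trans ?_
  simp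

/-- With a subroutine of expected polynomial time, every static program takes expected polynomial
time. -/
theorem exists_expect_steps_le (hA : RandSolverPolyTime A) {P : Prog} (hP : P.IsStatic) :
    ∃ p : Polynomial ℕ, ∀ i (known : List (Request (N i))) (t : ℝ) (s : Mem (N i).numElems),
      expect (exec (γ i) known t (A i) P s) (fun s' => (s'.steps : ℝ≥0∞)) ≤
        s.steps + (p.eval ((N i).size + known.length) : ℕ) := by
  have hn : ∀ i (known : List (Request (N i))), (N i).numElems ≤ (N i).size + known.length :=
    fun i known => (N i).numElems_le_size.trans (Nat.le_add_right _ _)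
  have key : ∀ (p : Polynomial ℕ) (i : ι) (known : List (Request (N i))) (s s' : Mem (N i).numElems)
      (T : ℕ), s'.steps = s.steps + T → T ≤ p.eval ((N i).size + known.length) →
      expect (pure s') (fun s' => (s'.steps : ℝ≥0∞)) ≤
        s.steps + (p.eval ((N i).size + known.length) : ℕ) := by
    intro p i known s s' T h h'
    rw [expect_pure, h]
    exact_mod_cast Nat.add_le_add_left h' _
  induction P with
  | skip =>
    exact ⟨1, fun i known t s => key 1 i known s _ 1 rfl (by simp)⟩
  | setNat a j x =>
    exact ⟨.C (j.steps + x.steps + 1), fun i known t s => key _ i known s _ _ rfl (by simp)⟩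
  | setReal a j x =>
    exact ⟨.C (j.steps + x.steps + 1), fun i known t s => key _ i known s _ _ rfl (by simp)⟩
  | setSet a j S =>
    obtain ⟨q, hq⟩ := S.exists_steps_le
    refine ⟨.C j.steps + q + 1, fun i known t s => key _ i known s _ _ rfl ?_⟩
    simpa using hq _ _ (hn i known)
  | seq P P' ih ih' =>
    obtain ⟨p, hp⟩ := ih hP.1
    obtain ⟨p', hp'⟩ := ih' hP.2
    refine ⟨p + p', fun i known t s => ?_⟩
    simp only [exec]
    rw [expect_bind]
    refine (expect_mono _ fun s' _ => hp' i known t s').trans ?_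
    rw [expect_add_const]
    refine (add_le_add (hp i known t s) le_rfl).trans (le_of_eq ?_)
    simp only [Polynomial.eval_add]
    push_cast
    ring
  | ite b P P' ih ih' =>
    obtain ⟨p, hp⟩ := ih hP.1
    obtain ⟨p', hp'⟩ := ih' hP.2
    obtain ⟨q, hq⟩ := b.exists_steps_le
    refine ⟨q + 1 + p + p', fun i known t s => ?_⟩
    have hq := hq _ _ (hn i known)
    simp only [exec]
    split_ifs
    · refine (hp i known t _).trans ?_
      simp only [Mem.tick, Polynomial.eval_add, Polynomial.eval_one]
      norm_cast
      lia
    · refine (hp' i known t _).trans ?_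
      simp only [Mem.tick, Polynomial.eval_add, Polynomial.eval_one]
      norm_cast
      lia
  | loop r c P ih =>
    obtain ⟨p, hp⟩ := ih hP.2
    obtain ⟨q, hq⟩ := hP.1.exists_val_le
    refine ⟨.C (c.steps + 1) + q * (1 + p), fun i known t s => ?_⟩
    have hq := hq (N i) known s _ (hn i known) (Nat.le_add_left _ _)
    simp only [exec]
    refine (expect_foldlM_le _ _ ((1 + p.eval ((N i).size + known.length) : ℕ) : ℝ≥0∞) ?_ _
      _).trans ?_
    · intro s' j
      refine (hp i known t _).trans (le_of_eq ?_)
      simp only [Mem.tick]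
      push_cast
      ring
    · simp only [Mem.tick, List.length_range, Polynomial.eval_add, Polynomial.eval_one,
        Polynomial.eval_mul, Polynomial.eval_C]
      norm_cast
      have := Nat.mul_le_mul_right (1 + p.eval ((N i).size + known.length)) hq
      lia
  | solve E mask pen dest =>
    obtain ⟨p, hp⟩ := hA
    obtain ⟨q, hq⟩ := E.exists_steps_le
    refine ⟨q + .X + p + .X + 1, fun i known t s => ?_⟩
    have hq := hq _ _ (hn i known)
    have h1 := hp i (E.val known s) (callList known s mask pen)
    have h2 := polynomial_eval_mono p (Nat.add_le_add_left (callList_length_le known s mask pen)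
      (N i).size)
    simp only [exec]
    rw [expect_bind]
    simp only [expect_pure, Mem.tick]
    have : ∀ x : (N i).Sets × ℕ, ((s.steps + (E.steps (N i).numElems + known.length + x.2 +
        (N i).numElems + 1) : ℕ) : ℝ≥0∞) =
        (x.2 : ℝ≥0∞) + ((s.steps + (E.steps (N i).numElems + known.length +
        (N i).numElems + 1) : ℕ) : ℝ≥0∞) := by
      intro x
      push_cast
      ring
    simp only [this]
    rw [expect_add_const]
    refine (add_le_add h1 le_rfl).trans ?_
    simp only [Polynomial.eval_add, Polynomial.eval_one, Polynomial.eval_X]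
    have := hn i known
    norm_cast
    lia
  | crossing mask off θ dest =>
    refine ⟨.C (θ.steps + 1) + .X, fun i known t s => key _ i known s _ _ rfl ?_⟩
    simp
    lia
  | transmit S =>
    obtain ⟨q, hq⟩ := S.exists_steps_le
    refine ⟨q + 1, fun i known t s => key _ i known s _ _ rfl ?_⟩
    simpa using hq _ _ (hn i known)
  | setAlarm x =>
    exact ⟨.C (x.steps + 1), fun i known t s => key _ i known s _ _ rfl (by simp)⟩
  | clearAlarm => exact ⟨1, fun i known t s => key 1 i known s _ 1 rfl (by simp)⟩
end

/-! ### Reasoning about programs -/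

section
variable {N : Network.{u}} (γ : ℝ≥0) (known : List (Request N)) (t : ℝ) (A : Solver PMF N)

/-- The memory `s'` is a possible result of running `P` from the memory `s`. -/
def Runs (P : Prog) (s s' : Mem N.numElems) : Prop :=
  s' ∈ (exec γ known t A P s).support

variable {γ known t A}
variable {s s' : Mem N.numElems}

@[simp] theorem Mem.tick_nat {n : ℕ} (s : Mem n) (k : ℕ) : (s.tick k).nat = s.nat := rfl
@[simp] theorem Mem.tick_real {n : ℕ} (s : Mem n) (k : ℕ) : (s.tick k).real = s.real := rfl
@[simp] theorem Mem.tick_set {n : ℕ} (s : Mem n) (k : ℕ) : (s.tick k).set = s.set := rfl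
@[simp] theorem Mem.tick_alarm {n : ℕ} (s : Mem n) (k : ℕ) : (s.tick k).alarm = s.alarm := rfl
@[simp] theorem Mem.tick_sent {n : ℕ} (s : Mem n) (k : ℕ) : (s.tick k).sent = s.sent := rfl

theorem store_apply {α : Type} (f : ℕ → ℕ → α) (a i : ℕ) (x : α) (b j : ℕ) :
    store f a i x b j = if b = a ∧ j = i then x else f b j := by
  unfold store
  by_cases hb : b = a
  · subst hb
    by_cases hj : j = i <;> simp [hj]
  · simp [hb]

theorem mem_support_pure {α : Type} {a b : α} : b ∈ PMF.support (pure a : PMF α) ↔ b = a :=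
  PMF.mem_support_pure_iff a b

theorem mem_support_bind {α β : Type} {μ : PMF α} {f : α → PMF β} {b : β} :
    b ∈ (μ >>= f).support ↔ ∃ a ∈ μ.support, b ∈ (f a).support :=
  PMF.mem_support_bind_iff μ f b

theorem runs_skip : Runs γ known t A .skip s s' ↔ s' = s.tick 1 := mem_support_pure

theorem runs_setNat {a : ℕ} {i x : NatExp} : Runs γ known t A (.setNat a i x) s s' ↔
    s' = { s.tick (i.steps + x.steps + 1) with
      nat := store s.nat a (i.val known s) (x.val known s) } := mem_support_pure

theorem runs_setReal {a : ℕ} {i : NatExp} {x : RealExp} :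
    Runs γ known t A (.setReal a i x) s s' ↔
    s' = { s.tick (i.steps + x.steps + 1) with
      real := store s.real a (i.val known s) (x.val γ known t s) } := mem_support_pure

theorem runs_setSet {a : ℕ} {i : NatExp} {S : SetExp} :
    Runs γ known t A (.setSet a i S) s s' ↔
    s' = { s.tick (i.steps + S.steps N.numElems + 1) with
      set := store s.set a (i.val known s) (S.val known s) } := mem_support_pure

theorem runs_seq {P P' : Prog} : Runs γ known t A (.seq P P') s s' ↔
    ∃ u, Runs γ known t A P s u ∧ Runs γ known t A P' u s' := mem_support_bind

theorem runs_ite {b : Test} {P P' : Prog} : Runs γ known t A (.ite b P P') s s' ↔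
    (b.holds γ known t s ∧ Runs γ known t A P (s.tick (b.steps N.numElems + 1)) s') ∨
    (¬ b.holds γ known t s ∧ Runs γ known t A P' (s.tick (b.steps N.numElems + 1)) s') := by
  unfold Runs
  simp only [exec]
  split_ifs with h <;> simp [h]

theorem runs_solve {E : SetExp} {mask pen dest : ℕ} :
    Runs γ known t A (.solve E mask pen dest) s s' ↔
    ∃ ans ∈ (A (E.val known s) (callList known s mask pen)).support,
      s' = { s.tick (E.steps N.numElems + known.length + ans.2 + N.numElems + 1) with
        set := store s.set dest 0 ans.1 } := by
  unfold Runs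
  simp only [exec]
  rw [mem_support_bind]
  simp only [mem_support_pure]

theorem runs_crossing {mask off : ℕ} {θ : RealExp} {dest : ℕ} :
    Runs γ known t A (.crossing mask off θ dest) s s' ↔
    s' = { s.tick (θ.steps + known.length + 1) with
        real := store s.real dest 0
          (sInf {t' : ℝ | t ≤ t' ∧ θ.val γ known t s ≤ excess known s mask off t'}) } :=
  mem_support_pure

theorem runs_transmit {S : SetExp} : Runs γ known t A (.transmit S) s s' ↔
    s' = { s.tick (S.steps N.numElems + 1) with sent := s.sent ++ [(t, S.val known s)] } :=
  mem_support_pure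

theorem runs_setAlarm {x : RealExp} : Runs γ known t A (.setAlarm x) s s' ↔
    s' = { s.tick (x.steps + 1) with alarm := some (x.val γ known t s) } :=
  mem_support_pure

theorem runs_clearAlarm : Runs γ known t A .clearAlarm s s' ↔
    s' = { s.tick 1 with alarm := none } :=
  mem_support_pure

theorem foldlM_invariant {β : Type} {f : β → ℕ → PMF β} (Inv : ℕ → β → Prop) {n : ℕ}
    (step : ∀ j < n, ∀ b b', Inv j b → b' ∈ (f b j).support → Inv (j + 1) b') {b b' : β}
    (h0 : Inv 0 b) (h : b' ∈ ((List.range n).foldlM f b).support) : Inv n b' := by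
  induction n generalizing b' with
  | zero =>
    rw [List.range_zero, List.foldlM_nil, mem_support_pure] at h
    exact h ▸ h0
  | succ n ih =>
    have e : (List.range (n + 1)).foldlM f b = (List.range n).foldlM f b >>= fun b' => f b' n := by
      have : ∀ (l : List ℕ) (b : β), (l ++ [n]).foldlM f b = l.foldlM f b >>= fun b' => f b' n := by
        intro l
        induction l with
        | nil =>
          intro b
          simp only [List.nil_append, List.foldlM_cons, List.foldlM_nil, pmf_pure_bind]
          exact PMF.bind_pure _
        | cons a l ih =>
          intro b
          simp only [List.cons_append, List.foldlM_cons, ih]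
          exact (PMF.bind_bind _ _ _).symm
      rw [List.range_succ, this]
    rw [e, mem_support_bind] at h
    obtain ⟨a, ha, hb⟩ := h
    exact step n (Nat.lt_succ_self n) a b'
      (ih (fun j hj => step j (hj.trans (Nat.lt_succ_self n))) ha) hb

/-- The rule for loops: an invariant `Inv j` holds before round `j`. -/
theorem Runs.loop_induction {r : ℕ} {c : NatExp} {P : Prog} (Inv : ℕ → Mem N.numElems → Prop)
    (h : Runs γ known t A (.loop r c P) s s') {n : ℕ} (hn : c.val known s = n)
    (h0 : Inv 0 (s.tick (c.steps + 1)))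
    (step : ∀ j < n, ∀ u u', Inv j u →
      Runs γ known t A P { u.tick 1 with nat := store u.nat r 0 j } u' → Inv (j + 1) u') :
    Inv n s' := by
  subst hn
  exact foldlM_invariant Inv step h0 h

/-- The memories hold the same data, that is, they differ at most in the number of steps. -/
structure SameData {n : ℕ} (u s : Mem n) : Prop where
  nat : u.nat = s.nat
  real : u.real = s.real
  set : u.set = s.set
  sent : u.sent = s.sent
  alarm : u.alarm = s.alarm

theorem Runs.of_setNat {a : ℕ} {i x : NatExp} (h : Runs γ known t A (.setNat a i x) s s') :
    SameData s' { s with nat := store s.nat a (i.val known s) (x.val known s) } := by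
  rw [runs_setNat] at h
  subst h
  constructor <;> rfl

theorem Runs.of_setReal {a : ℕ} {i : NatExp} {x : RealExp}
    (h : Runs γ known t A (.setReal a i x) s s') :
    SameData s' { s with real := store s.real a (i.val known s) (x.val γ known t s) } := by
  rw [runs_setReal] at h
  subst h
  constructor <;> rfl

theorem Runs.of_setSet {a : ℕ} {i : NatExp} {x : SetExp}
    (h : Runs γ known t A (.setSet a i x) s s') :
    SameData s' { s with set := store s.set a (i.val known s) (x.val known s) } := by
  rw [runs_setSet] at h
  subst h
  constructor <;> rfl

theorem Runs.of_skip (h : Runs γ known t A .skip s s') : SameData s' s := by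
  rw [runs_skip] at h
  subst h
  constructor <;> rfl

theorem Runs.of_crossing {mask off : ℕ} {θ : RealExp} {dest : ℕ}
    (h : Runs γ known t A (.crossing mask off θ dest) s s') :
    SameData s' { s with
      real := store s.real dest 0
        (sInf {t' : ℝ | t ≤ t' ∧ θ.val γ known t s ≤ excess known s mask off t'}) } := by
  rw [runs_crossing] at h
  subst h
  constructor <;> rfl

theorem Runs.of_transmit {S : SetExp} (h : Runs γ known t A (.transmit S) s s') :
    SameData s' { s with sent := s.sent ++ [(t, S.val known s)] } := by
  rw [runs_transmit] at h
  subst h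
  constructor <;> rfl

theorem Runs.of_setAlarm {x : RealExp} (h : Runs γ known t A (.setAlarm x) s s') :
    SameData s' { s with alarm := some (x.val γ known t s) } := by
  rw [runs_setAlarm] at h
  subst h
  constructor <;> rfl

theorem Runs.of_clearAlarm (h : Runs γ known t A .clearAlarm s s') :
    SameData s' { s with alarm := none } := by
  rw [runs_clearAlarm] at h
  subst h
  constructor <;> rfl

theorem Runs.of_ite {b : Test} {P P' : Prog} (h : Runs γ known t A (.ite b P P') s s') :
    ∃ u, SameData u s ∧ ((b.holds γ known t s ∧ Runs γ known t A P u s') ∨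
      (¬ b.holds γ known t s ∧ Runs γ known t A P' u s')) :=
  ⟨_, by constructor <;> rfl, runs_ite.1 h⟩

/-- The rule for loops, with the memory at the start of a round left abstract. -/
theorem Runs.loop_rule {r : ℕ} {c : NatExp} {P : Prog} (Inv : ℕ → Mem N.numElems → Prop)
    (h : Runs γ known t A (.loop r c P) s s') {n : ℕ} (hn : c.val known s = n)
    (h0 : ∀ u, SameData u s → Inv 0 u)
    (step : ∀ j < n, ∀ u v u', Inv j u → SameData v { u with nat := store u.nat r 0 j } →
      Runs γ known t A P v u' → Inv (j + 1) u') :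
    Inv n s' :=
  h.loop_induction Inv hn (h0 _ (by constructor <;> rfl)) fun j hj u u' hu h' =>
    step j hj u _ u' hu (by constructor <;> rfl) h'

/-- The natural, real and set arrays that a program may write to. -/
def Prog.writes : Prog → List ℕ × List ℕ × List ℕ
  | .setNat a _ _ => ([a], [], [])
  | .setReal a _ _ => ([], [a], [])
  | .setSet a _ _ => ([], [], [a])
  | .seq P P' => (P.writes.1 ++ P'.writes.1, P.writes.2.1 ++ P'.writes.2.1,
      P.writes.2.2 ++ P'.writes.2.2)
  | .ite _ P P' => (P.writes.1 ++ P'.writes.1, P.writes.2.1 ++ P'.writes.2.1,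
      P.writes.2.2 ++ P'.writes.2.2)
  | .loop r _ P => (r :: P.writes.1, P.writes.2.1, P.writes.2.2)
  | .solve _ _ _ dest => ([], [], [dest])
  | .crossing _ _ _ dest => ([], [dest], [])
  | _ => ([], [], [])

/-- The program neither transmits nor touches the alarm. -/
def Prog.IsSilent : Prog → Prop
  | .seq P P' => P.IsSilent ∧ P'.IsSilent
  | .ite _ P P' => P.IsSilent ∧ P'.IsSilent
  | .loop _ _ P => P.IsSilent
  | .transmit _ => False
  | .setAlarm _ => False
  | .clearAlarm => False
  | _ => True

theorem store_of_ne {α : Type} (f : ℕ → ℕ → α) {a b : ℕ} (i : ℕ) (x : α) (h : b ≠ a) :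
    store f a i x b = f b := by
  simp [store, h]

/-- A program leaves unchanged the arrays that it does not write to. -/
theorem Runs.frame {P : Prog} (h : Runs γ known t A P s s') :
    (∀ a ∉ P.writes.1, s'.nat a = s.nat a) ∧ (∀ a ∉ P.writes.2.1, s'.real a = s.real a) ∧
    (∀ a ∉ P.writes.2.2, s'.set a = s.set a) := by
  induction P generalizing s s' with
  | skip => rw [runs_skip] at h; subst h; simp
  | setNat a i x =>
    rw [runs_setNat] at h; subst h
    refine ⟨fun b hb => ?_, fun _ _ => rfl, fun _ _ => rfl⟩
    exact store_of_ne _ _ _ (by simpa [Prog.writes] using hb)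
  | setReal a i x =>
    rw [runs_setReal] at h; subst h
    refine ⟨fun _ _ => rfl, fun b hb => ?_, fun _ _ => rfl⟩
    exact store_of_ne _ _ _ (by simpa [Prog.writes] using hb)
  | setSet a i x =>
    rw [runs_setSet] at h; subst h
    refine ⟨fun _ _ => rfl, fun _ _ => rfl, fun b hb => ?_⟩
    exact store_of_ne _ _ _ (by simpa [Prog.writes] using hb)
  | seq P P' ih ih' =>
    rw [runs_seq] at h
    obtain ⟨u, h1, h2⟩ := h
    obtain ⟨a1, a2, a3⟩ := ih h1
    obtain ⟨b1, b2, b3⟩ := ih' h2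
    simp only [Prog.writes, List.mem_append, not_or]
    exact ⟨fun a ha => (b1 a ha.2).trans (a1 a ha.1), fun a ha => (b2 a ha.2).trans (a2 a ha.1),
      fun a ha => (b3 a ha.2).trans (a3 a ha.1)⟩
  | ite b P P' ih ih' =>
    rw [runs_ite] at h
    simp only [Prog.writes, List.mem_append, not_or]
    rcases h with ⟨_, h⟩ | ⟨_, h⟩
    · obtain ⟨a1, a2, a3⟩ := ih h
      exact ⟨fun a ha => a1 a ha.1, fun a ha => a2 a ha.1, fun a ha => a3 a ha.1⟩
    · obtain ⟨a1, a2, a3⟩ := ih' h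
      exact ⟨fun a ha => a1 a ha.2, fun a ha => a2 a ha.2, fun a ha => a3 a ha.2⟩
  | loop r c P ih =>
    simp only [Prog.writes, List.mem_cons, not_or]
    refine h.loop_induction (fun _ u => (∀ a, ¬ a = r ∧ a ∉ P.writes.1 → u.nat a = s.nat a) ∧
      (∀ a ∉ P.writes.2.1, u.real a = s.real a) ∧ (∀ a ∉ P.writes.2.2, u.set a = s.set a)) rfl
      (by simp) ?_
    rintro j - u u' ⟨h1, h2, h3⟩ hu
    obtain ⟨a1, a2, a3⟩ := ih hu
    refine ⟨fun a ha => ?_, fun a ha => (a2 a ha).trans (h2 a ha),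
      fun a ha => (a3 a ha).trans (h3 a ha)⟩
    rw [a1 a ha.2, ← h1 a ha]
    exact store_of_ne _ _ _ ha.1
  | solve E mask pen dest =>
    rw [runs_solve] at h
    obtain ⟨ans, -, rfl⟩ := h
    refine ⟨fun _ _ => rfl, fun _ _ => rfl, fun b hb => ?_⟩
    exact store_of_ne _ _ _ (by simpa [Prog.writes] using hb)
  | crossing mask off θ dest =>
    rw [runs_crossing] at h; subst h
    refine ⟨fun _ _ => rfl, fun b hb => ?_, fun _ _ => rfl⟩
    exact store_of_ne _ _ _ (by simpa [Prog.writes] using hb)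
  | transmit S => rw [runs_transmit] at h; subst h; simp
  | setAlarm S => rw [runs_setAlarm] at h; subst h; simp
  | clearAlarm => rw [runs_clearAlarm] at h; subst h; simp

theorem Runs.nat_eq {P : Prog} (h : Runs γ known t A P s s') {a : ℕ} (ha : a ∉ P.writes.1) :
    s'.nat a = s.nat a := h.frame.1 a ha

theorem Runs.real_eq {P : Prog} (h : Runs γ known t A P s s') {a : ℕ} (ha : a ∉ P.writes.2.1) :
    s'.real a = s.real a := h.frame.2.1 a ha

theorem Runs.set_eq {P : Prog} (h : Runs γ known t A P s s') {a : ℕ} (ha : a ∉ P.writes.2.2) :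
    s'.set a = s.set a := h.frame.2.2 a ha

theorem Runs.silent {P : Prog} (h : Runs γ known t A P s s') (hP : P.IsSilent) :
    s'.sent = s.sent ∧ s'.alarm = s.alarm := by
  induction P generalizing s s' with
  | skip => rw [runs_skip] at h; subst h; simp
  | setNat a i x => rw [runs_setNat] at h; subst h; simp
  | setReal a i x => rw [runs_setReal] at h; subst h; simp
  | setSet a i x => rw [runs_setSet] at h; subst h; simp
  | seq P P' ih ih' =>
    rw [runs_seq] at h
    obtain ⟨u, h1, h2⟩ := h
    obtain ⟨a1, a2⟩ := ih h1 hP.1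
    obtain ⟨b1, b2⟩ := ih' h2 hP.2
    exact ⟨b1.trans a1, b2.trans a2⟩
  | ite b P P' ih ih' =>
    rw [runs_ite] at h
    rcases h with ⟨_, h⟩ | ⟨_, h⟩
    · have := ih h hP.1
      exact this
    · have := ih' h hP.2
      exact this
  | loop r c P ih =>
    refine h.loop_induction (fun _ u => u.sent = s.sent ∧ u.alarm = s.alarm) rfl (by simp) ?_
    rintro j - u u' ⟨h1, h2⟩ hu
    obtain ⟨a1, a2⟩ := ih hu hP
    exact ⟨a1.trans h1, a2.trans h2⟩
  | solve E mask pen dest =>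
    rw [runs_solve] at h
    obtain ⟨ans, -, rfl⟩ := h
    simp
  | crossing mask off θ dest => rw [runs_crossing] at h; subst h; simp
  | transmit S => exact hP.elim
  | setAlarm S => exact hP.elim
  | clearAlarm => exact hP.elim

end

/-! ### Requests by number -/

section
variable {N : Network.{u}}

/-- The delay at time `x` of request number `q`, and `0` if there is no such request. -/
def delayOf (L : List (Request N)) (q : ℕ) (x : ℝ) : ℝ≥0 := L[q]?.elim 0 fun r => r.delay x

/-- The set `S` serves request number `q`, if there is such a request. -/
def Serves (L : List (Request N)) (q : ℕ) (S : N.Sets) : Prop := ∀ r ∈ L[q]?, N.serves r.kind S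

theorem Serves.mono {L : List (Request N)} {q : ℕ} {S T : N.Sets} (hST : S ⊆ T)
    (h : Serves L q S) : Serves L q T := fun r hr => N.serves_mono _ _ _ hST (h r hr)

theorem serves_univ (L : List (Request N)) (q : ℕ) : Serves L q Finset.univ :=
  fun r _ => N.serves_univ r.kind

theorem delayOf_mono (L : List (Request N)) (q : ℕ) : Monotone (delayOf L q) := by
  intro x y h
  unfold delayOf
  cases L[q]? with
  | none => simp
  | some r => simpa using r.delay_mono h

theorem delayOf_continuous (L : List (Request N)) (q : ℕ) : Continuous (delayOf L q) := by
  unfold delayOf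
  cases L[q]? with
  | none => simpa using continuous_const
  | some r => simpa using r.delay_continuous

theorem delayOf_tendsto {L : List (Request N)} {q : ℕ} (hq : q < L.length) :
    Filter.Tendsto (delayOf L q) Filter.atTop Filter.atTop := by
  unfold delayOf
  rw [List.getElem?_eq_getElem hq]
  exact L[q].delay_tendsto

theorem delayOf_take {L : List (Request N)} {q r : ℕ} (hq : q < r) :
    delayOf (L.take r) q = delayOf L q := by
  unfold delayOf
  rw [List.getElem?_take_of_lt hq]

theorem serves_take {L : List (Request N)} {q r : ℕ} (hq : q < r) :
    Serves (L.take r) q = Serves L q := by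
  unfold Serves
  rw [List.getElem?_take_of_lt hq]

theorem sum_zipIdx_map {α β : Type*} [AddCommMonoid β] (l : List α) (f : α × ℕ → β) :
    (l.zipIdx.map f).sum = ∑ q ∈ Finset.range l.length, l[q]?.elim 0 fun r => f (r, q) := by
  induction l using List.reverseRecOn with
  | nil => simp
  | append_singleton l a ih =>
    rw [List.zipIdx_append, List.map_append, List.sum_append, ih, List.length_append,
      List.length_singleton, Finset.sum_range_succ]
    congr 1
    · refine Finset.sum_congr rfl fun q hq => ?_
      rw [List.getElem?_append_left (Finset.mem_range.1 hq)]
    · simp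

theorem sum_map_eq_sum_range {α β : Type*} [AddCommMonoid β] (l : List α) (f : α → β) :
    (l.map f).sum = ∑ q ∈ Finset.range l.length, l[q]?.elim 0 f := by
  rw [← sum_zipIdx_map l fun x => f x.1]
  congr 1
  conv_lhs => rw [← List.zipIdx_map_fst 0 l, List.map_map]
  rfl

theorem excess_eq (known : List (Request N)) (s : Mem N.numElems) (mask off : ℕ) (x : ℝ) :
    excess known s mask off x = ∑ q ∈ Finset.range known.length,
      if s.nat mask q = 0 then 0 else max 0 ((delayOf known q x : ℝ) - s.real off q) := by
  rw [excess, sum_zipIdx_map]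
  refine Finset.sum_congr rfl fun q hq => ?_
  rw [delayOf, List.getElem?_eq_getElem (Finset.mem_range.1 hq)]
  simp

open Classical in
theorem pcCost_callList (known : List (Request N)) (s : Mem N.numElems) (mask pen : ℕ)
    (E₀ S : N.Sets) : N.pcCost E₀ (callList known s mask pen) S =
      (∑ e ∈ S, if e ∈ E₀ then 0 else N.cost e) + ∑ q ∈ Finset.range known.length,
        if s.nat mask q = 0 then 0 else if Serves known q S then 0
          else (s.real pen q).toNNReal := by
  unfold Network.pcCost callList
  congr 1
  have : ∀ l : List (Request N × ℕ), ((l.filterMap fun x =>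
      if s.nat mask x.2 = 0 then none else some (x.1.kind, (s.real pen x.2).toNNReal)).map
        fun x => if N.serves x.1 S then 0 else x.2).sum =
      (l.map fun x => if s.nat mask x.2 = 0 then 0 else
        if N.serves x.1.kind S then 0 else (s.real pen x.2).toNNReal).sum := by
    intro l
    induction l with
    | nil => rfl
    | cons a l ih =>
      by_cases h : s.nat mask a.2 = 0
      · simp [h, ih]
      · simp [h, ih]
  rw [this, sum_zipIdx_map]
  refine Finset.sum_congr rfl fun q hq => ?_
  have : known[q]? = some (known[q]'(Finset.mem_range.1 hq)) := List.getElem?_eq_getElem _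
  simp [Serves, this]

/-- The cost of element number `e`, and `0` if there is no such element. -/
def costOf (N : Network.{u}) (e : ℕ) : ℝ := if h : e < N.numElems then (N.cost ⟨e, h⟩ : ℝ) else 0

theorem sum_range_costOf (S : N.Sets) [DecidablePred fun e : ℕ => ∃ x ∈ S, (x : ℕ) = e] :
    (∑ e ∈ Finset.range N.numElems, if ∃ x ∈ S, (x : ℕ) = e then costOf N e else 0) =
      N.setCost S := by
  classical
  rw [← Fin.sum_univ_eq_sum_range (fun e => if ∃ x ∈ S, (x : ℕ) = e then costOf N e else 0)
    N.numElems]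
  unfold Network.setCost
  push_cast
  rw [← Finset.sum_filter]
  refine Finset.sum_congr ?_ fun e _ => by simp [costOf]
  ext e
  simp [Fin.val_inj]

theorem setCost_mono {S T : N.Sets} (h : S ⊆ T) : N.setCost S ≤ N.setCost T :=
  Finset.sum_le_sum_of_subset h

theorem setCost_union_le (S T : N.Sets) : N.setCost (S ∪ T) ≤ N.setCost S + N.setCost T := by
  unfold Network.setCost
  rw [← Finset.sum_union_inter]
  exact le_self_add

theorem sum_ite_mem_eq_setCost_sdiff (E S : N.Sets) :
    (∑ e ∈ S, if e ∈ E then 0 else N.cost e) = N.setCost (S \ E) := by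
  unfold Network.setCost
  rw [Finset.sdiff_eq_filter, Finset.sum_filter]
  exact Finset.sum_congr rfl fun e _ => by by_cases h : e ∈ E <;> simp [h]

end

/-! ### Building blocks of the program

Memory layout, where an array of which only entry `0` is used is called a register, and an array of
naturals that indicates a set of requests a mask.

* Naturals: masks `0` (pending requests), `1` (requests that take part in forwarding), `2` (those
  of them that the current solution does not serve), `3` (those of them that the candidate
  solution does not serve), `4` (argument of calls and crossings); counters `5`, `6`, `7`;
  flags `8` (an alarm is set), `9` (forwarding is over), `10` (outcome of a check).
* Reals, by request: `0` level, `1` offset, `2` cost of the individual solution, `3` and `4`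
  penalties.  Registers: `5` crossing time, `6` alarm time, `7` level that triggers the alarm, `8`
  time reached by forwarding, `9` cost of the candidate solution, `10` level of the service.
* Sets: `0` individual solutions, by request.  Registers: `1` answer for a single request, `2` free
  elements, `3` current solution, `4` solution for the cheap requests, `5` answer of the subroutine,
  `6` candidate solution. -/

local infixr:60 " ;; " => Prog.seq

section
variable {N : Network.{u}}

/-- Entry `0` of an array of naturals. -/
abbrev NatExp.reg (a : ℕ) : NatExp := .get a (.lit 0)

/-- Puts the cost of `S` in entry `i` of the real array `a`. -/
def sumCostProg (a : ℕ) (i : NatExp) (S : SetExp) : Prog :=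
  .setReal a i (.ofNat (.lit 0)) ;;
  .loop 7 .numElems
    (.ite (.mem (.reg 7) S) (.setReal a i (.add (.get a i) (.cost (.reg 7)))) .skip)

/-- Calls the subroutine on the single request numbered by the natural register `6`, at a penalty
that exceeds `γ` times the cost of all elements, those in the set register `6` being free; the
answer goes to the set register `1`. -/
def soloProg : Prog :=
  .setReal 4 (.reg 6) (.ofNat (.lit 1)) ;;
  .loop 7 .numElems (.setReal 4 (.reg 6) (.add (.get 4 (.reg 6)) (.cost (.reg 7)))) ;;
  .setReal 4 (.reg 6) (.mulRatio (.get 4 (.reg 6))) ;;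
  .loop 7 .numReqs (.setNat 4 (.reg 7) (.lit 0)) ;;
  .setNat 4 (.reg 6) (.lit 1) ;;
  .solve (.get 6 (.lit 0)) 4 4 1

/-- Decides whether the set register `6`, which has to contain all elements of cost zero, serves the
request numbered by the natural register `6`: the natural register `10` is zero if it does. -/
def servedProg : Prog :=
  soloProg ;;
  .setNat 10 (.lit 0) (.lit 0) ;;
  .loop 7 .numElems
    (.ite (.mem (.reg 7) (.sdiff (.get 1 (.lit 0)) (.get 6 (.lit 0))))
      (.setNat 10 (.lit 0) (.lit 1)) .skip)

variable {γ : ℝ≥0} {known : List (Request N)} {t : ℝ} {A : Solver PMF N}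
variable {s s' : Mem N.numElems}

theorem runs_sumCostProg {a : ℕ} {i : NatExp} {S : SetExp} {I : ℕ} {X : N.Sets}
    (hi : ∀ u : Mem N.numElems, i.val known u = I)
    (hS : ∀ u : Mem N.numElems, u.set = s.set → S.val known u = X)
    (h : Runs γ known t A (sumCostProg a i S) s s') :
    s'.real a I = N.setCost X ∧ ∀ j, j ≠ I → s'.real a j = s.real a j := by
  classical
  obtain ⟨u, hu, h⟩ := runs_seq.1 h
  rw [runs_setReal] at hu
  rw [← sum_range_costOf X]
  refine h.loop_induction (n := N.numElems) (fun m u => u.set = s.set ∧ u.real a I =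
    (∑ e ∈ Finset.range m, if ∃ x ∈ X, (x : ℕ) = e then costOf N e else 0) ∧
    ∀ j, j ≠ I → u.real a j = s.real a j) rfl ?_ ?_ |>.2
  · subst hu
    simp +contextual [hi, store_apply, RealExp.val, NatExp.val]
  · rintro m - u u' ⟨h1, h2, h3⟩ hu
    rw [runs_ite] at hu
    simp only [Test.holds, NatExp.val, store_apply, and_self, if_true] at hu
    rw [hS _ (by simpa using h1), Finset.sum_range_succ] at *
    rcases hu with ⟨hm, hu⟩ | ⟨hm, hu⟩
    · rw [runs_setReal] at hu
      subst hu
      simp +contextual [hi, store_apply, RealExp.val, NatExp.val, h1, h2, h3, hm, costOf]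
    · rw [runs_skip] at hu
      subst hu
      simp +contextual [h1, h2, h3, hm]

/-- As leaving the request unserved costs more than `γ` times the cost of all elements, the answer
serves it. -/
theorem runs_soloProg {q : ℕ} (hγ : 1 ≤ γ)
    (hA : ∀ E₀ Q S, ∀ x ∈ (A E₀ Q).support, N.pcCost E₀ Q x.1 ≤ γ * N.pcCost E₀ Q S)
    (hq : s.nat 6 0 = q) (hlt : q < known.length) (h : Runs γ known t A soloProg s s') :
    Serves known q (s'.set 1 0) ∧ ∀ S, Serves known q S →
      N.setCost (s'.set 1 0 \ s.set 6 0) ≤ γ * N.setCost (S \ s.set 6 0) := by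
  classical
  obtain ⟨u1, h1, h⟩ := runs_seq.1 h
  obtain ⟨u2, h2, h⟩ := runs_seq.1 h
  obtain ⟨u3, h3, h⟩ := runs_seq.1 h
  obtain ⟨u4, h4, h⟩ := runs_seq.1 h
  obtain ⟨u5, h5, h⟩ := runs_seq.1 h
  have hu2 : u2.nat 6 = s.nat 6 ∧ u2.set = s.set ∧
      u2.real 4 q = 1 + ∑ e ∈ Finset.range N.numElems, costOf N e := by
    refine h2.loop_induction (n := N.numElems) (fun m u => u.nat 6 = s.nat 6 ∧ u.set = s.set ∧
      u.real 4 q = 1 + ∑ e ∈ Finset.range m, costOf N e) rfl ?_ ?_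
    · rw [runs_setReal] at h1
      subst h1
      simp [store_apply, RealExp.val, NatExp.val, hq]
    · rintro m - u u' ⟨h1, h2, h3⟩ hu
      rw [runs_setReal] at hu
      subst hu
      refine ⟨?_, h2, ?_⟩
      · simpa [store_of_ne] using h1
      · simp [store_apply, RealExp.val, NatExp.val, h1, hq, h3, Finset.sum_range_succ, costOf,
          add_assoc]
  have hu3 : u3.nat 6 = s.nat 6 ∧ u3.set = s.set ∧
      u3.real 4 q = (1 + ∑ e ∈ Finset.range N.numElems, costOf N e) * γ := by
    rw [runs_setReal] at h3
    subst h3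
    simp [store_apply, RealExp.val, NatExp.val, hu2, hq]
  have hu4 : u4.nat 6 = s.nat 6 ∧ u4.set = s.set ∧ u4.real = u3.real ∧
      ∀ j < known.length, u4.nat 4 j = 0 := by
    refine h4.loop_induction (n := known.length) (fun m u => u.nat 6 = s.nat 6 ∧ u.set = s.set ∧
      u.real = u3.real ∧ ∀ j < m, u.nat 4 j = 0) rfl ?_ ?_
    · simp [hu3]
    · rintro m - u u' ⟨h1, h2, h3, h4⟩ hu
      rw [runs_setNat] at hu
      subst hu
      refine ⟨?_, h2, h3, ?_⟩
      · simpa [store_of_ne] using h1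
      · intro j hj
        simp only [store_apply, NatExp.val, true_and, and_self, if_true]
        split_ifs with h h'
        · rfl
        · lia
        · exact h4 j (by lia)
  have hu5 : u5.set = s.set ∧ u5.real = u3.real ∧
      ∀ j < known.length, u5.nat 4 j = if j = q then 1 else 0 := by
    rw [runs_setNat] at h5
    subst h5
    refine ⟨hu4.2.1, hu4.2.2.1, fun j hj => ?_⟩
    simp [store_apply, NatExp.val, hu4.1, hq, hu4.2.2.2 j hj]
  rw [runs_solve] at h
  obtain ⟨ans, hans, rfl⟩ := h
  have key := fun S => hA _ _ S ans hans
  simp only [pcCost_callList, sum_ite_mem_eq_setCost_sdiff] at key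
  simp only [SetExp.val, NatExp.val, hu5.1] at key
  have hsum : ∀ S, (∑ j ∈ Finset.range known.length, if u5.nat 4 j = 0 then 0 else
      if Serves known j S then 0 else (u5.real 4 j).toNNReal) =
      if Serves known q S then 0 else (u5.real 4 q).toNNReal := by
    intro S
    rw [Finset.sum_eq_single_of_mem q (Finset.mem_range.2 hlt)]
    · simp [hu5.2.2 q hlt]
    · intro j hj hjq
      simp [hu5.2.2 j (Finset.mem_range.1 hj), hjq]
  simp only [hsum] at key
  have e1 : ({ u5.tick (SetExp.steps N.numElems (.get 6 (.lit 0)) + known.length + ans.2 +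
      N.numElems + 1) with set := store u5.set 1 0 ans.1 } : Mem N.numElems).set 1 0 = ans.1 := by
    simp [store_apply]
  rw [e1]
  have hs : Serves known q ans.1 := by
    by_contra hns
    have k1 := key Finset.univ
    rw [if_neg hns, if_pos (serves_univ _ _), add_zero] at k1
    have e2 : u5.real 4 q = ((1 + N.setCost Finset.univ) * γ : ℝ≥0) := by
      rw [hu5.2.1, hu3.2.2]
      push_cast
      congr 2
      rw [← Fin.sum_univ_eq_sum_range (fun e => costOf N e) N.numElems]
      unfold Network.setCost
      push_cast
      exact Finset.sum_congr rfl fun e _ => by simp [costOf]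
    have k2 := setCost_mono (N := N) (Finset.sdiff_subset (s := Finset.univ) (t := s.set 6 0))
    rw [e2, Real.toNNReal_coe] at k1
    have k3 : γ * N.setCost (Finset.univ \ s.set 6 0) ≤ γ * N.setCost Finset.univ := by gcongr
    have k4 : (1 + N.setCost Finset.univ) * γ = γ + γ * N.setCost Finset.univ := by ring
    have k5 : γ + γ * N.setCost Finset.univ ≤ 0 + γ * N.setCost Finset.univ := by
      rw [← k4, zero_add]
      exact (le_add_self.trans k1).trans k3
    have k6 : γ ≤ 0 := le_of_add_le_add_right k5
    exact absurd (hγ.trans k6) (by norm_num)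
  refine ⟨hs, fun S hS => ?_⟩
  have := key S
  rwa [if_pos hs, if_pos hS, add_zero, add_zero] at this

/-- The set `s.set 6 0` serves a request if and only if, with its elements free, the request is
served at no cost; so a call to the subroutine tells.  Elements of cost zero are in this set by
assumption, and cannot blur the answer. -/
theorem runs_servedProg {q : ℕ} (hγ : 1 ≤ γ)
    (hA : ∀ E₀ Q S, ∀ x ∈ (A E₀ Q).support, N.pcCost E₀ Q x.1 ≤ γ * N.pcCost E₀ Q S)
    (hq : s.nat 6 0 = q) (hlt : q < known.length) (hE : ∀ e, N.cost e = 0 → e ∈ s.set 6 0)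
    (h : Runs γ known t A servedProg s s') :
    s'.nat 10 0 = 0 ↔ Serves known q (s.set 6 0) := by
  obtain ⟨u, hu, h⟩ := runs_seq.1 h
  obtain ⟨u', hu', h⟩ := runs_seq.1 h
  obtain ⟨hs, hopt⟩ := runs_soloProg hγ hA hq hlt hu
  have hu6 : u.set 6 = s.set 6 := hu.set_eq (by decide)
  have h1 : s'.nat 10 0 = 0 ↔ ∀ e : ℕ, e < N.numElems →
      ¬ ∃ x ∈ u.set 1 0 \ s.set 6 0, (x : ℕ) = e := by
    refine (h.loop_induction (n := N.numElems) (fun m v => v.set = u.set ∧ (v.nat 10 0 = 0 ↔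
      ∀ e : ℕ, e < m → ¬ ∃ x ∈ u.set 1 0 \ s.set 6 0, (x : ℕ) = e)) rfl ?_ ?_).2
    · rw [runs_setNat] at hu'
      subst hu'
      simp [store_apply, NatExp.val]
    · rintro m - v v' ⟨h1, h2⟩ hv
      have hT : ∀ w : Mem N.numElems, w.set = v.set → w.nat 7 0 = m →
          ((Test.mem (.reg 7) (.sdiff (.get 1 (.lit 0)) (.get 6 (.lit 0)))).holds γ known t w ↔
            ∃ x ∈ u.set 1 0 \ s.set 6 0, (x : ℕ) = m) := by
        intro w hw hw'
        simp only [Test.holds, SetExp.val, NatExp.val, hw, hw', h1, hu6]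
      rw [runs_ite, hT _ (by rfl) (by simp [store_apply])] at hv
      rcases hv with ⟨hm, hv⟩ | ⟨hm, hv⟩
      · rw [runs_setNat] at hv
        subst hv
        refine ⟨h1, ?_⟩
        simp only [store_apply, NatExp.val, and_self, if_true, one_ne_zero, false_iff]
        exact fun hall => hall m (Nat.lt_succ_self m) hm
      · rw [runs_skip] at hv
        subst hv
        refine ⟨h1, ?_⟩
        simp only [Mem.tick_nat, store_of_ne _ _ _ (show (10 : ℕ) ≠ 7 by decide)]
        rw [h2]
        refine ⟨fun hall e he => ?_, fun hall e he => hall e (he.trans (Nat.lt_succ_self m))⟩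
        rcases Nat.lt_succ_iff_lt_or_eq.1 he with he | rfl
        · exact hall e he
        · exact hm
  have h2 : s'.nat 10 0 = 0 ↔ u.set 1 0 ⊆ s.set 6 0 := by
    rw [h1]
    constructor
    · intro hall x hx
      by_contra hn
      exact hall x x.2 ⟨x, Finset.mem_sdiff.2 ⟨hx, hn⟩, rfl⟩
    · rintro hsub e - ⟨x, hx, -⟩
      exact (Finset.mem_sdiff.1 hx).2 (hsub (Finset.mem_sdiff.1 hx).1)
  rw [h2]
  refine ⟨fun hsub => hs.mono hsub, fun hserv x hx => ?_⟩
  -- The answer costs nothing outside of the set, so that only free elements can be outside.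
  have h3 := hopt _ hserv
  rw [Finset.sdiff_self] at h3
  have h4 : N.setCost (u.set 1 0 \ s.set 6 0) = 0 := by
    simpa [Network.setCost] using h3
  by_contra hn
  rw [Network.setCost, Finset.sum_eq_zero_iff] at h4
  exact hn (hE x (h4 x (Finset.mem_sdiff.2 ⟨hx, hn⟩)))

end

/-! ### Alarms -/

/-- Entry `0` of an array of reals. -/
abbrev RealExp.reg (a : ℕ) : RealExp := .get a (.lit 0)

/-- Entry `0` of an array of sets. -/
abbrev SetExp.reg (a : ℕ) : SetExp := .get a (.lit 0)

/-- Puts in the natural array `a` the indicator function of the requests `q` that pass the test `b`,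
where `q` is read in the natural register `7`. -/
def markProg (a : ℕ) (b : Test) : Prog :=
  .loop 7 .numReqs (.ite b (.setNat a (.reg 7) (.lit 1)) (.setNat a (.reg 7) (.lit 0)))

/-- Sets the alarm to the first time at which, for some pending request `q`, the pending requests of
level at most that of `q` have a total residual delay equal to this level, which is then put in the
real register `7`. -/
def resetAlarmProg : Prog :=
  .clearAlarm ;;
  .setNat 8 (.lit 0) (.lit 0) ;;
  .loop 6 .numReqs (.ite (.natLt (.lit 0) (.get 0 (.reg 6)))
    (markProg 4 (.and (.natLt (.lit 0) (.get 0 (.reg 7)))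
        (.not (.realLt (.get 0 (.reg 6)) (.get 0 (.reg 7))))) ;;
      .crossing 4 1 (.get 0 (.reg 6)) 5 ;;
      .ite (.and (.natLt (.lit 0) (.reg 8)) (.not (.realLt (.reg 5) (.reg 6)))) .skip
        (.setNat 8 (.lit 0) (.lit 1) ;;
          .setReal 6 (.lit 0) (.reg 5) ;;
          .setReal 7 (.lit 0) (.get 0 (.reg 6)) ;;
          .setAlarm (.reg 5)))
    .skip)

section
variable {N : Network.{u}} {γ : ℝ≥0} {known : List (Request N)} {t : ℝ} {A : Solver PMF N}
variable {s s' : Mem N.numElems}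

theorem runs_markProg {a : ℕ} {b : Test} {p : ℕ → Prop} [DecidablePred p]
    (hb : ∀ (u : Mem N.numElems) (j : ℕ), (∀ a', a' ≠ 7 → a' ≠ a → u.nat a' = s.nat a') →
      u.nat 7 0 = j → u.real = s.real → u.set = s.set → (b.holds γ known t u ↔ p j))
    (ha : a ≠ 7) (h : Runs γ known t A (markProg a b) s s') :
    ∀ j < known.length, s'.nat a j = if p j then 1 else 0 := by
  refine (h.loop_rule (n := known.length) (fun m u => ((∀ a', a' ≠ 7 → a' ≠ a →
    u.nat a' = s.nat a') ∧ u.real = s.real ∧ u.set = s.set) ∧ ∀ j < m,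
      u.nat a j = if p j then 1 else 0) rfl ?_ ?_).2
  · intro u hu
    exact ⟨⟨fun a' _ _ => by rw [hu.nat], hu.real, hu.set⟩, by simp⟩
  · rintro m - u v u' ⟨⟨h1, h2, h3⟩, h4⟩ hv hu'
    obtain ⟨w, hw, hu'⟩ := hu'.of_ite
    have h7 : v.nat 7 0 = m := by simp [hv.nat, store_apply]
    have hn : ∀ a', a' ≠ 7 → v.nat a' = u.nat a' := fun a' h => by
      simp [hv.nat, store_of_ne _ _ _ h]
    have hb := hb v m (fun a' h h' => (hn a' h).trans (h1 a' h h')) h7 (hv.real.trans h2)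
      (hv.set.trans h3)
    rw [hb] at hu'
    have hset : ∀ x : ℕ, Runs γ known t A (.setNat a (.reg 7) (.lit x)) w u' →
        ((∀ a', a' ≠ 7 → a' ≠ a → u'.nat a' = s.nat a') ∧ u'.real = s.real ∧ u'.set = s.set) ∧
        ∀ j, u'.nat a j = if j = m then x else u.nat a j := by
      intro x hx
      have hx := hx.of_setNat
      refine ⟨⟨fun a' h h' => ?_, hx.real.trans (hw.real.trans (hv.real.trans h2)),
        hx.set.trans (hw.set.trans (hv.set.trans h3))⟩, fun j => ?_⟩
      · rw [hx.nat]
        simp [store_of_ne _ _ _ h', hw.nat, hn a' h, h1 a' h h']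
      · rw [hx.nat]
        simp [store_apply, NatExp.val, hw.nat, h7, hn a ha]
    rcases hu' with ⟨hp, hu'⟩ | ⟨hp, hu'⟩
    · refine ⟨(hset _ hu').1, fun j hj => ?_⟩
      rw [(hset _ hu').2]
      split_ifs with h h' h'
      · rfl
      · exact absurd (h ▸ hp) h'
      · rw [h4 j (by lia), if_pos h']
      · rw [h4 j (by lia), if_neg h']
    · refine ⟨(hset _ hu').1, fun j hj => ?_⟩
      rw [(hset _ hu').2]
      split_ifs with h h' h'
      · exact absurd (h ▸ h') hp
      · rfl
      · rw [h4 j (by lia), if_pos h']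
      · rw [h4 j (by lia), if_neg h']

/-- The part of the delay of request `q` at time `x` that exceeds `h`. -/
def residual (known : List (Request N)) (q : ℕ) (h x : ℝ) : ℝ :=
  max 0 ((delayOf known q x : ℝ) - h)

theorem residual_nonneg (known : List (Request N)) (q : ℕ) (h x : ℝ) :
    0 ≤ residual known q h x := le_max_left _ _

theorem residual_mono (known : List (Request N)) (q : ℕ) (h : ℝ) :
    Monotone (residual known q h) := fun _ _ hxy =>
  max_le_max le_rfl (sub_le_sub_right (NNReal.coe_le_coe.2 (delayOf_mono known q hxy)) h)

theorem residual_continuous (known : List (Request N)) (q : ℕ) (h : ℝ) :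
    Continuous (residual known q h) := by
  have := delayOf_continuous known q
  unfold residual
  fun_prop

theorem residual_tendsto {q : ℕ} (hq : q < known.length) (h : ℝ) :
    Filter.Tendsto (residual known q h) Filter.atTop Filter.atTop := by
  refine Filter.tendsto_atTop_mono (fun x => le_max_right _ _) ?_
  exact Filter.tendsto_atTop_add_const_right _ _
    (NNReal.tendsto_coe_atTop.2 (delayOf_tendsto hq))

open Classical in
/-- The total residual delay at time `x` of the requests in `M`. -/
def totalResidual (known : List (Request N)) (M : ℕ → Prop) (h : ℕ → ℝ) (x : ℝ) : ℝ :=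
  ∑ q ∈ Finset.range known.length, if M q then residual known q (h q) x else 0

theorem totalResidual_mono (known : List (Request N)) (M : ℕ → Prop) (h : ℕ → ℝ) :
    Monotone (totalResidual known M h) := by
  intro x y hxy
  refine Finset.sum_le_sum fun q _ => ?_
  split_ifs
  · exact residual_mono known q (h q) hxy
  · exact le_rfl

theorem totalResidual_mono_set {M M' : ℕ → Prop} (hM : ∀ q < known.length, M q → M' q)
    (h : ℕ → ℝ) (x : ℝ) : totalResidual known M h x ≤ totalResidual known M' h x := by
  refine Finset.sum_le_sum fun q hq => ?_
  split_ifs with h1 h2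
  · exact le_rfl
  · exact absurd (hM q (Finset.mem_range.1 hq) h1) h2
  · exact residual_nonneg _ _ _ _
  · exact le_rfl

theorem totalResidual_congr {M M' : ℕ → Prop} (hM : ∀ q < known.length, (M q ↔ M' q))
    (h : ℕ → ℝ) (x : ℝ) : totalResidual known M h x = totalResidual known M' h x :=
  le_antisymm (totalResidual_mono_set (fun q hq => (hM q hq).1) h x)
    (totalResidual_mono_set (fun q hq => (hM q hq).2) h x)

theorem totalResidual_continuous (known : List (Request N)) (M : ℕ → Prop) (h : ℕ → ℝ) :
    Continuous (totalResidual known M h) := by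
  refine continuous_finsetSum _ fun q _ => ?_
  split_ifs
  · exact residual_continuous known q (h q)
  · exact continuous_const

theorem excess_eq_totalResidual (mask off : ℕ) (s : Mem N.numElems) (x : ℝ) :
    excess known s mask off x = totalResidual known (fun q => s.nat mask q ≠ 0) (s.real off) x := by
  rw [excess_eq]
  refine Finset.sum_congr rfl fun q _ => ?_
  by_cases h : s.nat mask q = 0 <;> simp [h, residual]

theorem sInf_crossing {f : ℝ → ℝ} (hf : Continuous f) (hm : Monotone f) {θ : ℝ} (h0 : f t ≤ θ)
    (h1 : ∃ x, θ ≤ f x) :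
    t ≤ sInf {x | t ≤ x ∧ θ ≤ f x} ∧ f (sInf {x | t ≤ x ∧ θ ≤ f x}) = θ := by
  obtain ⟨x, hx⟩ := h1
  obtain ⟨y, hy, hfy⟩ := intermediate_value_Icc (le_max_left t x) hf.continuousOn
    ⟨h0, hx.trans (hm (le_max_right t x))⟩
  have hmem : y ∈ {x | t ≤ x ∧ θ ≤ f x} := ⟨hy.1, hfy.ge⟩
  have hbdd : BddBelow {x | t ≤ x ∧ θ ≤ f x} := ⟨t, fun x hx => hx.1⟩
  have hcl : IsClosed {x | t ≤ x ∧ θ ≤ f x} :=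
    isClosed_Ici.inter (isClosed_Ici.preimage hf)
  have h := hcl.csInf_mem ⟨y, hmem⟩ hbdd
  exact ⟨h.1, le_antisymm ((hm (csInf_le hbdd hmem)).trans hfy.le) h.2⟩

theorem totalResidual_crossing {M : ℕ → Prop} {h : ℕ → ℝ} {θ : ℝ}
    (h0 : totalResidual known M h t ≤ θ) (h1 : ∃ q < known.length, M q) :
    t ≤ sInf {x | t ≤ x ∧ θ ≤ totalResidual known M h x} ∧
      totalResidual known M h (sInf {x | t ≤ x ∧ θ ≤ totalResidual known M h x}) = θ := by
  refine sInf_crossing (totalResidual_continuous _ _ _) (totalResidual_mono _ _ _) h0 ?_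
  obtain ⟨q, hq, hM⟩ := h1
  obtain ⟨x, hx⟩ := ((residual_tendsto hq (h q)).eventually_ge_atTop θ).exists
  refine ⟨x, hx.trans ?_⟩
  unfold totalResidual
  refine le_trans (by rw [if_pos hM]) (Finset.single_le_sum (fun q _ => ?_)
    (Finset.mem_range.2 hq))
  split_ifs
  · exact residual_nonneg _ _ _ _
  · exact le_rfl

/-- The total residual delay at time `x` of the pending requests of level at most `v`. -/
def load (known : List (Request N)) (s : Mem N.numElems) (v x : ℝ) : ℝ :=
  totalResidual known (fun q => s.nat 0 q ≠ 0 ∧ s.real 0 q ≤ v) (s.real 1) x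

/-- The alarm is set to a time at which the load of a level reaches this level; this level is in the
real register `7`, and no load exceeds its level before. -/
def AlarmOK (known : List (Request N)) (t : ℝ) (s : Mem N.numElems) : Prop :=
  (s.alarm = none ∧ ∀ q < known.length, s.nat 0 q = 0) ∨
  ∃ a, s.alarm = some a ∧ t ≤ a ∧
    (∃ q < known.length, s.nat 0 q ≠ 0 ∧ s.real 0 q = s.real 7 0 ∧
      load known s (s.real 0 q) a = s.real 0 q) ∧
    ∀ q < known.length, s.nat 0 q ≠ 0 → load known s (s.real 0 q) a ≤ s.real 0 q

theorem runs_resetAlarmProg (h : Runs γ known t A resetAlarmProg s s')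
    (hload : ∀ q < known.length, s.nat 0 q ≠ 0 → load known s (s.real 0 q) t ≤ s.real 0 q) :
    s'.sent = s.sent ∧ AlarmOK known t s' := by
  obtain ⟨u1, h1, h⟩ := runs_seq.1 h
  obtain ⟨u2, h2, h⟩ := runs_seq.1 h
  have h1 := h1.of_clearAlarm
  have h2 := h2.of_setNat
  have key := h.loop_rule (n := known.length) (fun m u => (u.nat 0 = s.nat 0 ∧
    u.real 0 = s.real 0 ∧ u.real 1 = s.real 1 ∧ u.sent = s.sent) ∧
    ((u.alarm = none ∧ u.nat 8 0 = 0 ∧ ∀ q < m, s.nat 0 q = 0) ∨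
    (u.nat 8 0 = 1 ∧ ∃ a, u.alarm = some a ∧ u.real 6 0 = a ∧ t ≤ a ∧
    (∃ q < known.length, s.nat 0 q ≠ 0 ∧ s.real 0 q = u.real 7 0 ∧
      load known s (s.real 0 q) a = s.real 0 q) ∧
    ∀ q < m, s.nat 0 q ≠ 0 → load known s (s.real 0 q) a ≤ s.real 0 q))) rfl ?_ ?_
  · obtain ⟨⟨k1, k2, k3, k4⟩, k⟩ := key
    have hl : ∀ v a, load known s' v a = load known s v a := fun v a => by
      simp only [load, k1, k2, k3]
    refine ⟨k4, ?_⟩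
    unfold AlarmOK
    simp only [hl, k1, k2]
    rcases k with ⟨k, -, k'⟩ | ⟨-, a, k5, -, k6⟩
    · exact Or.inl ⟨k, k'⟩
    · exact Or.inr ⟨a, k5, k6⟩
  · intro u hu
    simp [hu.nat, hu.real, hu.sent, hu.alarm, h2.nat, h2.real, h2.sent, h2.alarm, h1.nat, h1.real,
      h1.sent, h1.alarm, store_apply, NatExp.val, store_of_ne]
  · rintro m hm u v u' ⟨⟨k1, k2, k3, k4⟩, k⟩ hv hu'
    obtain ⟨w, hw, hu'⟩ := hu'.of_ite
    have hn : ∀ a', a' ≠ 6 → v.nat a' = u.nat a' := fun a' h => by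
      simp [hv.nat, store_of_ne _ _ _ h]
    have h6 : v.nat 6 0 = m := by simp [hv.nat, store_apply]
    simp only [Test.holds, NatExp.val, h6, hn 0 (by decide), k1] at hu'
    rcases hu' with ⟨hp, hu'⟩ | ⟨hp, hu'⟩
    · obtain ⟨u3, h3, hu'⟩ := runs_seq.1 hu'
      obtain ⟨u4, h4, hu'⟩ := runs_seq.1 hu'
      have h4 := h4.of_crossing
      have w6 : w.nat 6 0 = m := by rw [hw.nat, h6]
      have w0 : w.nat 0 = s.nat 0 := by rw [hw.nat, hn 0 (by decide), k1]
      have wr : w.real = u.real := by rw [hw.real, hv.real]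
      have hmark := runs_markProg (p := fun j => s.nat 0 j ≠ 0 ∧ s.real 0 j ≤ s.real 0 m)
        (by
          intro u j h h' hr _
          simp only [Test.holds, NatExp.val, RealExp.val, h', h 0 (by decide) (by decide),
            h 6 (by decide) (by decide), w0, w6, hr, wr, k2, not_lt, Nat.pos_iff_ne_zero])
        (by decide) h3
      have hex : ∀ x, excess known u3 4 1 x = load known s (s.real 0 m) x := by
        intro x
        rw [excess_eq_totalResidual, load, h3.real_eq (by decide), wr, k3]
        refine totalResidual_congr (fun q hq => ?_) _ _
        rw [hmark q hq]
        split_ifs with hh <;> simp [hh]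
      have hθ : (RealExp.get 0 (.reg 6)).val γ known t u3 = s.real 0 m := by
        simp only [RealExp.val, NatExp.val, h3.real_eq (show 0 ∉ _ by decide), wr, k2,
          h3.nat_eq (show 6 ∉ _ by decide), w6]
      simp only [hex, hθ] at h4
      obtain ⟨c1, c2⟩ := totalResidual_crossing (hload m hm hp.ne') ⟨m, hm, hp.ne', le_rfl⟩
      change t ≤ sInf {x | t ≤ x ∧ s.real 0 m ≤ load known s (s.real 0 m) x} at c1
      change load known s (s.real 0 m) (sInf {x | t ≤ x ∧ s.real 0 m ≤
        load known s (s.real 0 m) x}) = _ at c2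
      generalize sInf {x | t ≤ x ∧ s.real 0 m ≤ load known s (s.real 0 m) x} = x at h4 c1 c2
      obtain ⟨y, hy, hu'⟩ := hu'.of_ite
      have h3s := h3.silent (by simp [markProg, Prog.IsSilent])
      have u4n : ∀ a, a ≠ 4 → a ≠ 7 → a ≠ 6 → u4.nat a = u.nat a := fun a h h' h'' => by
        simp only [h4.nat]
        rw [h3.nat_eq (by simp [markProg, Prog.writes, h, h']), hw.nat, hn a h'']
      have u46 : u4.nat 6 0 = m := by
        simp only [h4.nat]
        rw [h3.nat_eq (by simp [markProg, Prog.writes]), w6]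
      have u4r : ∀ a, a ≠ 5 → u4.real a = u.real a := fun a h => by
        simp only [h4.real]
        rw [store_of_ne _ _ _ h, h3.real_eq (by simp [markProg, Prog.writes]), wr]
      have u45 : u4.real 5 0 = x := by simp [h4.real, store_apply]
      have u4s : u4.sent = s.sent := by simp [h4.sent, h3s.1, hw.sent, hv.sent, k4]
      have u4a : u4.alarm = u.alarm := by simp [h4.alarm, h3s.2, hw.alarm, hv.alarm]
      simp only [Test.holds, NatExp.val, RealExp.val, u4n 8 (by decide) (by decide) (by decide),
        u45, u4r 6 (by decide), not_lt] at hu'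
      rcases hu' with ⟨⟨b1, b2⟩, hu'⟩ | ⟨b, hu'⟩
      · have hu' := hu'.of_skip
        rcases k with ⟨-, k, -⟩ | ⟨k5, a, k6, k7, k8, k9, k10⟩
        · lia
        · refine ⟨?_, Or.inr ⟨?_, a, ?_, ?_, k8, ?_, fun q hq hpq => ?_⟩⟩
          · simp [hu'.nat, hu'.real, hu'.sent, hy.nat, hy.real, hy.sent, u4n, u4r, u4s, k1, k2, k3]
          · simp [hu'.nat, hy.nat, u4n, k5]
          · simp [hu'.alarm, hy.alarm, u4a, k6]
          · simp [hu'.real, hy.real, u4r, k7]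
          · simpa [hu'.real, hy.real, u4r] using k9
          · rcases Nat.lt_succ_iff_lt_or_eq.1 hq with hq | rfl
            · exact k10 q hq hpq
            · exact (totalResidual_mono _ _ _ (k7 ▸ b2)).trans c2.le
      · obtain ⟨u5, h5, hu'⟩ := runs_seq.1 hu'
        obtain ⟨u6, h6', hu'⟩ := runs_seq.1 hu'
        obtain ⟨u7, h7, hu'⟩ := runs_seq.1 hu'
        have h5 := h5.of_setNat
        have h6' := h6'.of_setReal
        have h7 := h7.of_setReal
        have hu' := hu'.of_setAlarm
        refine ⟨?_, Or.inr ⟨?_, x, ?_, ?_, c1, ⟨m, hm, hp.ne', ?_, c2⟩, fun q hq hpq => ?_⟩⟩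
        · simp [hu'.nat, hu'.real, hu'.sent, h7.nat, h7.real, h7.sent, h6'.nat, h6'.real, h6'.sent,
            h5.nat, h5.real, h5.sent, hy.nat, hy.real, hy.sent, u4n, u4r, u4s, k1, k2, k3,
            store_of_ne]
        · simp [hu'.nat, h7.nat, h6'.nat, h5.nat, NatExp.val, store_apply]
        · simp [hu'.alarm, h7.real, h6'.real, h5.real, hy.real, u45, NatExp.val, RealExp.val,
            store_apply]
        · simp [hu'.real, h7.real, h6'.real, h5.real, hy.real, u45, NatExp.val, RealExp.val,
            store_apply]
        · simp [hu'.real, h7.real, h6'.real, h5.real, h6'.nat, h5.nat, hy.real, hy.nat, u46, u4r,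
            k2, NatExp.val, RealExp.val, store_apply]
        · rcases Nat.lt_succ_iff_lt_or_eq.1 hq with hq | rfl
          · rcases k with ⟨-, -, k⟩ | ⟨k5, a, -, k7, -, -, k10⟩
            · exact absurd (k q hq) hpq
            · have : x ≤ a := by
                by_contra hxa
                exact b ⟨by lia, by rw [k7]; exact (not_le.1 hxa).le⟩
              exact (totalResidual_mono _ _ _ this).trans (k10 q hq hpq)
          · exact c2.le
    · have hu' := hu'.of_skip
      have hp : s.nat 0 m = 0 := by lia
      refine ⟨?_, ?_⟩
      · simp [hu'.nat, hu'.real, hu'.sent, hw.nat, hw.real, hw.sent, hn, hv.real, hv.sent, k1, k2,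
          k3, k4]
      · have e : u'.nat 8 = u.nat 8 := by rw [hu'.nat, hw.nat, hn 8 (by decide)]
        have e' : u'.real = u.real := by rw [hu'.real, hw.real, hv.real]
        have e'' : u'.alarm = u.alarm := by rw [hu'.alarm, hw.alarm, hv.alarm]
        rw [e, e', e'']
        rcases k with ⟨ka, k, k'⟩ | ⟨k5, a, k6, k7, k8, k9, k10⟩
        · refine Or.inl ⟨ka, k, fun q hq => ?_⟩
          rcases Nat.lt_succ_iff_lt_or_eq.1 hq with hq | rfl
          · exact k' q hq
          · exact hp
        · refine Or.inr ⟨k5, a, k6, k7, k8, k9, fun q hq hpq => ?_⟩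
          rcases Nat.lt_succ_iff_lt_or_eq.1 hq with hq | rfl
          · exact k10 q hq hpq
          · exact absurd hp hpq

end

/-! ### Forwarding: buying a solution for a time as late as affordable -/

/-- Puts in the real array `3` the residual delays at the time in the real register `8`. -/
def penaltyProg : Prog :=
  .loop 7 .numReqs
    (.setReal 3 (.reg 7) (.sub (.delay (.reg 7) (.reg 8)) (.get 1 (.reg 7))) ;;
      .ite (.realLt (.get 3 (.reg 7)) (.ofNat (.lit 0)))
        (.setReal 3 (.reg 7) (.ofNat (.lit 0))) .skip)

/-- Puts in the natural array `3` the indicator function of the requests in the natural array `1`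
that the set register `6` does not serve, and adds their penalties to the real register `9`. -/
def unservedProg : Prog :=
  .loop 6 .numReqs
    (.setNat 3 (.reg 6) (.lit 0) ;;
      .ite (.natLt (.lit 0) (.get 1 (.reg 6)))
        (servedProg ;;
          .ite (.natLt (.lit 0) (.reg 10))
            (.setNat 3 (.reg 6) (.lit 1) ;;
              .setReal 9 (.lit 0) (.add (.reg 9) (.get 3 (.reg 6)))) .skip) .skip)

/-- Solves the prize-collecting problem on the requests in the natural array `1`, for the penalties
due to waiting until the time in the real register `8`.  The solution is put in the set register
`6`, its cost in the real register `9`, the requests that it does not serve in the natural array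
`3`. -/
def evalProg : Prog :=
  penaltyProg ;;
  .solve (.reg 2) 1 3 5 ;;
  .setSet 6 (.lit 0) (.union (.reg 5) (.reg 2)) ;;
  sumCostProg 9 (.lit 0) (.sdiff (.reg 6) (.reg 2)) ;;
  unservedProg

/-- The natural register `10` is set to zero if and only if the natural array `2` vanishes. -/
def isEmptyProg : Prog :=
  .setNat 10 (.lit 0) (.lit 0) ;;
  .loop 7 .numReqs (.ite (.natLt (.lit 0) (.get 2 (.reg 7))) (.setNat 10 (.lit 0) (.lit 1)) .skip)

/-- One round of forwarding, unless the flag in the natural register `9` is up.  The set register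
`3` and the natural array `2` hold the solution and the requests that it leaves unserved; the time
in the real register `8` moves on to the moment when these requests have accumulated a delay of
`2γw`, with `w` in the real register `10`. -/
def roundProg : Prog :=
  .ite (.natLt (.reg 9) (.lit 1))
    (isEmptyProg ;;
      .ite (.natLt (.reg 10) (.lit 1)) (.setNat 9 (.lit 0) (.lit 1))
        (.crossing 2 1 (.mulRatio (.add (.reg 10) (.reg 10))) 8 ;;
          evalProg ;;
          .ite (.realLt (.mulRatio (.reg 10)) (.reg 9)) (.setNat 9 (.lit 0) (.lit 1))
            (.setSet 3 (.lit 0) (.reg 6) ;;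
              markProg 2 (.natLt (.lit 0) (.get 3 (.reg 7))))))
    .skip

section
variable {N : Network.{u}} {γ : ℝ≥0} {known : List (Request N)} {t : ℝ} {A : Solver PMF N}
variable {s s' : Mem N.numElems}

theorem delay_val (q : NatExp) (x : RealExp) :
    (RealExp.delay q x).val γ known t s = delayOf known (q.val known s) (x.val γ known t s) := by
  simp only [RealExp.val, delayOf]
  cases known[q.val known s]? <;> simp

theorem runs_penaltyProg (h : Runs γ known t A penaltyProg s s') :
    ∀ j < known.length, s'.real 3 j = residual known j (s.real 1 j) (s.real 8 0) := by
  refine (h.loop_rule (n := known.length) (fun m u => (u.real 1 = s.real 1 ∧ u.real 8 = s.real 8) ∧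
    ∀ j < m, u.real 3 j = residual known j (s.real 1 j) (s.real 8 0)) rfl ?_ ?_).2
  · intro u hu
    simp [hu.real]
  · rintro m - u v u' ⟨⟨h1, h2⟩, h3⟩ hv hu'
    obtain ⟨w, hw, hu'⟩ := runs_seq.1 hu'
    have hw := hw.of_setReal
    obtain ⟨y, hy, hu'⟩ := hu'.of_ite
    have h7 : v.nat 7 0 = m := by simp [hv.nat, store_apply]
    have hwr : w.real = store u.real 3 m (delayOf known m (s.real 8 0) - s.real 1 m) := by
      have e : (RealExp.sub (.delay (.reg 7) (.reg 8)) (.get 1 (.reg 7))).val γ known t v =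
          delayOf known m (s.real 8 0) - s.real 1 m := by
        change (RealExp.delay (.reg 7) (.reg 8)).val γ known t v - _ = _
        rw [delay_val]
        simp only [RealExp.val, NatExp.val, h7, hv.real, h1, h2]
      rw [hw.real, e]
      simp only [NatExp.val, h7, hv.real]
    have hw7 : w.nat 7 0 = m := by rw [hw.nat, ← h7]
    have hres : residual known m (s.real 1 m) (s.real 8 0) =
      max 0 (delayOf known m (s.real 8 0) - s.real 1 m) := rfl
    simp only [Test.holds, RealExp.val, NatExp.val, hw7, hwr, store_apply, and_self, if_true,
      Nat.cast_zero] at hu'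
    rcases hu' with ⟨hp, hu'⟩ | ⟨hp, hu'⟩
    · have hu' := hu'.of_setReal
      refine ⟨by simp [hu'.real, hy.real, hwr, store_of_ne, h1, h2], fun j hj => ?_⟩
      simp only [hu'.real, hy.real, hwr, hy.nat, NatExp.val, hw7, RealExp.val, store_apply,
        true_and, Nat.cast_zero]
      split_ifs with hjm
      · rw [hjm, hres, max_eq_left hp.le]
      · exact h3 j (by lia)
    · have hu' := hu'.of_skip
      refine ⟨by simp [hu'.real, hy.real, hwr, store_of_ne, h1, h2], fun j hj => ?_⟩
      simp only [hu'.real, hy.real, hwr, store_apply, true_and]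
      split_ifs with hjm
      · rw [hjm, hres, max_eq_right (not_lt.1 hp)]
      · exact h3 j (by lia)

open Classical in
theorem runs_unservedProg (hγ : 1 ≤ γ)
    (hA : ∀ E₀ Q S, ∀ x ∈ (A E₀ Q).support, N.pcCost E₀ Q x.1 ≤ γ * N.pcCost E₀ Q S)
    (hE : ∀ e, N.cost e = 0 → e ∈ s.set 6 0)
    (h : Runs γ known t A unservedProg s s') :
    (∀ j < known.length, s'.nat 3 j =
      if s.nat 1 j ≠ 0 ∧ ¬ Serves known j (s.set 6 0) then 1 else 0) ∧
    s'.real 9 0 = s.real 9 0 + ∑ j ∈ Finset.range known.length,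
      if s.nat 1 j ≠ 0 ∧ ¬ Serves known j (s.set 6 0) then s.real 3 j else 0 := by
  refine (h.loop_rule (n := known.length) (fun m u => (u.nat 1 = s.nat 1 ∧ u.real 3 = s.real 3 ∧
    u.set 6 = s.set 6) ∧
    (∀ j < m, u.nat 3 j = if s.nat 1 j ≠ 0 ∧ ¬ Serves known j (s.set 6 0) then 1 else 0) ∧
    u.real 9 0 = s.real 9 0 + ∑ j ∈ Finset.range m,
      if s.nat 1 j ≠ 0 ∧ ¬ Serves known j (s.set 6 0) then s.real 3 j else 0) rfl ?_ ?_).2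
  · intro u hu
    simp [hu.real, hu.nat, hu.set]
  · rintro m hm u v u' ⟨⟨h1, h2, h3⟩, h4, h5⟩ hv hu'
    obtain ⟨w, hw, hu'⟩ := runs_seq.1 hu'
    have hw := hw.of_setNat
    obtain ⟨y, hy, hu'⟩ := hu'.of_ite
    have h6 : v.nat 6 0 = m := by simp [hv.nat, store_apply]
    have hyn : y.nat = store v.nat 3 m 0 := by simp [hy.nat, hw.nat, NatExp.val, h6]
    have hyr : y.real = u.real := by rw [hy.real, hw.real, hv.real]
    have hys : y.set = u.set := by rw [hy.set, hw.set, hv.set]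
    have hy6 : y.nat 6 0 = m := by simp [hyn, store_of_ne, h6]
    have hy1 : y.nat 1 = s.nat 1 := by simp [hyn, store_of_ne, hv.nat, h1]
    have hy3 : ∀ j < m + 1, y.nat 3 j = if j = m then 0 else
        if s.nat 1 j ≠ 0 ∧ ¬ Serves known j (s.set 6 0) then 1 else 0 := by
      intro j hj
      simp only [hyn, store_apply, true_and]
      split_ifs with _ hh
      · rfl
      · rw [hv.nat]
        simp only [store_of_ne _ _ _ (show 3 ≠ 6 by decide)]
        rw [h4 j (by lia), if_pos hh]
      · rw [hv.nat]
        simp only [store_of_ne _ _ _ (show 3 ≠ 6 by decide)]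
        rw [h4 j (by lia), if_neg hh]
    rw [Finset.sum_range_succ]
    have hT : (Test.natLt (.lit 0) (.get 1 (.reg 6))).holds γ known t w ↔ s.nat 1 m ≠ 0 := by
      simp only [Test.holds, NatExp.val, hy.nat.symm, hy6, hy1, Nat.pos_iff_ne_zero, ne_eq]
    rw [hT] at hu'
    rcases hu' with ⟨hp, hu'⟩ | ⟨hp, hu'⟩
    · obtain ⟨z, hz, hu'⟩ := runs_seq.1 hu'
      have hserved := runs_servedProg hγ hA hy6 hm (by rw [hys, h3]; exact hE) hz
      rw [hys, h3] at hserved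
      have hz1 : z.nat 1 = s.nat 1 := by rw [hz.nat_eq (by decide), hy1]
      have hz3 : z.nat 3 = y.nat 3 := hz.nat_eq (by decide)
      have hz6 : z.nat 6 0 = m := by rw [hz.nat_eq (by decide), hy6]
      have hzr3 : z.real 3 = s.real 3 := by rw [hz.real_eq (by decide), hyr, h2]
      have hzr9 : z.real 9 = u.real 9 := by rw [hz.real_eq (by decide), hyr]
      have hzs : z.set 6 = s.set 6 := by rw [hz.set_eq (by decide), hys, h3]
      obtain ⟨a, ha, hu'⟩ := hu'.of_ite
      have hT' : (Test.natLt (.lit 0) (.reg 10)).holds γ known t z ↔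
          ¬ Serves known m (s.set 6 0) := by
        rw [← hserved]
        simp only [Test.holds, NatExp.val, Nat.pos_iff_ne_zero, ne_eq]
      rw [hT'] at hu'
      rcases hu' with ⟨hq, hu'⟩ | ⟨hq, hu'⟩
      · obtain ⟨b, hb, hu'⟩ := runs_seq.1 hu'
        have hb := hb.of_setNat
        have hu' := hu'.of_setReal
        simp only [NatExp.val, ha.nat, hz6] at hb
        rw [if_pos ⟨hp, hq⟩]
        refine ⟨⟨?_, ?_, ?_⟩, fun j hj => ?_, ?_⟩
        · simp [hu'.nat, hb.nat, store_of_ne, hz1]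
        · simp [hu'.real, hb.real, ha.real, store_of_ne, hzr3]
        · simp [hu'.set, hb.set, ha.set, hzs]
        · simp only [hu'.nat, hb.nat, store_apply, true_and]
          rw [hz3, hy3 j hj]
          split_ifs <;> simp_all
        · simp [hu'.real, hb.real, hb.nat, ha.real, store_apply, NatExp.val, RealExp.val, hz6, hzr3,
            hzr9, h5, add_assoc]
      · have hu' := hu'.of_skip
        rw [if_neg (fun hh => hq hh.2)]
        refine ⟨⟨?_, ?_, ?_⟩, fun j hj => ?_, ?_⟩
        · simp [hu'.nat, ha.nat, hz1]
        · simp [hu'.real, ha.real, hzr3]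
        · simp [hu'.set, ha.set, hzs]
        · simp only [hu'.nat, ha.nat]
          rw [hz3, hy3 j hj]
          split_ifs <;> simp_all
        · simp [hu'.real, ha.real, hzr9, h5]
    · have hu' := hu'.of_skip
      rw [if_neg (fun hh => hp hh.1)]
      refine ⟨⟨?_, ?_, ?_⟩, fun j hj => ?_, ?_⟩
      · simp [hu'.nat, hy1]
      · simp [hu'.real, hyr, h2]
      · simp [hu'.set, hys, h3]
      · simp only [hu'.nat]
        rw [hy3 j hj]
        split_ifs <;> simp_all
      · simp [hu'.real, hyr, h5]

/-- The cost of the solution `S` of the prize-collecting problem on the requests in `M`, with free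
elements `E₀`, when the penalties are the residual delays at time `x`. -/
def waitCost (known : List (Request N)) (E₀ : N.Sets) (M : ℕ → Prop) (h : ℕ → ℝ) (x : ℝ)
    (S : N.Sets) : ℝ :=
  N.setCost (S \ E₀) + totalResidual known (fun q => M q ∧ ¬ Serves known q S) h x

theorem runs_evalProg (hγ : 1 ≤ γ)
    (hA : ∀ E₀ Q S, ∀ x ∈ (A E₀ Q).support, N.pcCost E₀ Q x.1 ≤ γ * N.pcCost E₀ Q S)
    (hE : ∀ e, N.cost e = 0 → e ∈ s.set 2 0)
    (h : Runs γ known t A evalProg s s') :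
    s.set 2 0 ⊆ s'.set 6 0 ∧
    (∀ q < known.length, s'.nat 3 q ≠ 0 ↔ s.nat 1 q ≠ 0 ∧ ¬ Serves known q (s'.set 6 0)) ∧
    s'.real 9 0 = N.setCost (s'.set 6 0 \ s.set 2 0) +
      totalResidual known (fun q => s'.nat 3 q ≠ 0) (s.real 1) (s.real 8 0) ∧
    ∀ S, s'.real 9 0 ≤ γ * waitCost known (s.set 2 0) (fun q => s.nat 1 q ≠ 0) (s.real 1)
      (s.real 8 0) S := by
  classical
  obtain ⟨u1, h1, h⟩ := runs_seq.1 h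
  obtain ⟨u2, h2, h⟩ := runs_seq.1 h
  obtain ⟨u3, h3, h⟩ := runs_seq.1 h
  obtain ⟨u4, h4, h⟩ := runs_seq.1 h
  have hpen := runs_penaltyProg h1
  have h13 : ∀ a, a ≠ 7 → u3.nat a = s.nat a := fun a ha => by
    rw [h3.nat_eq (by simp [Prog.writes]), h2.nat_eq (by simp [Prog.writes]),
      h1.nat_eq (by simp [penaltyProg, Prog.writes, ha])]
  have h3r : u3.real = u1.real := by
    funext a
    rw [h3.real_eq (by simp [Prog.writes]), h2.real_eq (by simp [Prog.writes])]
  have u1s : ∀ a, u1.set a = s.set a := fun a => h1.set_eq (by simp [penaltyProg, Prog.writes])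
  obtain ⟨ans, hans, hu2⟩ := runs_solve.1 h2
  have u25 : u2.set 5 0 = ans.1 := by simp [hu2, store_apply]
  have u22 : u2.set 2 = s.set 2 := by rw [h2.set_eq (by decide), u1s]
  have h3 := h3.of_setSet
  have u36 : u3.set 6 0 = ans.1 ∪ s.set 2 0 := by
    simp [h3.set, store_apply, SetExp.val, NatExp.val, u25, u22]
  have u32 : u3.set 2 = s.set 2 := by simp [h3.set, store_of_ne, u22]
  have hcost := runs_sumCostProg (I := 0) (X := (ans.1 ∪ s.set 2 0) \ s.set 2 0)
    (fun u => rfl) (fun u hu => by simp [SetExp.val, NatExp.val, hu, u36, u32]) h4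
  have u46 : u4.set 6 0 = ans.1 ∪ s.set 2 0 := by rw [h4.set_eq (by decide), u36]
  have u41 : u4.nat 1 = s.nat 1 := by rw [h4.nat_eq (by decide), h13 1 (by decide)]
  have u4p : ∀ j < known.length, u4.real 3 j = residual known j (s.real 1 j) (s.real 8 0) := by
    intro j hj
    rw [h4.real_eq (by decide), h3r, hpen j hj]
  obtain ⟨k1, k2⟩ := runs_unservedProg hγ hA
    (by rw [u46]; exact fun e he => Finset.mem_union_right _ (hE e he)) h
  have s'6 : s'.set 6 0 = ans.1 ∪ s.set 2 0 := by rw [h.set_eq (by decide), u46]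
  rw [u46, u41] at k1 k2
  have k3 : ∀ q < known.length, s'.nat 3 q ≠ 0 ↔
      s.nat 1 q ≠ 0 ∧ ¬ Serves known q (s'.set 6 0) := by
    intro q hq
    rw [k1 q hq, s'6]
    split_ifs with hh <;> simp [hh]
  have k4 : s'.real 9 0 = N.setCost (s'.set 6 0 \ s.set 2 0) +
      totalResidual known (fun q => s'.nat 3 q ≠ 0) (s.real 1) (s.real 8 0) := by
    rw [k2, hcost.1, s'6]
    congr 1
    refine Finset.sum_congr rfl fun q hq => ?_
    have hq := Finset.mem_range.1 hq
    have := k3 q hq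
    rw [s'6] at this
    simp only [this, u4p q hq]
  refine ⟨by rw [s'6]; exact Finset.subset_union_right, k3, k4, fun S => ?_⟩
  have key := hA _ _ S ans hans
  have e : (SetExp.reg 2).val known u1 = s.set 2 0 := by simp [SetExp.val, NatExp.val, u1s]
  rw [e] at key
  simp only [pcCost_callList, sum_ite_mem_eq_setCost_sdiff] at key
  have hval : ∀ S : N.Sets, ((N.setCost (S \ s.set 2 0) + ∑ q ∈ Finset.range known.length,
      if u1.nat 1 q = 0 then 0 else if Serves known q S then 0 else (u1.real 3 q).toNNReal :
        ℝ≥0) : ℝ) = waitCost known (s.set 2 0) (fun q => s.nat 1 q ≠ 0) (s.real 1)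
      (s.real 8 0) S := by
    intro S
    unfold waitCost totalResidual
    push_cast
    congr 1
    refine Finset.sum_congr rfl fun q hq => ?_
    have hq := Finset.mem_range.1 hq
    rw [h1.nat_eq (show 1 ∉ _ by decide), hpen q hq]
    by_cases hh : s.nat 1 q = 0 <;> by_cases hh' : Serves known q S <;>
      simp [hh, hh', residual_nonneg]
  have key' := NNReal.coe_le_coe.2 key
  rw [NNReal.coe_mul, hval S, hval ans.1] at key'
  refine le_trans ?_ key'
  rw [k4, waitCost, s'6, Finset.union_sdiff_right]
  refine add_le_add le_rfl (totalResidual_mono_set (fun q hq hM => ?_) _ _)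
  have := (k3 q hq).1 hM
  rw [s'6] at this
  exact ⟨this.1, fun hs => this.2 (hs.mono Finset.subset_union_left)⟩

theorem runs_isEmptyProg (h : Runs γ known t A isEmptyProg s s') :
    s'.nat 10 0 = 0 ↔ ∀ q < known.length, s.nat 2 q = 0 := by
  obtain ⟨u0, h0, h⟩ := runs_seq.1 h
  have h0 := h0.of_setNat
  refine (h.loop_rule (n := known.length) (fun m u => u.nat 2 = s.nat 2 ∧
    (u.nat 10 0 = 0 ↔ ∀ q < m, s.nat 2 q = 0)) rfl ?_ ?_).2
  · intro u hu
    simp [hu.nat, h0.nat, store_apply, NatExp.val, store_of_ne]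
  · rintro m - u v u' ⟨h1, h2⟩ hv hu'
    obtain ⟨w, hw, hu'⟩ := hu'.of_ite
    have h7 : v.nat 7 0 = m := by simp [hv.nat, store_apply]
    have v2 : v.nat 2 = s.nat 2 := by simp [hv.nat, store_of_ne, h1]
    have v10 : v.nat 10 = u.nat 10 := by simp [hv.nat, store_of_ne]
    simp only [Test.holds, NatExp.val, h7, v2, Nat.pos_iff_ne_zero, ne_eq] at hu'
    rcases hu' with ⟨hp, hu'⟩ | ⟨hp, hu'⟩
    · have hu' := hu'.of_setNat
      refine ⟨by simp [hu'.nat, hw.nat, store_of_ne, v2], ?_⟩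
      simp only [hu'.nat, store_apply, NatExp.val, and_self, if_true, one_ne_zero, false_iff]
      exact fun hall => hp (hall m (Nat.lt_succ_self m))
    · have hu' := hu'.of_skip
      refine ⟨by simp [hu'.nat, hw.nat, v2], ?_⟩
      rw [hu'.nat, hw.nat, v10, h2]
      refine ⟨fun hall q hq => ?_, fun hall q hq => hall q (hq.trans (Nat.lt_succ_self m))⟩
      rcases Nat.lt_succ_iff_lt_or_eq.1 hq with hq | rfl
      · exact hall q hq
      · exact not_not.1 hp

end

/-- Rounds of forwarding, as many as can be needed. -/
def forwardProg : Prog := .loop 5 (.add (.add .numReqs .numReqs) (.lit 1)) roundProg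

section
variable {N : Network.{u}} {γ : ℝ≥0} {known : List (Request N)} {t : ℝ} {A : Solver PMF N}
variable {s s' : Mem N.numElems}

/-- The invariant of forwarding, started at time `t` with memory `s`, with `B = γw`: the current
solution `u.set 3 0` costs at most `B` and serves the requests outside the mask `u.nat 2`, whose
residual delay at the time reached `u.real 8 0` is at most `2B`; and if
forwarding is over with requests left unserved, then this time is so late that no solution of the
prize-collecting problem costs less than `w`. -/
structure Forwarding (known : List (Request N)) (t B w : ℝ) (s u : Mem N.numElems) : Prop where
  le_time : t ≤ u.real 8 0
  sub : ∀ q < known.length, u.nat 2 q ≠ 0 → s.nat 1 q ≠ 0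
  serves : ∀ q < known.length, s.nat 1 q ≠ 0 → u.nat 2 q = 0 → Serves known q (u.set 3 0)
  cost_le : N.setCost (u.set 3 0 \ s.set 2 0) ≤ B
  residual_le : totalResidual known (fun q => u.nat 2 q ≠ 0) (s.real 1) (u.real 8 0) ≤ 2 * B
  le_waitCost : u.nat 9 0 ≠ 0 → (∃ q < known.length, u.nat 2 q ≠ 0) → ∀ S,
    w ≤ waitCost known (s.set 2 0) (fun q => s.nat 1 q ≠ 0) (s.real 1) (u.real 8 0) S

theorem Forwarding.congr {B w : ℝ} {u v : Mem N.numElems} (hF : Forwarding known t B w s u)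
    (h2 : v.nat 2 = u.nat 2)
    (h9 : v.nat 9 0 ≠ 0 → u.nat 9 0 ≠ 0 ∨ ∀ q < known.length, u.nat 2 q = 0)
    (h8 : v.real 8 0 = u.real 8 0) (h3 : v.set 3 0 = u.set 3 0) :
    Forwarding known t B w s v := by
  constructor
  · rw [h8]; exact hF.le_time
  · rw [h2]; exact hF.sub
  · rw [h2, h3]; exact hF.serves
  · rw [h3]; exact hF.cost_le
  · rw [h2, h8]; exact hF.residual_le
  · rw [h2, h8]
    rintro h ⟨q, hq, hq'⟩
    rcases h9 h with h | h
    · exact hF.le_waitCost h ⟨q, hq, hq'⟩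
    · exact absurd (h q hq) hq'

open Classical in
/-- The sum of the residual delays truncated at `B`. -/
def truncResidual (known : List (Request N)) (M : ℕ → Prop) (h : ℕ → ℝ) (B x : ℝ) : ℝ :=
  ∑ q ∈ Finset.range known.length, if M q then min (residual known q (h q) x) B else 0

theorem truncResidual_le {M : ℕ → Prop} {h : ℕ → ℝ} {B x : ℝ} (hB : 0 ≤ B) :
    truncResidual known M h B x ≤ known.length * B := by
  classical
  calc truncResidual known M h B x ≤ ∑ q ∈ Finset.range known.length, B := by
        refine Finset.sum_le_sum fun q _ => ?_
        split_ifs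
        · exact min_le_right _ _
        · exact hB
    _ = _ := by simp

theorem truncResidual_nonneg {M : ℕ → Prop} {h : ℕ → ℝ} {B x : ℝ} (hB : 0 ≤ B) :
    0 ≤ truncResidual known M h B x := by
  classical
  refine Finset.sum_nonneg fun q _ => ?_
  split_ifs
  · exact le_min (residual_nonneg _ _ _ _) hB
  · exact le_rfl

/-- If the residual delay of a subset `U` of `M` grows to at most `B` between `x` and `y`, then the
truncated sum over `M` grows by at least as much. -/
theorem truncResidual_add_le {M U : ℕ → Prop} {h : ℕ → ℝ} {B x y : ℝ} (hxy : x ≤ y)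
    (hU : ∀ q < known.length, U q → M q) (hy : totalResidual known U h y ≤ B) :
    truncResidual known M h B x + (totalResidual known U h y - totalResidual known U h x) ≤
      truncResidual known M h B y := by
  classical
  have hle : ∀ q < known.length, U q → residual known q (h q) y ≤ B := by
    intro q hq hUq
    refine le_trans ?_ hy
    unfold totalResidual
    refine le_trans (by rw [if_pos hUq]) (Finset.single_le_sum (fun q _ => ?_)
      (Finset.mem_range.2 hq))
    split_ifs
    · exact residual_nonneg _ _ _ _
    · exact le_rfl
  unfold truncResidual totalResidual
  rw [← Finset.sum_sub_distrib, ← Finset.sum_add_distrib]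
  refine Finset.sum_le_sum fun q hq => ?_
  have hq := Finset.mem_range.1 hq
  have hmono := residual_mono known q (h q) hxy
  by_cases h1 : U q
  · have h2 := hU q hq h1
    simp only [h1, h2, if_true]
    rw [min_eq_left (hle q hq h1), min_eq_left (hmono.trans (hle q hq h1))]
    linarith
  · by_cases h2 : M q
    · simp only [h1, h2, if_true, if_false, sub_zero, add_zero]
      exact min_le_min hmono le_rfl
    · simp [h1, h2]

/-- A round of forwarding, unless it is the last one, raises the sum of the residual delays
truncated at `2γw` by `γw` at least: the residual delay of the unserved requests grows from at most
`γw` to `2γw`. -/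
theorem runs_roundProg {w : ℝ} (hγ : 1 ≤ γ) (hw : 0 < w)
    (hA : ∀ E₀ Q S, ∀ x ∈ (A E₀ Q).support, N.pcCost E₀ Q x.1 ≤ γ * N.pcCost E₀ Q S)
    (hE : ∀ e, N.cost e = 0 → e ∈ s.set 2 0) {u u' : Mem N.numElems}
    (hu1 : u.nat 1 = s.nat 1) (hur1 : u.real 1 = s.real 1) (hur10 : u.real 10 0 = w)
    (hu2 : u.set 2 = s.set 2) (hF : Forwarding known t (γ * w) w s u)
    (hres : u.nat 9 0 = 0 →
      totalResidual known (fun q => u.nat 2 q ≠ 0) (s.real 1) (u.real 8 0) ≤ γ * w)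
    (h : Runs γ known t A roundProg u u') :
    Forwarding known t (γ * w) w s u' ∧ (u'.nat 9 0 = 0 →
      totalResidual known (fun q => u'.nat 2 q ≠ 0) (s.real 1) (u'.real 8 0) ≤ γ * w ∧
      u.nat 9 0 = 0 ∧
      truncResidual known (fun q => s.nat 1 q ≠ 0) (s.real 1) (2 * (γ * w)) (u.real 8 0) + γ * w ≤
        truncResidual known (fun q => s.nat 1 q ≠ 0) (s.real 1) (2 * (γ * w)) (u'.real 8 0)) := by
  have hB : 0 < γ * w := mul_pos (lt_of_lt_of_le one_pos (by exact_mod_cast hγ)) hw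
  obtain ⟨v, hv, h⟩ := h.of_ite
  rcases h with ⟨hdone, h⟩ | ⟨hdone, h⟩
  swap
  · -- The flag is up already.
    have h := h.of_skip
    simp only [Test.holds, NatExp.val, not_lt] at hdone
    have e1 : u'.nat = u.nat := by rw [h.nat, hv.nat]
    have e2 : u'.real = u.real := by rw [h.real, hv.real]
    have e3 : u'.set = u.set := by rw [h.set, hv.set]
    refine ⟨hF.congr (by rw [e1]) (by rw [e1]; exact Or.inl) (by rw [e2]) (by rw [e3]), ?_⟩
    rw [e1]
    intro h
    lia
  have hdone : u.nat 9 0 = 0 := by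
    simp only [Test.holds, NatExp.val] at hdone
    lia
  have hres := hres hdone
  obtain ⟨v1, h1, h⟩ := runs_seq.1 h
  have hempty := runs_isEmptyProg h1
  rw [hv.nat] at hempty
  have v1n : ∀ a, a ≠ 7 → a ≠ 10 → v1.nat a = u.nat a := fun a h h' => by
    rw [h1.nat_eq (by simp [isEmptyProg, Prog.writes, h, h']), hv.nat]
  have v1r : v1.real = u.real := by
    funext a
    rw [h1.real_eq (by simp [isEmptyProg, Prog.writes]), hv.real]
  have v1s : v1.set = u.set := by
    funext a
    rw [h1.set_eq (by simp [isEmptyProg, Prog.writes]), hv.set]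
  obtain ⟨v2, hv2, h⟩ := h.of_ite
  simp only [Test.holds, NatExp.val, Nat.lt_one_iff, hempty] at h
  rcases h with ⟨hem, h⟩ | ⟨hem, h⟩
  · -- All requests are served.
    have h := h.of_setNat
    have e1 : u'.nat 2 = u.nat 2 := by
      simp [h.nat, hv2.nat, store_of_ne, v1n]
    have e2 : u'.real = u.real := by rw [h.real, hv2.real, v1r]
    have e3 : u'.set = u.set := by rw [h.set, hv2.set, v1s]
    refine ⟨hF.congr e1 (fun _ => Or.inr hem) (by rw [e2]) (by rw [e3]), fun h9 => ?_⟩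
    simp [h.nat, store_apply, NatExp.val] at h9
  · have hne : ∃ q < known.length, u.nat 2 q ≠ 0 := by
      by_contra hcon
      exact hem fun q hq => by_contra fun h => hcon ⟨q, hq, h⟩
    obtain ⟨v3, h3, h⟩ := runs_seq.1 h
    obtain ⟨v4, h4, h⟩ := runs_seq.1 h
    have h3 := h3.of_crossing
    have v2n : ∀ a, a ≠ 7 → a ≠ 10 → v2.nat a = u.nat a := fun a h h' => by rw [hv2.nat, v1n a h h']
    have v2r : v2.real = u.real := by rw [hv2.real, v1r]
    have v2s : v2.set = u.set := by rw [hv2.set, v1s]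
    have hex : ∀ x, excess known v2 2 1 x =
        totalResidual known (fun q => u.nat 2 q ≠ 0) (s.real 1) x := by
      intro x
      rw [excess_eq_totalResidual, v2n 2 (by decide) (by decide), v2r, hur1]
    have hθ : (RealExp.mulRatio (.add (.reg 10) (.reg 10))).val γ known t v2 = 2 * (γ * w) := by
      simp only [RealExp.val, NatExp.val, v2r, hur10]
      ring
    simp only [hex, hθ] at h3
    have hmono := totalResidual_mono known (fun q => u.nat 2 q ≠ 0) (s.real 1)
    obtain ⟨c1, c2⟩ := totalResidual_crossing (t := t) (θ := 2 * (γ * w))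
      ((hmono hF.le_time).trans (hres.trans (by linarith))) hne
    generalize sInf {x | t ≤ x ∧ 2 * (γ * w) ≤
      totalResidual known (fun q => u.nat 2 q ≠ 0) (s.real 1) x} = x at h3 c1 c2
    have hux : u.real 8 0 ≤ x := by
      by_contra hcon
      have := hmono (not_le.1 hcon).le
      rw [c2] at this
      linarith
    have v3n : ∀ a, a ≠ 7 → a ≠ 10 → v3.nat a = u.nat a := fun a h h' => by rw [h3.nat, v2n a h h']
    have v3r : ∀ a, a ≠ 8 → v3.real a = u.real a := fun a h => by
      rw [h3.real]
      simp [store_of_ne _ _ _ h, v2r]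
    have v38 : v3.real 8 0 = x := by simp [h3.real, store_apply]
    have v3s : v3.set = u.set := by rw [h3.set, v2s]
    obtain ⟨k1, k2, k3, k4⟩ := runs_evalProg hγ hA (by rw [v3s, hu2]; exact hE) h4
    simp only [v3s, hu2, v3n 1 (by decide) (by decide), hu1, v3r 1 (by decide), hur1, v38]
      at k1 k2 k3 k4
    have v4n : ∀ a, a < 3 ∨ a = 9 → v4.nat a = u.nat a := fun a h => by
      rw [h4.nat_eq, v3n a (by lia) (by lia)]
      have : a ≠ 3 ∧ a ≠ 4 ∧ a ≠ 6 ∧ a ≠ 7 ∧ a ≠ 10 := by lia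
      simp [evalProg, penaltyProg, unservedProg, sumCostProg, servedProg, soloProg, Prog.writes,
        this]
    have v48 : v4.real 8 0 = x := by rw [h4.real_eq (by decide), v38]
    have v410 : v4.real 10 0 = w := by rw [h4.real_eq (by decide), v3r 10 (by decide), hur10]
    have v43 : v4.set 3 = u.set 3 := by rw [h4.set_eq (by decide), v3s]
    obtain ⟨v5, hv5, h⟩ := h.of_ite
    simp only [Test.holds, RealExp.val, NatExp.val, v410] at h
    rcases h with ⟨hrej, h⟩ | ⟨hacc, h⟩
    · -- The solution is too expensive, and so is every solution, up to the factor `γ`.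
      have h := h.of_setNat
      have e1 : u'.nat 2 = u.nat 2 := by simp [h.nat, hv5.nat, store_of_ne, v4n]
      have e2 : u'.real 8 0 = x := by simp [h.real, hv5.real, v48]
      have e3 : u'.set 3 = u.set 3 := by simp [h.set, hv5.set, v43]
      constructor
      · constructor
        · rw [e2]; exact c1
        · rw [e1]; exact hF.sub
        · rw [e1, e3]; exact hF.serves
        · rw [e3]; exact hF.cost_le
        · rw [e1, e2]; exact c2.le
        · rintro - - S
          rw [e2]
          have := k4 S
          have hγ0 : (0 : ℝ) < γ := lt_of_lt_of_le one_pos (by exact_mod_cast hγ)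
          by_contra hcon
          have := mul_lt_mul_of_pos_left (not_le.1 hcon) hγ0
          linarith
      · intro h9
        simp [h.nat, store_apply, NatExp.val] at h9
    · rw [not_lt, mul_comm] at hacc
      obtain ⟨v6, h6, h⟩ := runs_seq.1 h
      have h6 := h6.of_setSet
      have v6n : v6.nat = v4.nat := by simp [h6.nat, hv5.nat]
      have v63 : v6.set 3 0 = v4.set 6 0 := by
        simp [h6.set, store_apply, NatExp.val, SetExp.val, hv5.set]
      have hmark := runs_markProg (p := fun j => v4.nat 3 j ≠ 0) (by
          intro u j h h' hr _
          simp only [Test.holds, NatExp.val, h', h 3 (by decide) (by decide), v6n,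
            Nat.pos_iff_ne_zero]) (by decide) h
      have hmark' : ∀ j < known.length, (u'.nat 2 j ≠ 0 ↔ v4.nat 3 j ≠ 0) := by
        intro j hj
        rw [hmark j hj]
        split_ifs with hh <;> simp [hh]
      have e2 : u'.real 8 0 = x := by
        rw [h.real_eq (by simp [markProg, Prog.writes]), h6.real]
        simp [hv5.real, v48]
      have e3 : u'.set 3 0 = v4.set 6 0 := by
        rw [h.set_eq (by simp [markProg, Prog.writes]), v63]
      have hres' : totalResidual known (fun q => u'.nat 2 q ≠ 0) (s.real 1) (u'.real 8 0) ≤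
          γ * w := by
        rw [totalResidual_congr hmark', e2]
        have := NNReal.coe_nonneg (N.setCost (v4.set 6 0 \ s.set 2 0))
        linarith
      refine ⟨⟨?_, fun q hq hq' => ?_, fun q hq hq' hq'' => ?_, ?_, ?_, ?_⟩, fun _ =>
        ⟨hres', hdone, ?_⟩⟩
      · rw [e2]; exact c1
      · exact ((k2 q hq).1 ((hmark' q hq).1 hq')).1
      · rw [e3]
        by_contra hcon
        exact (hmark' q hq).2 ((k2 q hq).2 ⟨hq', hcon⟩) hq''
      · rw [e3]
        have : 0 ≤ totalResidual known (fun q => v4.nat 3 q ≠ 0) (s.real 1) x :=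
          Finset.sum_nonneg fun q _ => by
            split_ifs
            · exact residual_nonneg _ _ _ _
            · exact le_rfl
        linarith
      · linarith
      · intro h9
        have : u'.nat 9 0 = 0 := by
          rw [h.nat_eq (by simp [markProg, Prog.writes]), v6n, v4n 9 (by lia), hdone]
        exact absurd this h9
      · have := truncResidual_add_le (M := fun q => s.nat 1 q ≠ 0) hux hF.sub c2.le
        rw [e2]
        rw [c2] at this
        linarith

/-- There are enough rounds for forwarding to come to its end, as the truncated sum of residual
delays is at most `2kγw` for `k` requests. -/
theorem runs_forwardProg {w : ℝ} (hγ : 1 ≤ γ) (hw : 0 < w)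
    (hA : ∀ E₀ Q S, ∀ x ∈ (A E₀ Q).support, N.pcCost E₀ Q x.1 ≤ γ * N.pcCost E₀ Q S)
    (hE : ∀ e, N.cost e = 0 → e ∈ s.set 2 0) (h10 : s.real 10 0 = w)
    (hF : Forwarding known t (γ * w) w s s)
    (hres : totalResidual known (fun q => s.nat 2 q ≠ 0) (s.real 1) (s.real 8 0) ≤ γ * w)
    (h : Runs γ known t A forwardProg s s') :
    s'.nat 9 0 ≠ 0 ∧ Forwarding known t (γ * w) w s s' := by
  have hB : 0 < γ * w := mul_pos (lt_of_lt_of_le one_pos (by exact_mod_cast hγ)) hw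
  have key := h.loop_rule (n := known.length + known.length + 1) (fun m u =>
    (u.nat 1 = s.nat 1 ∧ u.real 1 = s.real 1 ∧ u.real 10 0 = w ∧ u.set 2 = s.set 2) ∧
    Forwarding known t (γ * w) w s u ∧ (u.nat 9 0 = 0 →
      totalResidual known (fun q => u.nat 2 q ≠ 0) (s.real 1) (u.real 8 0) ≤ γ * w ∧
      m * (γ * w) ≤ truncResidual known (fun q => s.nat 1 q ≠ 0) (s.real 1) (2 * (γ * w))
        (u.real 8 0))) rfl ?_ ?_
  · obtain ⟨-, k1, k2⟩ := key
    refine ⟨fun h9 => ?_, k1⟩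
    have k3 := (k2 h9).2.trans (truncResidual_le (by linarith))
    push_cast at k3
    nlinarith
  · intro u hu
    refine ⟨by simp [hu.nat, hu.real, hu.set, h10], ?_, fun _ => ?_⟩
    · exact hF.congr (by rw [hu.nat]) (by rw [hu.nat]; exact Or.inl) (by rw [hu.real])
        (by rw [hu.set])
    · rw [hu.nat, hu.real]
      refine ⟨hres, ?_⟩
      rw [Nat.cast_zero, zero_mul]
      exact truncResidual_nonneg (by linarith)
  · rintro m - u v u' ⟨⟨a1, a2, a3, a4⟩, a5, a6⟩ hv hu'
    have vn : ∀ a, a ≠ 5 → v.nat a = u.nat a := fun a h => by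
      simp [hv.nat, store_of_ne _ _ _ h]
    have hFv : Forwarding known t (γ * w) w s v :=
      a5.congr (vn 2 (by decide)) (by rw [vn 9 (by decide)]; exact Or.inl) (by rw [hv.real])
        (by rw [hv.set])
    have := runs_roundProg hγ hw hA hE (by rw [vn 1 (by decide), a1]) (by rw [hv.real, a2])
      (by rw [hv.real, a3]) (by rw [hv.set, a4]) hFv
      (by
        rw [vn 9 (by decide), vn 2 (by decide), hv.real]
        exact fun h => (a6 h).1) hu'
    rw [vn 9 (by decide), hv.real] at this
    refine ⟨⟨?_, ?_, ?_, ?_⟩, this.1, fun h9 => ?_⟩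
    · rw [hu'.nat_eq (by decide), vn 1 (by decide), a1]
    · rw [hu'.real_eq (by decide), hv.real, a2]
    · rw [hu'.real_eq (by decide), hv.real, a3]
    · rw [hu'.set_eq (by decide), hv.set, a4]
    · obtain ⟨b1, b2, b3⟩ := this.2 h9
      refine ⟨b1, ?_⟩
      have := (a6 b2).2
      push_cast
      linarith

end

/-! ### Services -/

/-- Puts in the set register `2` the elements whose cost, times the number of elements, is at most
the real register `10`. -/
def freeProg : Prog :=
  .setSet 2 (.lit 0) .empty ;;
  .loop 7 .numElems (.ite (.not (.realLt (.reg 10) (.mulNat (.cost (.reg 7)) .numElems)))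
    (.setSet 2 (.lit 0) (.union (.reg 2) (.single (.reg 7)))) .skip)

/-- The request numbered by the natural register `7` is pending, of level at most the real register
`10`. -/
def touchedTest : Test :=
  .and (.natLt (.lit 0) (.get 0 (.reg 7))) (.not (.realLt (.reg 10) (.get 0 (.reg 7))))

/-- Puts in the set register `4` the free elements and the individual solutions of the cheap touched
requests. -/
def cheapProg : Prog :=
  .setSet 4 (.lit 0) (.reg 2) ;;
  .loop 7 .numReqs (.ite (.and touchedTest (.not (.natLt (.lit 0) (.get 1 (.reg 7)))))
    (.setSet 4 (.lit 0) (.union (.reg 4) (.get 0 (.reg 7)))) .skip)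

/-- Raises the offsets of the touched requests to their delay at the time in the real register `8`,
raises the level of those in the natural array `2`, and declares the others served. -/
def updateProg : Prog :=
  .loop 7 .numReqs (.ite touchedTest
    (.ite (.realLt (.get 1 (.reg 7)) (.delay (.reg 7) (.reg 8)))
        (.setReal 1 (.reg 7) (.delay (.reg 7) (.reg 8))) .skip ;;
      .ite (.natLt (.lit 0) (.get 2 (.reg 7)))
        (.setReal 0 (.reg 7) (.reg 10)) (.setNat 0 (.reg 7) (.lit 0))) .skip)

/-- A service, at twice the level in the real register `7`. -/
def serviceProg : Prog :=
  .setReal 10 (.lit 0) (.add (.reg 7) (.reg 7)) ;;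
  freeProg ;;
  markProg 1 (.and touchedTest
    (.realLt (.mulRatio (.reg 10)) (.mulNat (.get 2 (.reg 7)) .numReqs))) ;;
  markProg 2 (.natLt (.lit 0) (.get 1 (.reg 7))) ;;
  cheapProg ;;
  .setSet 3 (.lit 0) (.reg 2) ;;
  .setReal 8 (.lit 0) .now ;;
  .setNat 9 (.lit 0) (.lit 0) ;;
  forwardProg ;;
  updateProg ;;
  .transmit (.union (.reg 3) (.reg 4))

section
variable {N : Network.{u}} {γ : ℝ≥0} {known : List (Request N)} {t : ℝ} {A : Solver PMF N}
variable {s s' : Mem N.numElems}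

/-- The elements that cost at most a share of `w`. -/
def freeElems (N : Network.{u}) (w : ℝ) : N.Sets :=
  Finset.univ.filter fun e => (N.cost e : ℝ) * N.numElems ≤ w

theorem setCost_freeElems_le {w : ℝ} (hw : 0 ≤ w) : (N.setCost (freeElems N w) : ℝ) ≤ w := by
  rcases Nat.eq_zero_or_pos N.numElems with h | h
  · have : freeElems N w = ∅ := by
      ext e
      exact absurd e.2 (by lia)
    simpa [this, Network.setCost] using hw
  · have h' : (0 : ℝ) < N.numElems := by exact_mod_cast h
    unfold Network.setCost
    push_cast
    calc ∑ e ∈ freeElems N w, (N.cost e : ℝ) ≤ ∑ e ∈ freeElems N w, w / N.numElems := by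
          refine Finset.sum_le_sum fun e he => ?_
          rw [le_div_iff₀ h']
          exact (Finset.mem_filter.1 he).2
      _ ≤ ∑ e : Fin N.numElems, w / N.numElems :=
          Finset.sum_le_sum_of_subset_of_nonneg (Finset.subset_univ _)
            fun _ _ _ => div_nonneg hw h'.le
      _ = w := by
          rw [Finset.sum_const, Finset.card_univ, Fintype.card_fin, nsmul_eq_mul]
          field_simp

theorem runs_freeProg (h : Runs γ known t A freeProg s s') :
    s'.set 2 0 = freeElems N (s.real 10 0) := by
  obtain ⟨u0, h0, h⟩ := runs_seq.1 h
  have h0 := h0.of_setSet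
  have key := h.loop_rule (n := N.numElems) (fun m u => u.real = s.real ∧
    ∀ e, e ∈ u.set 2 0 ↔ (e : ℕ) < m ∧ (N.cost e : ℝ) * N.numElems ≤ s.real 10 0) rfl ?_ ?_
  · ext e
    rw [key.2, freeElems, Finset.mem_filter]
    simp [e.2]
  · intro u hu
    simp [hu.real, hu.set, h0.real, h0.set, store_apply, NatExp.val, SetExp.val]
  · rintro m hm u v u' ⟨h1, h2⟩ hv hu'
    obtain ⟨w, hw, hu'⟩ := hu'.of_ite
    have h7 : v.nat 7 0 = m := by simp [hv.nat, store_apply]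
    simp only [Test.holds, RealExp.val, NatExp.val, h7, hv.real, h1, hm, dif_pos, not_lt] at hu'
    have split : ∀ e : Fin N.numElems, (e : ℕ) < m + 1 ↔ (e : ℕ) < m ∨ e = ⟨m, hm⟩ := by
      intro e
      rw [Nat.lt_succ_iff_lt_or_eq, Fin.ext_iff]
    rcases hu' with ⟨hp, hu'⟩ | ⟨hp, hu'⟩
    · have hu' := hu'.of_setSet
      refine ⟨by simp [hu'.real, hw.real, hv.real, h1], fun e => ?_⟩
      have e1 : u'.set 2 0 =
          u.set 2 0 ∪ Finset.univ.filter fun x : Fin N.numElems => (x : ℕ) = m := by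
        simp [hu'.set, store_apply, NatExp.val, SetExp.val, hw.set, hw.nat, hv.set, h7]
      rw [e1, Finset.mem_union, h2, Finset.mem_filter, split, Fin.ext_iff]
      constructor
      · rintro (⟨a, b⟩ | ⟨-, a⟩)
        · exact ⟨Or.inl a, b⟩
        · obtain rfl : e = ⟨m, hm⟩ := Fin.ext a
          exact ⟨Or.inr rfl, hp⟩
      · rintro ⟨a | a, b⟩
        · exact Or.inl ⟨a, b⟩
        · exact Or.inr ⟨Finset.mem_univ _, a⟩
    · have hu' := hu'.of_skip
      refine ⟨by simp [hu'.real, hw.real, hv.real, h1], fun e => ?_⟩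
      have e1 : u'.set 2 0 = u.set 2 0 := by rw [hu'.set, hw.set, hv.set]
      rw [e1, h2, split]
      refine ⟨fun h => ⟨Or.inl h.1, h.2⟩, ?_⟩
      rintro ⟨a | rfl, b⟩
      · exact ⟨a, b⟩
      · exact absurd b hp

/-- The request `q` is pending, of level at most `w`. -/
def Touched (s : Mem N.numElems) (w : ℝ) (q : ℕ) : Prop := s.nat 0 q ≠ 0 ∧ s.real 0 q ≤ w

theorem holds_touchedTest {u : Mem N.numElems} {j : ℕ} (h7 : u.nat 7 0 = j) :
    touchedTest.holds γ known t u ↔ Touched u (u.real 10 0) j := by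
  simp [touchedTest, Test.holds, NatExp.val, RealExp.val, h7, Touched, Nat.pos_iff_ne_zero]

open Classical in
theorem runs_cheapProg (h : Runs γ known t A cheapProg s s') :
    s.set 2 0 ⊆ s'.set 4 0 ∧
    (∀ q < known.length, Touched s (s.real 10 0) q → s.nat 1 q = 0 → s.set 0 q ⊆ s'.set 4 0) ∧
    N.setCost (s'.set 4 0) ≤ N.setCost (s.set 2 0) + ∑ q ∈ Finset.range known.length,
      if Touched s (s.real 10 0) q ∧ s.nat 1 q = 0 then N.setCost (s.set 0 q) else 0 := by
  obtain ⟨u0, h0, h⟩ := runs_seq.1 h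
  have h0 := h0.of_setSet
  refine (h.loop_rule (n := known.length) (fun m u => (u.real = s.real ∧
    (∀ a, a ≠ 7 → u.nat a = s.nat a) ∧ u.set 0 = s.set 0) ∧
    s.set 2 0 ⊆ u.set 4 0 ∧
    (∀ q < m, Touched s (s.real 10 0) q → s.nat 1 q = 0 → s.set 0 q ⊆ u.set 4 0) ∧
    N.setCost (u.set 4 0) ≤ N.setCost (s.set 2 0) + ∑ q ∈ Finset.range m,
      if Touched s (s.real 10 0) q ∧ s.nat 1 q = 0 then N.setCost (s.set 0 q) else 0)
      rfl ?_ ?_).2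
  · intro u hu
    simp [hu.real, hu.set, hu.nat, h0.real, h0.set, h0.nat, store_apply, store_of_ne, NatExp.val,
      SetExp.val]
  · rintro m hm u v u' ⟨⟨h1, h2, h3⟩, h4, h5, h6⟩ hv hu'
    obtain ⟨w, hw, hu'⟩ := hu'.of_ite
    have h7 : v.nat 7 0 = m := by simp [hv.nat, store_apply]
    have vn : ∀ a, a ≠ 7 → v.nat a = s.nat a := fun a h => by
      simp [hv.nat, store_of_ne _ _ _ h, h2 a h]
    have vr : v.real = s.real := by rw [hv.real, h1]
    have hT : (Test.and touchedTest (.not (.natLt (.lit 0) (.get 1 (.reg 7))))).holds γ known t v ↔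
        Touched s (s.real 10 0) m ∧ s.nat 1 m = 0 := by
      change touchedTest.holds γ known t v ∧ _ ↔ _
      rw [holds_touchedTest h7]
      simp [Test.holds, NatExp.val, h7, Touched, vn, vr]
    rw [hT] at hu'
    rw [Finset.sum_range_succ]
    rcases hu' with ⟨hp, hu'⟩ | ⟨hp, hu'⟩
    · have hu' := hu'.of_setSet
      have e1 : u'.set 4 0 = u.set 4 0 ∪ s.set 0 m := by
        simp [hu'.set, store_apply, NatExp.val, SetExp.val, hw.set, hw.nat, hv.set, h7, h3]
      rw [e1, if_pos hp]
      refine ⟨⟨?_, fun a ha => ?_, ?_⟩, h4.trans Finset.subset_union_left, ?_, ?_⟩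
      · rw [hu'.real, hw.real, vr]
      · rw [hu'.nat, hw.nat, vn a ha]
      · simp [hu'.set, store_of_ne, hw.set, hv.set, h3]
      · intro q hq ht hq'
        rcases Nat.lt_succ_iff_lt_or_eq.1 hq with hq | rfl
        · exact (h5 q hq ht hq').trans Finset.subset_union_left
        · exact Finset.subset_union_right
      · rw [← add_assoc]
        exact (setCost_union_le _ _).trans (add_le_add h6 le_rfl)
    · have hu' := hu'.of_skip
      have e1 : u'.set = u.set := by rw [hu'.set, hw.set, hv.set]
      rw [e1, if_neg hp, add_zero]
      refine ⟨⟨?_, fun a ha => ?_, h3⟩, h4, ?_, h6⟩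
      · rw [hu'.real, hw.real, vr]
      · rw [hu'.nat, hw.nat, vn a ha]
      · intro q hq ht hq'
        rcases Nat.lt_succ_iff_lt_or_eq.1 hq with hq | rfl
        · exact h5 q hq ht hq'
        · exact absurd ⟨ht, hq'⟩ hp

theorem add_residual (q : ℕ) (h x : ℝ) :
    h + residual known q h x = max h (delayOf known q x) := by
  rw [residual, ← max_add_add_left]
  simp

open Classical in
theorem runs_updateProg (h : Runs γ known t A updateProg s s') : ∀ q < known.length,
    (s'.nat 0 q = if Touched s (s.real 10 0) q ∧ s.nat 2 q = 0 then 0 else s.nat 0 q) ∧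
    (s'.real 0 q = if Touched s (s.real 10 0) q ∧ s.nat 2 q ≠ 0 then s.real 10 0 else s.real 0 q) ∧
    (s'.real 1 q = if Touched s (s.real 10 0) q then
      s.real 1 q + residual known q (s.real 1 q) (s.real 8 0) else s.real 1 q) := by
  have key := h.loop_rule (n := known.length) (fun m u => (u.real 10 = s.real 10 ∧
    u.real 8 = s.real 8 ∧ u.nat 2 = s.nat 2) ∧ ∀ q,
    (u.nat 0 q = if q < m ∧ Touched s (s.real 10 0) q ∧ s.nat 2 q = 0 then 0 else s.nat 0 q) ∧
    (u.real 0 q = if q < m ∧ Touched s (s.real 10 0) q ∧ s.nat 2 q ≠ 0 then s.real 10 0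
      else s.real 0 q) ∧
    (u.real 1 q = if q < m ∧ Touched s (s.real 10 0) q then
      s.real 1 q + residual known q (s.real 1 q) (s.real 8 0) else s.real 1 q)) rfl ?_ ?_
  · intro q hq
    simpa [hq] using key.2 q
  · intro u hu
    simp [hu.real, hu.nat]
  · rintro m hm u v u' ⟨⟨h1, h2, h3⟩, h4⟩ hv hu'
    obtain ⟨w, hw, hu'⟩ := hu'.of_ite
    have h7 : v.nat 7 0 = m := by simp [hv.nat, store_apply]
    have vn : ∀ a, a ≠ 7 → v.nat a = u.nat a := fun a h => by
      simp [hv.nat, store_of_ne _ _ _ h]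
    have wn : ∀ a, a ≠ 7 → w.nat a = u.nat a := fun a h => by rw [hw.nat, vn a h]
    have w7 : w.nat 7 0 = m := by rw [hw.nat, h7]
    have wr : w.real = u.real := by rw [hw.real, hv.real]
    obtain ⟨a1, a2, a3⟩ := h4 m
    simp only [lt_irrefl, false_and, if_false] at a1 a2 a3
    have hT : touchedTest.holds γ known t v ↔ Touched s (s.real 10 0) m := by
      rw [holds_touchedTest h7]
      simp [Touched, vn, hv.real, h1, a1, a2]
    rw [hT] at hu'
    have succ : ∀ q, q ≠ m → (q < m + 1 ↔ q < m) := fun q hq => by lia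
    rcases hu' with ⟨hp, hu'⟩ | ⟨hp, hu'⟩
    · obtain ⟨x, hx, hu'⟩ := runs_seq.1 hu'
      have hd : (RealExp.delay (.reg 7) (.reg 8)).val γ known t w =
          delayOf known m (s.real 8 0) := by
        rw [delay_val]
        simp [NatExp.val, RealExp.val, w7, wr, h2]
      have hx' : x.nat = w.nat ∧ x.real = store u.real 1 m
          (s.real 1 m + residual known m (s.real 1 m) (s.real 8 0)) := by
        rw [add_residual]
        obtain ⟨y, hy, hx⟩ := hx.of_ite
        have hd' : (RealExp.delay (.reg 7) (.reg 8)).val γ known t y =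
            delayOf known m (s.real 8 0) := by
          rw [delay_val]
          simp [NatExp.val, RealExp.val, hy.nat, w7, hy.real, wr, h2]
        have e : (RealExp.get 1 (.reg 7)).val γ known t w = s.real 1 m := by
          simp [RealExp.val, NatExp.val, w7, wr, a3]
        simp only [Test.holds, hd, e] at hx
        rcases hx with ⟨hlt, hx⟩ | ⟨hlt, hx⟩
        · have hx := hx.of_setReal
          rw [hd'] at hx
          refine ⟨by rw [hx.nat, hy.nat], ?_⟩
          rw [hx.real, max_eq_right hlt.le]
          simp [NatExp.val, hy.nat, w7, hy.real, wr]
        · have hx := hx.of_skip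
          refine ⟨by rw [hx.nat, hy.nat], ?_⟩
          rw [hx.real, hy.real, wr, max_eq_left (not_lt.1 hlt), ← a3]
          simp [store]
      obtain ⟨y, hy, hu'⟩ := hu'.of_ite
      have e : (Test.natLt (.lit 0) (.get 2 (.reg 7))).holds γ known t x ↔ s.nat 2 m ≠ 0 := by
        simp [Test.holds, NatExp.val, hx'.1, w7, wn, h3, Nat.pos_iff_ne_zero]
      rw [e] at hu'
      rcases hu' with ⟨hq, hu'⟩ | ⟨hq, hu'⟩
      · have hu' := hu'.of_setReal
        have un : ∀ a, a ≠ 7 → u'.nat a = u.nat a := fun a h => by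
          rw [hu'.nat, hy.nat, hx'.1, wn a h]
        have ur : u'.real = store (store u.real 1 m
          (s.real 1 m + residual known m (s.real 1 m) (s.real 8 0))) 0 m (s.real 10 0) := by
          simp [hu'.real, hy.real, hy.nat, hx', NatExp.val, RealExp.val, w7, store_of_ne, h1]
        refine ⟨⟨?_, ?_, ?_⟩, fun q => ?_⟩
        · simp [ur, store_of_ne, h1]
        · simp [ur, store_of_ne, h2]
        · rw [un 2 (by decide), h3]
        · rw [un 0 (by decide), ur]
          by_cases hqm : q = m
          · subst hqm
            simp [store_apply, a1, hp, hq]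
          · simp only [store_apply, hqm, and_false, if_false, succ q hqm]
            simpa [hqm] using h4 q
      · have hu' := hu'.of_setNat
        have un : ∀ a, a ≠ 7 → a ≠ 0 → u'.nat a = u.nat a := fun a h h' => by
          rw [hu'.nat]
          simp only [store_of_ne _ _ _ h']
          rw [hy.nat, hx'.1, wn a h]
        have un0 : u'.nat 0 = fun q => if q = m then 0 else u.nat 0 q := by
          funext q
          simp [hu'.nat, store_apply, NatExp.val, hy.nat, hx'.1, w7, wn]
        have ur : u'.real = store u.real 1 m
          (s.real 1 m + residual known m (s.real 1 m) (s.real 8 0)) := by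
          rw [hu'.real, hy.real, hx'.2]
        rw [not_not] at hq
        refine ⟨⟨?_, ?_, ?_⟩, fun q => ?_⟩
        · simp [ur, store_of_ne, h1]
        · simp [ur, store_of_ne, h2]
        · rw [un 2 (by decide) (by decide), h3]
        · rw [un0, ur]
          by_cases hqm : q = m
          · subst hqm
            simp [store_apply, a2, hp, hq]
          · simp only [store_apply, hqm, and_false, if_false, succ q hqm]
            simpa [hqm] using h4 q
    · have hu' := hu'.of_skip
      have un : ∀ a, a ≠ 7 → u'.nat a = u.nat a := fun a h => by rw [hu'.nat, wn a h]
      have ur : u'.real = u.real := by rw [hu'.real, wr]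
      rw [ur, un 2 (by decide), un 0 (by decide)]
      refine ⟨⟨h1, h2, h3⟩, fun q => ?_⟩
      by_cases hqm : q = m
      · subst hqm
        simp [a1, a2, a3, hp]
      · simpa [succ q hqm] using h4 q

end

section
variable {N : Network.{u}} {γ : ℝ≥0} {known : List (Request N)} {t : ℝ} {A : Solver PMF N}
variable {s s' : Mem N.numElems}

/-- The cost of the individual solution of request `q`, times the number of requests, is more than
`γw`. -/
def Expensive (γ : ℝ≥0) (k : ℕ) (s : Mem N.numElems) (w : ℝ) (q : ℕ) : Prop :=
  γ * w < s.real 2 q * k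

open Classical in
/-- The effect of a service at level `w` at time `t`, which transmits `X` and forwards time to `x`:
of the touched requests, those in `U` remain pending. -/
structure IsService (γ : ℝ≥0) (known : List (Request N)) (t w x : ℝ) (X : N.Sets) (U : ℕ → Prop)
    (s s' : Mem N.numElems) : Prop where
  le_time : t ≤ x
  sent : s'.sent = s.sent ++ [(t, X)]
  cost_le : (N.setCost X : ℝ) ≤ 3 * (γ * w)
  sub : ∀ q < known.length, U q → Touched s w q ∧ Expensive γ known.length s w q
  pending : ∀ q < known.length, (s'.nat 0 q ≠ 0 ↔ s.nat 0 q ≠ 0 ∧ (s.real 0 q ≤ w → U q))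
  serves : ∀ q < known.length, Touched s w q → ¬ U q → Serves known q X
  level : ∀ q < known.length, s'.real 0 q = if U q then w else s.real 0 q
  offset : ∀ q < known.length, s'.real 1 q =
    if Touched s w q then s.real 1 q + residual known q (s.real 1 q) x else s.real 1 q
  residual_le : totalResidual known U (s.real 1) x ≤ 2 * (γ * w)
  le_waitCost : (∃ q < known.length, U q) → ∀ S, w ≤ waitCost known (freeElems N w)
    (fun q => Touched s w q ∧ Expensive γ known.length s w q) (s.real 1) x S
  real_two : s'.real 2 = s.real 2
  set_zero : s'.set 0 = s.set 0

theorem runs_serviceProg {w : ℝ} (hγ : 1 ≤ γ) (hw : 0 < w)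
    (hA : ∀ E₀ Q S, ∀ x ∈ (A E₀ Q).support, N.pcCost E₀ Q x.1 ≤ γ * N.pcCost E₀ Q S)
    (h7 : s.real 7 0 + s.real 7 0 = w)
    (hown : ∀ q < known.length, s.nat 0 q ≠ 0 →
      Serves known q (s.set 0 q) ∧ (N.setCost (s.set 0 q) : ℝ) = s.real 2 q)
    (hres : totalResidual known (Touched s w) (s.real 1) t ≤ w)
    (h : Runs γ known t A serviceProg s s') :
    ∃ x X U, IsService γ known t w x X U s s' := by
  classical
  have hγ' : (1 : ℝ) ≤ γ := by exact_mod_cast hγ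
  have hwB : w ≤ γ * w := le_mul_of_one_le_left hw.le hγ'
  obtain ⟨u1, h1, h⟩ := runs_seq.1 h
  obtain ⟨u2, h2, h⟩ := runs_seq.1 h
  obtain ⟨u3, h3, h⟩ := runs_seq.1 h
  obtain ⟨u4, h4, h⟩ := runs_seq.1 h
  obtain ⟨u5, h5, h⟩ := runs_seq.1 h
  obtain ⟨u6, h6, h⟩ := runs_seq.1 h
  obtain ⟨u7, h7', h⟩ := runs_seq.1 h
  obtain ⟨u8, h8, h⟩ := runs_seq.1 h
  obtain ⟨u9, h9, h⟩ := runs_seq.1 h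
  obtain ⟨u10, h10, h⟩ := runs_seq.1 h
  have hsent : u10.sent = s.sent := by
    rw [(h10.silent (by simp [updateProg, Prog.IsSilent])).1,
      (h9.silent (by simp [forwardProg, roundProg, isEmptyProg, evalProg, penaltyProg,
        unservedProg, sumCostProg, servedProg, soloProg, markProg, Prog.IsSilent])).1,
      (h8.silent (by simp [Prog.IsSilent])).1, (h7'.silent (by simp [Prog.IsSilent])).1,
      (h6.silent (by simp [Prog.IsSilent])).1, (h5.silent (by simp [cheapProg, Prog.IsSilent])).1,
      (h4.silent (by simp [markProg, Prog.IsSilent])).1,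
      (h3.silent (by simp [markProg, Prog.IsSilent])).1,
      (h2.silent (by simp [freeProg, Prog.IsSilent])).1, (h1.silent (by simp [Prog.IsSilent])).1]
  -- The level of the service and the free elements.
  have u1r := h1.of_setReal.real
  have u110 : u1.real 10 0 = w := by
    simp [u1r, store_apply, NatExp.val, RealExp.val, h7]
  have u1r' : ∀ a, a ≠ 10 → u1.real a = s.real a := fun a ha => by
    simp [u1r, store_of_ne _ _ _ ha]
  have u1n : u1.nat = s.nat := h1.of_setReal.nat
  have u1s : u1.set = s.set := h1.of_setReal.set
  have u22 := runs_freeProg h2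
  rw [u110] at u22
  have u2r : u2.real = u1.real := by
    funext a
    exact h2.real_eq (by simp [freeProg, Prog.writes])
  have u2n : ∀ a, a ≠ 7 → u2.nat a = s.nat a := fun a ha => by
    rw [h2.nat_eq (by simp [freeProg, Prog.writes, ha]), u1n]
  have u2s : ∀ a, a ≠ 2 → u2.set a = s.set a := fun a ha => by
    rw [h2.set_eq (by simp [freeProg, Prog.writes, ha]), u1s]
  -- The requests that take part in forwarding.
  have hT : ∀ u : Mem N.numElems, u.nat 0 = s.nat 0 → u.real 0 = s.real 0 →
      ∀ q, Touched u w q ↔ Touched s w q := by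
    intro u hn hr q
    simp only [Touched, hn, hr]
  have hmark1 := runs_markProg (p := fun q => Touched s w q ∧ Expensive γ known.length s w q)
    (by
      intro u j hn hj hr _
      change touchedTest.holds γ known t u ∧ _ ↔ _
      rw [holds_touchedTest hj, hr, u2r, u110, hT u (by
        rw [hn 0 (by decide) (by decide), u2n 0 (by decide)]) (by
        rw [hr, u2r, u1r' 0 (by decide)])]
      simp only [Test.holds, RealExp.val, NatExp.val, hj, hr, u2r, u110, u1r' 2 (by decide),
        Expensive]
      rw [mul_comm w]) (by decide) h3
  have u3n : ∀ a, a ≠ 7 → a ≠ 1 → u3.nat a = s.nat a := fun a ha ha' => by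
    rw [h3.nat_eq (by simp [markProg, Prog.writes, ha, ha']), u2n a ha]
  have u3r : u3.real = u1.real := by
    funext a
    rw [h3.real_eq (by simp [markProg, Prog.writes]), u2r]
  have u3s : u3.set = u2.set := by
    funext a
    exact h3.set_eq (by simp [markProg, Prog.writes])
  have hmark2 := runs_markProg (p := fun q => u3.nat 1 q ≠ 0)
    (by
      intro u j hn hj hr _
      simp only [Test.holds, NatExp.val, hj, hn 1 (by decide) (by decide), Nat.pos_iff_ne_zero])
    (by decide) h4
  have u4n : ∀ a, a ≠ 7 → a ≠ 2 → u4.nat a = u3.nat a := fun a ha ha' =>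
    h4.nat_eq (by simp [markProg, Prog.writes, ha, ha'])
  have u4r : u4.real = u1.real := by
    funext a
    rw [h4.real_eq (by simp [markProg, Prog.writes]), u3r]
  have u4s : u4.set = u2.set := by
    funext a
    rw [h4.set_eq (by simp [markProg, Prog.writes]), u3s]
  -- The cheap requests.
  obtain ⟨c1, c2, c3⟩ := runs_cheapProg h5
  have hT4 := hT u4 (by rw [u4n 0 (by decide) (by decide), u3n 0 (by decide) (by decide)])
    (by rw [u4r, u1r' 0 (by decide)])
  have u41 : ∀ q < known.length, (u4.nat 1 q = 0 ↔
      ¬ (Touched s w q ∧ Expensive γ known.length s w q)) := by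
    intro q hq
    rw [u4n 1 (by decide) (by decide), hmark1 q hq]
    split_ifs with hh <;> simp [hh]
  rw [u4r, u110, u4s, u2s 0 (by decide)] at c2
  rw [u4r, u110, u4s, u22, u2s 0 (by decide)] at c3
  rw [u4s, u22] at c1
  have u5n : ∀ a, a ≠ 7 → u5.nat a = u4.nat a := fun a ha =>
    h5.nat_eq (by simp [cheapProg, Prog.writes, ha])
  have u5r : u5.real = u1.real := by
    funext a
    rw [h5.real_eq (by simp [cheapProg, Prog.writes]), u4r]
  have u5s : ∀ a, a ≠ 4 → u5.set a = u2.set a := fun a ha => by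
    rw [h5.set_eq (by simp [cheapProg, Prog.writes, ha]), u4s]
  -- Forwarding.
  have e6 := h6.of_setSet
  have e7 := h7'.of_setReal
  have e8 := h8.of_setNat
  have u8n : ∀ a, a ≠ 7 → a ≠ 9 → u8.nat a = u4.nat a := fun a ha ha' => by
    simp only [e8.nat, store_of_ne _ _ _ ha']
    rw [e7.nat, e6.nat, u5n a ha]
  have u8r : ∀ a, a ≠ 8 → u8.real a = u1.real a := fun a ha => by
    simp only [e8.real, e7.real, store_of_ne _ _ _ ha]
    rw [e6.real, u5r]
  have u88 : u8.real 8 0 = t := by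
    simp [e8.real, e7.real, store_apply, NatExp.val, RealExp.val]
  have u8s : ∀ a, a ≠ 3 → u8.set a = u5.set a := fun a ha => by
    simp [e8.set, e7.set, e6.set, store_of_ne _ _ _ ha]
  have u83 : u8.set 3 0 = freeElems N w := by
    simp [e8.set, e7.set, e6.set, store_apply, NatExp.val, SetExp.val, u5s 2 (by decide), u22]
  have u82 : u8.set 2 0 = freeElems N w := by
    rw [u8s 2 (by decide), u5s 2 (by decide), u22]
  have u81 : ∀ q < known.length, (u8.nat 1 q ≠ 0 ↔
      Touched s w q ∧ Expensive γ known.length s w q) := by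
    intro q hq
    rw [u8n 1 (by decide) (by decide), ne_eq, u41 q hq, not_not]
  have u8u : ∀ q < known.length, (u8.nat 2 q ≠ 0 ↔ u8.nat 1 q ≠ 0) := by
    intro q hq
    rw [u8n 2 (by decide) (by decide), u8n 1 (by decide) (by decide), hmark2 q hq,
      u4n 1 (by decide) (by decide)]
    split_ifs with hh <;> simp [hh]
  have hoff : u8.real 1 = s.real 1 := by rw [u8r 1 (by decide), u1r' 1 (by decide)]
  have hres8 : totalResidual known (fun q => u8.nat 2 q ≠ 0) (u8.real 1) (u8.real 8 0) ≤ γ * w := by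
    rw [hoff, u88]
    exact (totalResidual_mono_set (fun q hq hq' => ((u81 q hq).1 ((u8u q hq).1 hq')).1) _ _).trans
      (hres.trans hwB)
  have u89 : u8.nat 9 0 = 0 := by simp [e8.nat, store_apply, NatExp.val]
  obtain ⟨f1, f2⟩ := runs_forwardProg (w := w) hγ hw hA
    (by
      intro e he
      rw [u82, freeElems, Finset.mem_filter]
      exact ⟨Finset.mem_univ _, by simpa [he] using hw.le⟩)
    (by rw [u8r 10 (by decide), u110])
    (by
      refine ⟨u88.ge, fun q hq => (u8u q hq).1, fun q hq hq' hq'' => ?_, ?_, ?_, fun h => ?_⟩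
      · exact absurd hq'' ((u8u q hq).2 hq')
      · rw [u83, u82, Finset.sdiff_self]
        simpa [Network.setCost] using hw.le.trans hwB
      · linarith
      · exact absurd u89 h)
    hres8 h9
  have u9n0 : u9.nat 0 = s.nat 0 := by
    rw [h9.nat_eq (by decide), u8n 0 (by decide) (by decide), u4n 0 (by decide) (by decide),
      u3n 0 (by decide) (by decide)]
  have u9r : ∀ a, a < 3 ∨ a = 10 → u9.real a = u1.real a := fun a ha => by
    rw [h9.real_eq, u8r a (by lia)]
    have : a ≠ 3 ∧ a ≠ 4 ∧ a ≠ 8 ∧ a ≠ 9 := by lia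
    simp [forwardProg, roundProg, isEmptyProg, evalProg, penaltyProg, unservedProg, sumCostProg,
      servedProg, soloProg, markProg, Prog.writes, this]
  -- The update and the transmission.
  have upd := runs_updateProg h10
  rw [u9r 10 (by lia), u110, u9r 0 (by lia), u9r 1 (by lia), u1r' 0 (by decide),
    u1r' 1 (by decide), u9n0] at upd
  have hT9 := hT u9 u9n0 (by rw [u9r 0 (by lia), u1r' 0 (by decide)])
  simp only [hT9] at upd
  have e := h.of_transmit
  have hU : ∀ q < known.length, u9.nat 2 q ≠ 0 → Touched s w q ∧ Expensive γ known.length s w q :=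
    fun q hq hq' => (u81 q hq).1 (f2.sub q hq hq')
  have u103 : u10.set 3 0 = u9.set 3 0 := by rw [h10.set_eq (by decide)]
  have u104 : u10.set 4 0 = u5.set 4 0 := by
    rw [h10.set_eq (by decide), h9.set_eq (by decide), u8s 4 (by decide)]
  have hX : (SetExp.union (.reg 3) (.reg 4)).val known u10 = u9.set 3 0 ∪ u5.set 4 0 := by
    simp [SetExp.val, NatExp.val, u103, u104]
  rw [hX] at e
  refine ⟨u9.real 8 0, u9.set 3 0 ∪ u5.set 4 0, fun q => u9.nat 2 q ≠ 0, f2.le_time, ?_, ?_, hU, ?_,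
    ?_, ?_, ?_, ?_, ?_, ?_, ?_⟩
  · rw [e.sent, hsent]
  · have k1 := f2.cost_le
    rw [u82] at k1
    have k2 : u9.set 3 0 ∪ u5.set 4 0 ⊆ (u9.set 3 0 \ freeElems N w) ∪ u5.set 4 0 := by
      intro x hx
      rw [Finset.mem_union] at hx ⊢
      by_cases hx' : x ∈ freeElems N w
      · exact Or.inr (c1 hx')
      · exact hx.imp (fun hx => Finset.mem_sdiff.2 ⟨hx, hx'⟩) id
    have k3 := NNReal.coe_le_coe.2 ((setCost_mono k2).trans (setCost_union_le _ _))
    have k4 := NNReal.coe_le_coe.2 c3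
    push_cast at k3 k4
    have k5 := setCost_freeElems_le (N := N) hw.le
    have k6 : (∑ q ∈ Finset.range known.length,
        ((if Touched u4 w q ∧ u4.nat 1 q = 0 then N.setCost (s.set 0 q) else 0 : ℝ≥0) : ℝ)) ≤
        γ * w := by
      rcases Nat.eq_zero_or_pos known.length with hk | hk
      · rw [hk, Finset.range_zero, Finset.sum_empty]
        linarith
      · have hk' : (0 : ℝ) < known.length := by exact_mod_cast hk
        calc _ ≤ ∑ q ∈ Finset.range known.length, γ * w / known.length := by
              refine Finset.sum_le_sum fun q hq => ?_
              have hq := Finset.mem_range.1 hq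
              split_ifs with hh
              · rw [hT4, u41 q hq] at hh
                have := (hown q hq hh.1.1).2
                rw [this, le_div_iff₀ hk']
                exact not_lt.1 fun hh' => hh.2 ⟨hh.1, hh'⟩
              · rw [NNReal.coe_zero]
                positivity
          _ = γ * w := by
              rw [Finset.sum_const, Finset.card_range, nsmul_eq_mul]
              field_simp
    linarith
  · intro q hq
    have e1 : s'.nat 0 = u10.nat 0 := by rw [e.nat]
    rw [e1, (upd q hq).1]
    split_ifs with hh
    · simp [hh.1.1, hh.2, hh.1.2]
    · constructor
      · exact fun h => ⟨h, fun hl hq' => hh ⟨⟨h, hl⟩, hq'⟩⟩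
      · exact fun h => h.1
  · intro q hq ht hq'
    by_cases hx : Expensive γ known.length s w q
    · exact (f2.serves q hq ((u81 q hq).2 ⟨ht, hx⟩) (not_not.1 hq')).mono
        Finset.subset_union_left
    · refine (hown q hq ht.1).1.mono ((c2 q hq ((hT4 q).2 ht) ?_).trans Finset.subset_union_right)
      exact (u41 q hq).2 fun hh => hx hh.2
  · intro q hq
    have e1 : s'.real 0 = u10.real 0 := by rw [e.real]
    rw [e1, (upd q hq).2.1]
    by_cases hh : u9.nat 2 q = 0
    · simp [hh]
    · simp [hh, (hU q hq hh).1]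
  · intro q hq
    have e1 : s'.real 1 = u10.real 1 := by rw [e.real]
    rw [e1, (upd q hq).2.2]
  · have := f2.residual_le
    rwa [hoff] at this
  · intro hne S
    have := f2.le_waitCost f1 hne S
    rw [u82, hoff] at this
    refine this.trans (le_of_eq ?_)
    unfold waitCost
    congr 1
    exact totalResidual_congr (fun q hq => and_congr_left fun _ => u81 q hq) _ _
  · have e1 : s'.real 2 = u10.real 2 := by rw [e.real]
    rw [e1, h10.real_eq (by decide), u9r 2 (by lia), u1r' 2 (by decide)]
  · have e1 : s'.set 0 = u10.set 0 := by rw [e.set]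
    rw [e1, h10.set_eq (by decide), h9.set_eq (by decide), u8s 0 (by decide), u5s 0 (by decide),
      u2s 0 (by decide)]

/-! ### Releases -/

/-- The number of the request just released. -/
abbrev NatExp.last : NatExp := .sub .numReqs (.lit 1)

/-- Registers the request just released, with its individual solution, which is transmitted at once
if it costs nothing; otherwise its level is the cost of this solution divided by `γ`, rounded down
to a power of two. -/
def registerProg : Prog :=
  .setNat 6 (.lit 0) .last ;;
  .setSet 6 (.lit 0) .empty ;;
  soloProg ;;
  .setSet 0 .last (.reg 1) ;;
  sumCostProg 2 .last (.reg 1) ;;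
  .setReal 0 .last (.pow2Floor (.divRatio (.get 2 .last))) ;;
  .setReal 1 .last (.delay .last .now) ;;
  .ite (.realLt (.ofNat (.lit 0)) (.get 2 .last))
    (.setNat 0 .last (.lit 1)) (.setNat 0 .last (.lit 0) ;; .transmit (.reg 1))

/-- The effect of registering request number `r` at time `t`. -/
structure IsRegistration (γ : ℝ≥0) (known : List (Request N)) (t : ℝ) (r : ℕ)
    (s s' : Mem N.numElems) : Prop where
  nat : ∀ q, q ≠ r → s'.nat 0 q = s.nat 0 q
  real : ∀ a < 3, ∀ q, q ≠ r → s'.real a q = s.real a q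
  set : ∀ q, q ≠ r → s'.set 0 q = s.set 0 q
  serves : Serves known r (s'.set 0 r)
  own : s'.real 2 r = N.setCost (s'.set 0 r)
  own_le : ∀ S, Serves known r S → s'.real 2 r ≤ γ * N.setCost S
  level : s'.real 0 r = (2 : ℝ) ^ Int.log 2 (s'.real 2 r / γ)
  offset : s'.real 1 r = delayOf known r t
  pending : s'.nat 0 r ≠ 0 ↔ 0 < s'.real 2 r
  sent : s'.sent = if s'.nat 0 r ≠ 0 then s.sent else s.sent ++ [(t, s'.set 0 r)]

theorem runs_registerProg {r : ℕ} (hγ : 1 ≤ γ)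
    (hA : ∀ E₀ Q S, ∀ x ∈ (A E₀ Q).support, N.pcCost E₀ Q x.1 ≤ γ * N.pcCost E₀ Q S)
    (hr : known.length = r + 1) (h : Runs γ known t A registerProg s s') :
    IsRegistration γ known t r s s' := by
  have hlast : ∀ u : Mem N.numElems, NatExp.last.val known u = r := fun u => by
    simp [NatExp.val, hr]
  obtain ⟨u1, h1, h⟩ := runs_seq.1 h
  obtain ⟨u2, h2, h⟩ := runs_seq.1 h
  obtain ⟨u3, h3, h⟩ := runs_seq.1 h
  obtain ⟨u4, h4, h⟩ := runs_seq.1 h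
  obtain ⟨u5, h5, h⟩ := runs_seq.1 h
  obtain ⟨u6, h6, h⟩ := runs_seq.1 h
  obtain ⟨u7, h7, h⟩ := runs_seq.1 h
  obtain ⟨u8, h8, h⟩ := h.of_ite
  have e1 := h1.of_setNat
  have e2 := h2.of_setSet
  obtain ⟨k1, k2⟩ := runs_soloProg hγ hA (q := r)
    (by simp [e2.nat, e1.nat, store_apply, NatExp.val, hr]) (by lia) h3
  have u26 : u2.set 6 0 = ∅ := by simp [e2.set, store_apply, NatExp.val, SetExp.val]
  simp only [u26, Finset.sdiff_empty] at k2
  have u30 : u3.nat 0 = s.nat 0 := by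
    rw [h3.nat_eq (by decide), h2.nat_eq (by decide), h1.nat_eq (by decide)]
  have u3r : ∀ a, a ≠ 4 → u3.real a = s.real a := fun a ha => by
    rw [h3.real_eq (by simp [soloProg, Prog.writes, ha]), h2.real_eq (by simp [Prog.writes]),
      h1.real_eq (by simp [Prog.writes])]
  have u3s : u3.set 0 = s.set 0 := by
    rw [h3.set_eq (by decide), h2.set_eq (by decide), h1.set_eq (by decide)]
  have u3t : u3.sent = s.sent := by
    rw [(h3.silent (by simp [soloProg, Prog.IsSilent])).1, (h2.silent (by simp [Prog.IsSilent])).1,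
      (h1.silent (by simp [Prog.IsSilent])).1]
  obtain ⟨X, hX⟩ : ∃ X, u3.set 1 0 = X := ⟨_, rfl⟩
  rw [hX] at k1
  simp only [hX] at k2
  have e4 := h4.of_setSet
  have u41 : u4.set 1 0 = X := by rw [h4.set_eq (by decide), hX]
  obtain ⟨c1, c2⟩ := runs_sumCostProg (I := r) (X := X) hlast
    (fun u hu => by simp [SetExp.val, NatExp.val, hu, u41]) h5
  have e6 := h6.of_setReal
  have e7 := h7.of_setReal
  have u80 : u8.nat 0 = s.nat 0 := by
    rw [h8.nat, h7.nat_eq (by decide), h6.nat_eq (by decide), h5.nat_eq (by decide),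
      h4.nat_eq (by decide), u30]
  have u8s : ∀ q, u8.set 0 q = if q = r then X else s.set 0 q := fun q => by
    rw [h8.set, h7.set_eq (by decide), h6.set_eq (by decide), h5.set_eq (by decide), e4.set]
    simp [store_apply, SetExp.val, NatExp.val, hX, u3s, hr]
  have u81 : u8.set 1 0 = X := by
    rw [h8.set, h7.set_eq (by decide), h6.set_eq (by decide), h5.set_eq (by decide), u41]
  have u8t : u8.sent = s.sent := by
    rw [h8.sent, (h7.silent (by simp [Prog.IsSilent])).1, (h6.silent (by simp [Prog.IsSilent])).1,
      (h5.silent (by simp [sumCostProg, Prog.IsSilent])).1,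
      (h4.silent (by simp [Prog.IsSilent])).1, u3t]
  have u82 : ∀ q, u8.real 2 q = if q = r then (N.setCost X : ℝ) else s.real 2 q := fun q => by
    rw [h8.real, h7.real_eq (by decide), h6.real_eq (by decide)]
    split_ifs with hq
    · rw [hq, c1]
    · rw [c2 q hq, h4.real_eq (by decide), u3r 2 (by decide)]
  have u52 : u5.real 2 r = N.setCost X := c1
  have u8r0 : ∀ q, u8.real 0 q = if q = r then (2 : ℝ) ^ Int.log 2 (N.setCost X / γ : ℝ)
      else s.real 0 q := fun q => by
    rw [h8.real, h7.real_eq (by decide), e6.real]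
    have : u5.real 0 = s.real 0 := by
      rw [h5.real_eq (by decide), h4.real_eq (by decide), u3r 0 (by decide)]
    simp only [store_apply, hlast, true_and, RealExp.val, u52, this]
  have u8r1 : ∀ q, u8.real 1 q = if q = r then (delayOf known r t : ℝ) else s.real 1 q :=
      fun q => by
    rw [h8.real, e7.real, delay_val]
    have : u6.real 1 = s.real 1 := by
      rw [h6.real_eq (by decide), h5.real_eq (by decide), h4.real_eq (by decide),
        u3r 1 (by decide)]
    simp only [store_apply, hlast, true_and, RealExp.val, this]
  have hT : (Test.realLt (.ofNat (.lit 0)) (.get 2 .last)).holds γ known t u7 ↔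
      (0 : ℝ) < N.setCost X := by
    have u72 : u7.real 2 r = N.setCost X := by
      have := u82 r
      rwa [h8.real, if_pos rfl] at this
    simp [Test.holds, RealExp.val, NatExp.val, hr, u72]
  have hs' : s'.real = u8.real ∧ s'.set = u8.set ∧ (∀ q, q ≠ r → s'.nat 0 q = u8.nat 0 q) ∧
      (s'.nat 0 r ≠ 0 ↔ (0 : ℝ) < N.setCost X) ∧
      s'.sent = if s'.nat 0 r ≠ 0 then s.sent else s.sent ++ [(t, X)] := by
    rw [hT] at h
    rcases h with ⟨hp, h⟩ | ⟨hp, h⟩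
    · have e := h.of_setNat
      refine ⟨e.real, e.set, fun q hq => ?_, ?_, ?_⟩
      · simp [e.nat, store_apply, NatExp.val, hr, hq]
      · simpa [e.nat, store_apply, NatExp.val, hr] using hp
      · simp [e.nat, e.sent, store_apply, NatExp.val, hr, u8t]
    · obtain ⟨u9, h9, h⟩ := runs_seq.1 h
      have e9 := h9.of_setNat
      have e := h.of_transmit
      refine ⟨by rw [e.real, e9.real], by rw [e.set, e9.set], fun q hq => ?_, ?_, ?_⟩
      · simp [e.nat, e9.nat, store_apply, NatExp.val, hr, hq]
      · simpa [e.nat, e9.nat, store_apply, NatExp.val, hr] using hp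
      · simp [e.nat, e.sent, e9.nat, e9.sent, e9.set, store_apply, NatExp.val, SetExp.val, hr, u8t,
          u81]
  obtain ⟨a1, a2, a3, a4, a5⟩ := hs'
  have s'2 : s'.real 2 r = N.setCost X := by rw [a1, u82, if_pos rfl]
  have s'0 : s'.set 0 r = X := by rw [a2, u8s, if_pos rfl]
  constructor
  · intro q hq
    rw [a3 q hq, u80]
  · intro a ha q hq
    rw [a1]
    interval_cases a
    · rw [u8r0, if_neg hq]
    · rw [u8r1, if_neg hq]
    · rw [u82, if_neg hq]
  · intro q hq
    rw [a2, u8s, if_neg hq]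
  · rw [s'0]; exact k1
  · rw [s'2, s'0]
  · intro S hS
    rw [s'2]
    exact_mod_cast k2 S hS
  · rw [s'2, a1, u8r0, if_pos rfl]
  · rw [a1, u8r1, if_pos rfl]
  · rw [a4, s'2]
  · rw [a5, s'0]

/-- The online algorithm: each request is registered when released, and a service is performed when
the alarm goes off. -/
def algorithm : OnlineAlg where
  onRequest := registerProg ;; resetAlarmProg
  onAlarm := serviceProg ;; resetAlarmProg

theorem algorithm_isStatic : algorithm.onRequest.IsStatic ∧ algorithm.onAlarm.IsStatic := by
  simp [algorithm, registerProg, resetAlarmProg, serviceProg, freeProg, markProg, cheapProg,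
    forwardProg, roundProg, isEmptyProg, evalProg, penaltyProg, unservedProg, sumCostProg,
    servedProg, soloProg, updateProg, Prog.IsStatic, NatExp.IsStatic]

end

/-! ### How often a transmission is charged -/

theorem tsum_zpow_le (c : ℝ≥0) :
    ∑' j : ℤ, (if (2 : ℝ) ^ j ≤ c then ENNReal.ofReal (2 ^ j) else 0) ≤ 2 * (c : ℝ≥0∞) := by
  rcases eq_or_ne c 0 with rfl | hc
  · have : ∀ j : ℤ, ¬ ((2 : ℝ) ^ j ≤ (0 : ℝ≥0)) := fun j => by
      rw [NNReal.coe_zero, not_le]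
      positivity
    simp only [this, if_false, tsum_zero, zero_le]
  have hc' : (0 : ℝ) < c := NNReal.coe_pos.2 (pos_iff_ne_zero.2 hc)
  set J := Int.log 2 (c : ℝ) with hJ
  have hJc : (2 : ℝ) ^ J ≤ c := by
    have := Int.zpow_log_le_self (b := 2) (by norm_num) hc'
    exact_mod_cast this
  have hinj : Function.Injective fun i : ℕ => J - (i : ℤ) := fun a b h => by
    simp only at h
    lia
  rw [← hinj.tsum_eq]
  · calc ∑' i : ℕ, (if (2 : ℝ) ^ (J - (i : ℤ)) ≤ c then ENNReal.ofReal (2 ^ (J - (i : ℤ))) else 0)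
        ≤ ∑' i : ℕ, ENNReal.ofReal (2 ^ J) * (2⁻¹) ^ i := by
          refine ENNReal.tsum_le_tsum fun i => ?_
          have : ENNReal.ofReal ((2 : ℝ) ^ (J - (i : ℤ))) = ENNReal.ofReal (2 ^ J) * (2⁻¹) ^ i := by
            rw [zpow_sub₀ (by norm_num), div_eq_mul_inv, ENNReal.ofReal_mul (by positivity),
              zpow_natCast, ← inv_pow, ENNReal.ofReal_pow (by norm_num),
              ENNReal.ofReal_inv_of_pos (by norm_num), ENNReal.ofReal_ofNat]
          rw [this]
          split_ifs <;> simp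
      _ = ENNReal.ofReal (2 ^ J) * 2 := by
          rw [ENNReal.tsum_mul_left, ENNReal.tsum_geometric, ENNReal.one_sub_inv_two, inv_inv]
      _ ≤ 2 * (c : ℝ≥0∞) := by
          rw [mul_comm]
          gcongr
          rw [← ENNReal.ofReal_coe_nnreal]
          exact ENNReal.ofReal_le_ofReal hJc
  · intro j hj
    have hj : (2 : ℝ) ^ j ≤ c := by
      by_contra h
      simp [h] at hj
    have : j ≤ J := by
      rw [hJ, ← Int.zpow_le_iff_le_log (by norm_num) hc']
      exact_mod_cast hj
    exact ⟨(J - j).toNat, by simp; lia⟩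

theorem tsum_window_le (x : ℝ≥0) (m : ℕ) (a : ℝ≥0∞) :
    ∑' j : ℤ, (if (x : ℝ) < 2 ^ j ∧ (2 : ℝ) ^ j < x * m then a else 0) ≤
      (Nat.log 2 m + 1 : ℕ) * a := by
  set J := Int.log 2 (x : ℝ) with hJ
  have hsub : ∀ j : ℤ, ((x : ℝ) < 2 ^ j ∧ (2 : ℝ) ^ j < x * m) →
      j ∈ Finset.Icc (J + 1) (J + (Nat.log 2 m + 1 : ℕ)) := by
    rintro j ⟨h1, h2⟩
    have hx : (0 : ℝ) < x := by
      by_contra hx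
      have : (x : ℝ) = 0 := le_antisymm (not_lt.1 hx) x.2
      rw [this, zero_mul] at h2
      exact absurd h2 (not_lt.2 (by positivity))
    have hJ1 : (x : ℝ) < 2 ^ (J + 1) := by
      have := Int.lt_zpow_succ_log_self (b := 2) (by norm_num) (x : ℝ)
      exact_mod_cast this
    have hJ0 : (2 : ℝ) ^ J ≤ x := by
      have := Int.zpow_log_le_self (b := 2) (by norm_num) hx
      exact_mod_cast this
    have hm : (m : ℝ) < 2 ^ (Nat.log 2 m + 1) := by
      exact_mod_cast Nat.lt_pow_succ_log_self (by norm_num) m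
    rw [Finset.mem_Icc]
    constructor
    · have : (2 : ℝ) ^ J < 2 ^ j := hJ0.trans_lt h1
      have := (zpow_lt_zpow_iff_right₀ (by norm_num)).1 this
      lia
    · have : (2 : ℝ) ^ j < 2 ^ (J + 1 + (Nat.log 2 m + 1 : ℕ)) := by
        rw [zpow_add₀ (by norm_num), zpow_natCast]
        calc (2 : ℝ) ^ j < x * m := h2
          _ ≤ 2 ^ (J + 1) * 2 ^ (Nat.log 2 m + 1) := by gcongr
      have := (zpow_lt_zpow_iff_right₀ (by norm_num)).1 this
      lia
  rw [tsum_eq_sum (s := Finset.Icc (J + 1) (J + (Nat.log 2 m + 1 : ℕ)))]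
  · calc _ ≤ ∑ j ∈ Finset.Icc (J + 1) (J + (Nat.log 2 m + 1 : ℕ)), a := by
          refine Finset.sum_le_sum fun j _ => ?_
          split_ifs <;> simp
      _ = _ := by
          rw [Finset.sum_const, nsmul_eq_mul, Int.card_Icc]
          congr 2
          lia
  · intro j hj
    rw [if_neg fun h => hj (hsub j h)]

section
variable {N : Network.{u}}

open Classical in
/-- What a transmission of `S` by the offline solution can be charged for services triggered
at level `2 ^ j`, on inputs of `k` requests: `2 ^ j` if `S` costs at least that much; otherwise the
cost of `S` without the free elements, or nothing if `S` is so cheap that the requests it serves are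
all cheap. -/
def share (N : Network.{u}) (k : ℕ) (j : ℤ) (S : N.Sets) : ℝ≥0∞ :=
  if (2 : ℝ) ^ j ≤ N.setCost S then ENNReal.ofReal (2 ^ j)
  else if (2 : ℝ) ^ j < N.setCost S * k then N.setCost (S \ freeElems N (2 ^ j)) else 0

/-- Each of the elements of `S` is charged at few levels above its cost, and `S` at few levels above
its own, while the levels below it form a geometric progression. -/
theorem tsum_share_le (k : ℕ) (S : N.Sets) : ∑' j : ℤ, share N k j S ≤
    (3 + Nat.log 2 (min k N.numElems) : ℕ) * (N.setCost S : ℝ≥0∞) := by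
  classical
  have hsplit : ∀ j, share N k j S ≤
      (if (2 : ℝ) ^ j ≤ N.setCost S then ENNReal.ofReal (2 ^ j) else 0) +
      (if (N.setCost S : ℝ) < 2 ^ j ∧ (2 : ℝ) ^ j < N.setCost S * k then
        (N.setCost (S \ freeElems N (2 ^ j)) : ℝ≥0∞) else 0) := by
    intro j
    unfold share
    split_ifs with h1 h2 h2 h3 h3 <;> simp_all
  have hsecond : ∑' j : ℤ, (if (N.setCost S : ℝ) < 2 ^ j ∧ (2 : ℝ) ^ j < N.setCost S * k then
      (N.setCost (S \ freeElems N (2 ^ j)) : ℝ≥0∞) else 0) ≤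
      (Nat.log 2 (min k N.numElems) + 1 : ℕ) * (N.setCost S : ℝ≥0∞) := by
    rcases min_choice k N.numElems with h | h
    · -- Few levels exceed the cost of the transmission by a factor less than `k`.
      rw [h]
      refine (ENNReal.tsum_le_tsum fun j => ?_).trans (tsum_window_le (N.setCost S) k _)
      split_ifs
      · exact_mod_cast setCost_mono Finset.sdiff_subset
      · exact le_rfl
    · -- Few levels exceed the cost of a given element by a factor less than the number of elements.
      rw [h]
      have hterm : ∀ j : ℤ, (if (N.setCost S : ℝ) < 2 ^ j ∧ (2 : ℝ) ^ j < N.setCost S * k then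
          (N.setCost (S \ freeElems N (2 ^ j)) : ℝ≥0∞) else 0) ≤
          ∑ e ∈ S, (if (N.cost e : ℝ) < 2 ^ j ∧ (2 : ℝ) ^ j < N.cost e * N.numElems then
            (N.cost e : ℝ≥0∞) else 0) := by
        intro j
        split_ifs with hj
        · unfold Network.setCost
          push_cast
          rw [Finset.sdiff_eq_filter, Finset.sum_filter]
          refine Finset.sum_le_sum fun e he => ?_
          have h1 : (N.cost e : ℝ) < 2 ^ j := by
            refine lt_of_le_of_lt ?_ hj.1
            exact_mod_cast Finset.single_le_sum (f := N.cost) (fun _ _ => zero_le) he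
          by_cases h2 : (2 : ℝ) ^ j < N.cost e * N.numElems
          · rw [if_pos (c := _ ∧ _) ⟨h1, h2⟩]
            split_ifs
            · exact zero_le
            · exact le_rfl
          · have h3 : e ∈ freeElems N (2 ^ j) := by
              rw [freeElems, Finset.mem_filter]
              exact ⟨Finset.mem_univ _, not_lt.1 h2⟩
            rw [if_neg (not_not.2 h3)]
            exact zero_le
        · exact zero_le
      refine (ENNReal.tsum_le_tsum hterm).trans ?_
      rw [Summable.tsum_finsetSum fun _ _ => ENNReal.summable]
      unfold Network.setCost
      push_cast
      rw [Finset.mul_sum]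
      refine Finset.sum_le_sum fun e _ => ?_
      exact_mod_cast tsum_window_le (N.cost e) N.numElems (N.cost e)
  calc ∑' j : ℤ, share N k j S ≤ _ := ENNReal.tsum_le_tsum hsplit
    _ ≤ 2 * (N.setCost S : ℝ≥0∞) +
        (Nat.log 2 (min k N.numElems) + 1 : ℕ) * (N.setCost S : ℝ≥0∞) := by
        rw [ENNReal.tsum_add]
        exact add_le_add (tsum_zpow_le _) hsecond
    _ = _ := by
        push_cast
        ring

theorem share_of_le {k : ℕ} {j : ℤ} {S : N.Sets} (h : (2 : ℝ) ^ j ≤ N.setCost S) :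
    share N k j S = ENNReal.ofReal (2 ^ j) := if_pos h

open Classical in
/-- The shares of the transmissions that satisfy `P`. -/
def windowShare (σ : Schedule N) (k : ℕ) (j : ℤ) (P : ℝ → Prop) : ℝ≥0∞ :=
  (σ.map fun s => if P s.1 then share N k j s.2 else 0).sum

theorem list_sum_map_le {α : Type*} (l : List α) {f g : α → ℝ≥0∞} (h : ∀ x ∈ l, f x ≤ g x) :
    (l.map f).sum ≤ (l.map g).sum := by
  induction l with
  | nil => simp
  | cons a l ih =>
    simp only [List.map_cons, List.sum_cons]
    exact add_le_add (h a (by simp)) (ih fun x hx => h x (by simp [hx]))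

theorem list_sum_map_add {α : Type*} (l : List α) (f g : α → ℝ≥0∞) :
    (l.map fun x => f x + g x).sum = (l.map f).sum + (l.map g).sum := by
  induction l with
  | nil => simp
  | cons a l ih =>
    simp only [List.map_cons, List.sum_cons, ih]
    ring

theorem windowShare_mono (σ : Schedule N) (k : ℕ) (j : ℤ) {P P' : ℝ → Prop}
    (h : ∀ o, P o → P' o) : windowShare σ k j P ≤ windowShare σ k j P' := by
  refine list_sum_map_le _ fun s _ => ?_
  split_ifs with h1 h2
  · exact le_rfl
  · exact absurd (h _ h1) h2
  · exact zero_le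
  · exact le_rfl

theorem windowShare_add_le (σ : Schedule N) (k : ℕ) (j : ℤ) {P P' Q : ℝ → Prop}
    (h : ∀ o, P o → Q o) (h' : ∀ o, P' o → Q o) (hd : ∀ o, P o → ¬ P' o) :
    windowShare σ k j P + windowShare σ k j P' ≤ windowShare σ k j Q := by
  unfold windowShare
  rw [← list_sum_map_add]
  refine list_sum_map_le _ fun s _ => ?_
  by_cases h1 : P s.1
  · simp [h1, h _ h1, hd _ h1]
  · by_cases h2 : P' s.1
    · simp [h1, h2, h' _ h2]
    · simp [h1, h2]

theorem share_le_windowShare {σ : Schedule N} {k : ℕ} {j : ℤ} {P : ℝ → Prop} {s : ℝ × N.Sets}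
    (hs : s ∈ σ) (h : P s.1) : share N k j s.2 ≤ windowShare σ k j P := by
  classical
  unfold windowShare
  have := List.single_le_sum (l := σ.map fun s => if P s.1 then share N k j s.2 else 0)
    (fun _ _ => zero_le) (if P s.1 then share N k j s.2 else 0) (List.mem_map_of_mem hs)
  rwa [if_pos h] at this

open Classical in
/-- The union of the transmissions that satisfy `P`. -/
def unionOf (σ : Schedule N) (P : ℝ × N.Sets → Prop) : N.Sets :=
  Finset.univ.filter fun e => ∃ s ∈ σ, P s ∧ e ∈ s.2

theorem mem_unionOf {σ : Schedule N} {P : ℝ × N.Sets → Prop} {e : Fin N.numElems} :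
    e ∈ unionOf σ P ↔ ∃ s ∈ σ, P s ∧ e ∈ s.2 := by
  simp [unionOf]

open Classical in
theorem setCost_unionOf_sdiff_le (σ : Schedule N) (P : ℝ × N.Sets → Prop) (F : N.Sets) :
    (N.setCost (unionOf σ P \ F) : ℝ≥0∞) ≤
      (σ.map fun s => if P s then (N.setCost (s.2 \ F) : ℝ≥0∞) else 0).sum := by
  induction σ with
  | nil => simp [unionOf, Network.setCost]
  | cons s σ ih =>
    rw [List.map_cons, List.sum_cons]
    have hsub : unionOf (s :: σ) P \ F ⊆ (if P s then s.2 \ F else ∅) ∪ (unionOf σ P \ F) := by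
      intro e he
      rw [Finset.mem_sdiff, unionOf, Finset.mem_filter] at he
      obtain ⟨⟨-, x, hx, hPx, hex⟩, heF⟩ := he
      rw [Finset.mem_union]
      rcases List.mem_cons.1 hx with rfl | hx
      · left
        rw [if_pos hPx]
        exact Finset.mem_sdiff.2 ⟨hex, heF⟩
      · right
        rw [Finset.mem_sdiff, unionOf, Finset.mem_filter]
        exact ⟨⟨Finset.mem_univ _, x, hx, hPx, hex⟩, heF⟩
    have := (setCost_mono hsub).trans (setCost_union_le _ _)
    refine (ENNReal.coe_le_coe.2 this).trans ?_
    rw [ENNReal.coe_add]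
    refine add_le_add ?_ ih
    split_ifs
    · exact le_rfl
    · simp [Network.setCost]

/-- If `2 ^ j` is bounded by the non-free part of the transmissions in a window that are not too
cheap, plus `y`, then it is bounded by their shares, plus `y`. -/
theorem zpow_le_windowShare_add (σ : Schedule N) (k : ℕ) (j : ℤ) (P : ℝ → Prop) (y : ℝ≥0∞)
    (h : ENNReal.ofReal (2 ^ j) ≤ N.setCost (unionOf σ (fun s => P s.1 ∧
      (2 : ℝ) ^ j < N.setCost s.2 * k) \ freeElems N (2 ^ j)) + y) :
    ENNReal.ofReal (2 ^ j) ≤ windowShare σ k j P + y := by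
  classical
  by_cases hex : ∃ s ∈ σ, P s.1 ∧ (2 : ℝ) ^ j ≤ N.setCost s.2
  · obtain ⟨s, hs, hP, hc⟩ := hex
    rw [← share_of_le (k := k) hc]
    exact (share_le_windowShare hs hP).trans le_self_add
  · refine h.trans (add_le_add ((setCost_unionOf_sdiff_le _ _ _).trans ?_) le_rfl)
    refine list_sum_map_le _ fun s hs => ?_
    split_ifs with h1 h2 h2
    · rw [share, if_neg fun hc => hex ⟨s, hs, h2, hc⟩, if_pos h1.2]
    · exact absurd h1.1 h2
    · exact zero_le
    · exact le_rfl

end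

/-! ### Events of a run, and termination -/

section
variable {N : Network.{u}} {γ : ℝ≥0} {L : List (Request N)} {t : ℝ} {A : Solver PMF N}
variable {known : List (Request N)} {s s' : Mem N.numElems} {c c' : Config N.numElems}

/-- The release time of request number `q`, and `0` if there is no such request. -/
def releaseOf (L : List (Request N)) (q : ℕ) : ℝ := L[q]?.elim 0 fun r => r.release

theorem releaseOf_mono (hL : IsInput L) {p q : ℕ} (hpq : p ≤ q) (hq : q < L.length) :
    releaseOf L p ≤ releaseOf L q := by
  unfold releaseOf
  rw [List.getElem?_eq_getElem hq, List.getElem?_eq_getElem (hpq.trans_lt hq)]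
  rcases hpq.eq_or_lt with rfl | h
  · exact le_rfl
  · exact List.pairwise_iff_getElem.1 hL p q _ hq h

theorem residual_take {q r : ℕ} (hq : q < r) (h x : ℝ) :
    residual (L.take r) q h x = residual L q h x := by
  unfold residual
  rw [delayOf_take hq]

open Classical in
theorem totalResidual_take {r : ℕ} (hr : r ≤ L.length) (M : ℕ → Prop) (h : ℕ → ℝ) (x : ℝ) :
    totalResidual (L.take r) M h x =
      ∑ q ∈ Finset.range r, if M q then residual L q (h q) x else 0 := by
  unfold totalResidual
  rw [List.length_take_of_le hr]
  refine Finset.sum_congr rfl fun q hq => ?_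
  rw [residual_take (Finset.mem_range.1 hq)]

/-- It is enough to bound the loads at the levels of the pending requests. -/
theorem load_le {x : ℝ}
    (h : ∀ q < known.length, s.nat 0 q ≠ 0 → load known s (s.real 0 q) x ≤ s.real 0 q)
    {v : ℝ} (hv : 0 ≤ v) : load known s v x ≤ v := by
  classical
  by_cases hne : ((Finset.range known.length).filter fun q => Touched s v q).Nonempty
  · obtain ⟨q, hq, hmax⟩ := Finset.exists_max_image _ (s.real 0) hne
    rw [Finset.mem_filter, Finset.mem_range] at hq
    refine le_trans ?_ ((h q hq.1 hq.2.1).trans hq.2.2)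
    refine totalResidual_mono_set (fun p hp hp' => ⟨hp'.1, hmax p ?_⟩) _ _
    rw [Finset.mem_filter, Finset.mem_range]
    exact ⟨hp, hp'⟩
  · refine le_trans (le_of_eq ?_) hv
    unfold load totalResidual
    refine Finset.sum_eq_zero fun q hq => if_neg fun hq' => hne ⟨q, ?_⟩
    rw [Finset.mem_filter]
    exact ⟨hq, hq'⟩

/-- What holds between events, whatever the offline solution.  The levels of a pending request go up
from its individual cost divided by `γ`, rounded to a power of two, by less than a factor `2k`. -/
structure Basic (γ : ℝ≥0) (L : List (Request N)) (c : Config N.numElems) : Prop where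
  released_le : c.released ≤ L.length
  release_le : ∀ q < c.released, releaseOf L q ≤ c.clock
  alarm : AlarmOK (L.take c.released) c.clock c.mem
  serves : ∀ q < c.released, c.mem.nat 0 q ≠ 0 →
    Serves L q (c.mem.set 0 q) ∧ (N.setCost (c.mem.set 0 q) : ℝ) = c.mem.real 2 q
  own_le : ∀ q < c.released, c.mem.nat 0 q ≠ 0 → ∀ S, Serves L q S →
    c.mem.real 2 q ≤ γ * N.setCost S
  level : ∀ q < c.released, c.mem.nat 0 q ≠ 0 → 0 < c.mem.real 2 q ∧ ∃ i : ℕ,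
    c.mem.real 0 q = 2 ^ (Int.log 2 (c.mem.real 2 q / γ) + i) ∧ (2 : ℝ) ^ i < 2 * L.length
  offset : ∀ q < c.released, 0 ≤ c.mem.real 1 q

/-- The number of times that the level of request `q` has been doubled, as long as it is pending. -/
def rise (γ : ℝ≥0) (s : Mem N.numElems) (q : ℕ) : ℕ :=
  (Int.log 2 (s.real 0 q) - Int.log 2 (s.real 2 q / γ)).toNat

/-- A quantity that grows at each event. -/
def progress (γ : ℝ≥0) (L : List (Request N)) (c : Config N.numElems) : ℕ :=
  c.released + ∑ q ∈ Finset.range c.released,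
    if c.mem.nat 0 q ≠ 0 then rise γ c.mem q else 2 * L.length

theorem rise_eq {q i : ℕ} (h : s.real 0 q = 2 ^ (Int.log 2 (s.real 2 q / γ) + i)) :
    rise γ s q = i := by
  have : Int.log 2 (s.real 0 q) = Int.log 2 (s.real 2 q / γ) + i := by
    rw [h]
    exact_mod_cast Int.log_zpow (R := ℝ) (b := 2) (by norm_num) _
  rw [rise, this]
  simp

theorem lt_of_two_pow_lt {i k : ℕ} (h : (2 : ℝ) ^ i < 2 * k) : i < 2 * k := by
  have h' : 2 ^ i < 2 * k := by exact_mod_cast h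
  exact Nat.lt_two_pow_self.trans h'

theorem Basic.progress_le (hB : Basic γ L c) :
    progress γ L c ≤ L.length + L.length * (2 * L.length) := by
  unfold progress
  refine add_le_add hB.released_le ?_
  calc _ ≤ ∑ q ∈ Finset.range c.released, 2 * L.length := by
        refine Finset.sum_le_sum fun q hq => ?_
        split_ifs with h
        · obtain ⟨-, i, hi, hlt⟩ := hB.level q (Finset.mem_range.1 hq) h
          rw [rise_eq hi]
          exact (lt_of_two_pow_lt hlt).le
        · exact le_rfl
    _ = c.released * (2 * L.length) := by simp
    _ ≤ _ := Nat.mul_le_mul_right _ hB.released_le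

theorem Basic.level_pos (hB : Basic γ L c) {q : ℕ} (hq : q < c.released)
    (hp : c.mem.nat 0 q ≠ 0) : 0 < c.mem.real 0 q := by
  obtain ⟨-, i, hi, -⟩ := hB.level q hq hp
  rw [hi]
  positivity

/-- Both memories hold the same data about the requests, and the same transmissions. -/
structure SameRequests (s s' : Mem N.numElems) : Prop where
  nat : s'.nat 0 = s.nat 0
  real : ∀ a < 3, s'.real a = s.real a
  set : s'.set 0 = s.set 0
  sent : s'.sent = s.sent

theorem runs_resetAlarmProg' (h : Runs γ known t A resetAlarmProg s s')
    (hload : ∀ q < known.length, s.nat 0 q ≠ 0 → load known s (s.real 0 q) t ≤ s.real 0 q) :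
    SameRequests s s' ∧ AlarmOK known t s' := by
  obtain ⟨h1, h2⟩ := runs_resetAlarmProg h hload
  refine ⟨⟨h.nat_eq (by decide), fun a ha => ?_, h.set_eq (by decide), h1⟩, h2⟩
  interval_cases a <;> exact h.real_eq (by decide)

theorem IsRegistration.congr {r : ℕ} {s₁ : Mem N.numElems}
    (h : IsRegistration γ known t r s s₁) (e : SameRequests s₁ s') :
    IsRegistration γ known t r s s' := by
  constructor
  · rw [e.nat]; exact h.nat
  · intro a ha; rw [e.real a ha]; exact h.real a ha
  · rw [e.set]; exact h.set
  · rw [e.set]; exact h.serves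
  · rw [e.set, e.real 2 (by lia)]; exact h.own
  · rw [e.real 2 (by lia)]; exact h.own_le
  · rw [e.real 2 (by lia), e.real 0 (by lia)]; exact h.level
  · rw [e.real 1 (by lia)]; exact h.offset
  · rw [e.real 2 (by lia), e.nat]; exact h.pending
  · rw [e.nat, e.set, e.sent]; exact h.sent

theorem IsService.congr {w x : ℝ} {X : N.Sets} {U : ℕ → Prop} {s₁ : Mem N.numElems}
    (h : IsService γ known t w x X U s s₁) (e : SameRequests s₁ s') :
    IsService γ known t w x X U s s' := by
  constructor
  · exact h.le_time
  · rw [e.sent]; exact h.sent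
  · exact h.cost_le
  · exact h.sub
  · rw [e.nat]; exact h.pending
  · exact h.serves
  · rw [e.real 0 (by lia)]; exact h.level
  · rw [e.real 1 (by lia)]; exact h.offset
  · exact h.residual_le
  · exact h.le_waitCost
  · rw [e.real 2 (by lia)]; exact h.real_two
  · rw [e.set]; exact h.set_zero

theorem Basic.load_le_of_le (hB : Basic γ L c) {x : ℝ}
    (hx : ∀ a, c.mem.alarm = some a → x ≤ a) : ∀ q < (L.take c.released).length,
    c.mem.nat 0 q ≠ 0 → load (L.take c.released) c.mem (c.mem.real 0 q) x ≤ c.mem.real 0 q := by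
  intro q hq hp
  rcases hB.alarm with ⟨-, h⟩ | ⟨a, ha, -, -, h⟩
  · exact absurd (h q hq) hp
  · exact (totalResidual_mono _ _ _ (hx a ha)).trans (h q hq hp)

/-- Registering a request does not change the loads, as its delay so far is not residual. -/
theorem Basic.load_registration (hB : Basic γ L c) (hr : c.released < L.length)
    (hx : ∀ a, c.mem.alarm = some a → t ≤ a)
    (h : IsRegistration γ (L.take (c.released + 1)) t c.released c.mem s) :
    ∀ q < (L.take (c.released + 1)).length, s.nat 0 q ≠ 0 →
      load (L.take (c.released + 1)) s (s.real 0 q) t ≤ s.real 0 q := by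
  classical
  have hload := fun v (hv : 0 ≤ v) => load_le (hB.load_le_of_le hx) (v := v) hv
  have key : ∀ v, load (L.take (c.released + 1)) s v t = load (L.take c.released) c.mem v t := by
    intro v
    unfold load
    rw [totalResidual_take hr, totalResidual_take hr.le, Finset.sum_range_succ]
    have : residual L c.released (s.real 1 c.released) t = 0 := by
      rw [residual, h.offset, delayOf_take (Nat.lt_succ_self _), sub_self, max_self]
    rw [this, ite_self, add_zero]
    refine Finset.sum_congr rfl fun q hq => ?_
    have hq := (Finset.mem_range.1 hq).ne
    rw [h.nat q hq, h.real 0 (by lia) q hq, h.real 1 (by lia) q hq]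
  intro q hq hp
  rw [key]
  refine hload _ ?_
  rw [List.length_take_of_le hr] at hq
  rcases Nat.lt_succ_iff_lt_or_eq.1 hq with hq | rfl
  · rw [h.nat q hq.ne] at hp
    rw [h.real 0 (by lia) q hq.ne]
    exact (hB.level_pos hq hp).le
  · rw [h.level]
    positivity

theorem Basic.registration (hL : IsInput L) (hB : Basic γ L c)
    (hr : c.released < L.length) (ht : t = releaseOf L c.released)
    (h : IsRegistration γ (L.take (c.released + 1)) t c.released c.mem s')
    (hal : AlarmOK (L.take (c.released + 1)) t s') :
    Basic γ L ⟨s', c.released + 1, t⟩ ∧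
      progress γ L c + 1 ≤ progress γ L ⟨s', c.released + 1, t⟩ := by
  have hlev : s'.real 0 c.released = 2 ^ (Int.log 2 (s'.real 2 c.released / γ) + (0 : ℕ)) := by
    rw [h.level]
    simp
  constructor
  · constructor
    · exact hr
    · intro q hq
      rw [ht]
      exact releaseOf_mono hL (Nat.lt_succ_iff.1 hq) hr
    · exact hal
    · intro q hq hp
      simp only at hp ⊢
      rcases Nat.lt_succ_iff_lt_or_eq.1 hq with hq | rfl
      · rw [h.nat q hq.ne] at hp
        rw [h.set q hq.ne, h.real 2 (by lia) q hq.ne]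
        exact hB.serves q hq hp
      · have := h.serves
        rw [serves_take (Nat.lt_succ_self _)] at this
        exact ⟨this, h.own.symm⟩
    · intro q hq hp S hS
      simp only at hp ⊢
      rcases Nat.lt_succ_iff_lt_or_eq.1 hq with hq | rfl
      · rw [h.nat q hq.ne] at hp
        rw [h.real 2 (by lia) q hq.ne]
        exact hB.own_le q hq hp S hS
      · refine h.own_le S ?_
        rwa [serves_take (Nat.lt_succ_self _)]
    · intro q hq hp
      simp only at hp ⊢
      rcases Nat.lt_succ_iff_lt_or_eq.1 hq with hq | rfl
      · rw [h.nat q hq.ne] at hp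
        rw [h.real 2 (by lia) q hq.ne, h.real 0 (by lia) q hq.ne]
        exact hB.level q hq hp
      · refine ⟨h.pending.1 hp, 0, hlev, ?_⟩
        have : (1 : ℝ) ≤ L.length := by exact_mod_cast (Nat.zero_le _).trans_lt hr
        rw [pow_zero]
        linarith
    · intro q hq
      simp only
      rcases Nat.lt_succ_iff_lt_or_eq.1 hq with hq | rfl
      · rw [h.real 1 (by lia) q hq.ne]
        exact hB.offset q hq
      · rw [h.offset]
        exact NNReal.coe_nonneg _
  · unfold progress
    simp only
    rw [Finset.sum_range_succ]
    have : ∑ q ∈ Finset.range c.released,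
        (if s'.nat 0 q ≠ 0 then rise γ s' q else 2 * L.length) =
        ∑ q ∈ Finset.range c.released,
        (if c.mem.nat 0 q ≠ 0 then rise γ c.mem q else 2 * L.length) := by
      refine Finset.sum_congr rfl fun q hq => ?_
      have hq := (Finset.mem_range.1 hq).ne
      rw [h.nat q hq]
      unfold rise
      rw [h.real 0 (by lia) q hq, h.real 2 (by lia) q hq]
    rw [this]
    lia

/-- After a service the remaining touched requests have no residual delay. -/
theorem Basic.load_service {w x : ℝ} {X : N.Sets} {U : ℕ → Prop} (hB : Basic γ L c) (hw : 0 < w)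
    (hx : ∀ a, c.mem.alarm = some a → t ≤ a)
    (h : IsService γ (L.take c.released) t w x X U c.mem s) :
    ∀ q < (L.take c.released).length, s.nat 0 q ≠ 0 →
      load (L.take c.released) s (s.real 0 q) t ≤ s.real 0 q := by
  classical
  have hlen := List.length_take_of_le hB.released_le
  have hload := fun v (hv : 0 ≤ v) => load_le (hB.load_le_of_le hx) (v := v) hv
  intro q hq hp
  refine le_trans ?_ (hload (s.real 0 q) ?_)
  · unfold load totalResidual
    refine Finset.sum_le_sum fun p hp => ?_
    have hp := Finset.mem_range.1 hp
    by_cases h1 : s.nat 0 p ≠ 0 ∧ s.real 0 p ≤ s.real 0 q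
    · rw [if_pos h1]
      by_cases hU : U p
      · have : residual (L.take c.released) p (s.real 1 p) t = 0 := by
          rw [h.offset p hp, if_pos (h.sub p hp hU).1, add_residual, residual]
          refine max_eq_left (sub_nonpos.2 (le_max_of_le_right ?_))
          exact_mod_cast delayOf_mono _ _ h.le_time
        rw [this]
        split_ifs
        · exact residual_nonneg _ _ _ _
        · exact le_rfl
      · have h2 := (h.pending p hp).1 h1.1
        have h3 : ¬ Touched c.mem w p := fun ht => hU (h2.2 ht.2)
        have h4 : s.real 0 p = c.mem.real 0 p := by rw [h.level p hp, if_neg hU]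
        rw [if_pos ⟨h2.1, h4 ▸ h1.2⟩, h.offset p hp, if_neg h3]
    · rw [if_neg h1]
      split_ifs
      · exact residual_nonneg _ _ _ _
      · exact le_rfl
  · rw [h.level q hq]
    split_ifs
    · exact hw.le
    · exact (hB.level_pos (by lia) ((h.pending q hq).1 hp).1).le

theorem Basic.service {v x : ℝ} {X : N.Sets} {U : ℕ → Prop} (hγ : 1 ≤ γ) (hB : Basic γ L c)
    (ht : c.clock ≤ t) (htrig : ∃ q < c.released, c.mem.nat 0 q ≠ 0 ∧ c.mem.real 0 q = v)
    (h : IsService γ (L.take c.released) t (v + v) x X U c.mem s')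
    (hal : AlarmOK (L.take c.released) t s') :
    Basic γ L ⟨s', c.released, t⟩ ∧ progress γ L c + 1 ≤ progress γ L ⟨s', c.released, t⟩ := by
  have hγ0 : (0 : ℝ) < γ := lt_of_lt_of_le one_pos (by exact_mod_cast hγ)
  have hlen := List.length_take_of_le hB.released_le
  have hpend : ∀ q < c.released, s'.nat 0 q ≠ 0 → c.mem.nat 0 q ≠ 0 := fun q hq hp =>
    ((h.pending q (by lia)).1 hp).1
  obtain ⟨q₀, hq₀, hp₀, hv⟩ := htrig
  obtain ⟨-, i₀, hi₀, -⟩ := hB.level q₀ hq₀ hp₀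
  have hw : v + v = 2 ^ (Int.log 2 (c.mem.real 2 q₀ / γ) + i₀ + 1) := by
    rw [zpow_add_one₀ (by norm_num), ← hi₀, hv]
    ring
  -- The rounded own cost is at least half the own cost, whence the bound on the level.
  have hU : ∀ q < c.released, U q → ∃ i : ℕ,
      s'.real 0 q = 2 ^ (Int.log 2 (s'.real 2 q / γ) + i) ∧ (2 : ℝ) ^ i < 2 * L.length ∧
      c.mem.real 0 q ≤ s'.real 0 q := by
    intro q hq hUq
    obtain ⟨⟨hp, hle⟩, hexp⟩ := h.sub q (by lia) hUq
    obtain ⟨hpos, i, hi, -⟩ := hB.level q hq hp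
    rw [h.level q (by lia), if_pos hUq, h.real_two]
    have h1 : (2 : ℝ) ^ (Int.log 2 (c.mem.real 2 q / γ) + i) ≤
        2 ^ (Int.log 2 (c.mem.real 2 q₀ / γ) + i₀ + 1) := by
      rw [← hi, ← hw]
      exact hle
    have h2 := (zpow_le_zpow_iff_right₀ (by norm_num)).1 h1
    obtain ⟨i', hi'⟩ : ∃ i' : ℕ, Int.log 2 (c.mem.real 2 q₀ / γ) + i₀ + 1 =
        Int.log 2 (c.mem.real 2 q / γ) + i' :=
      ⟨(Int.log 2 (c.mem.real 2 q₀ / γ) + i₀ + 1 - Int.log 2 (c.mem.real 2 q / γ)).toNat, by lia⟩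
    refine ⟨i', by rw [hw, hi'], ?_, hle⟩
    have h3 : c.mem.real 2 q / γ < 2 ^ (Int.log 2 (c.mem.real 2 q / γ) + 1) := by
      have := Int.lt_zpow_succ_log_self (b := 2) (by norm_num) (c.mem.real 2 q / γ)
      exact_mod_cast this
    have h4 : v + v < c.mem.real 2 q / γ * L.length := by
      unfold Expensive at hexp
      rw [hlen] at hexp
      rw [div_mul_eq_mul_div, lt_div_iff₀ hγ0, mul_comm]
      refine hexp.trans_le ?_
      have : (c.released : ℝ) ≤ L.length := by exact_mod_cast hB.released_le
      gcongr
    rw [hw, hi', zpow_add₀ (by norm_num), zpow_natCast] at h4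
    rw [zpow_add_one₀ (by norm_num)] at h3
    have h5 : (0 : ℝ) < 2 ^ Int.log 2 (c.mem.real 2 q / γ) := by positivity
    have h6 : c.mem.real 2 q / γ * L.length ≤
        2 ^ Int.log 2 (c.mem.real 2 q / γ) * 2 * L.length := by gcongr
    have h7 : (2 : ℝ) ^ Int.log 2 (c.mem.real 2 q / γ) * 2 ^ i' <
        2 ^ Int.log 2 (c.mem.real 2 q / γ) * (2 * L.length) := by
      rw [← mul_assoc]
      exact h4.trans_le h6
    exact lt_of_mul_lt_mul_left h7 h5.le
  have hlevel : ∀ q < c.released, s'.nat 0 q ≠ 0 → 0 < s'.real 2 q ∧ ∃ i : ℕ,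
      s'.real 0 q = 2 ^ (Int.log 2 (s'.real 2 q / γ) + i) ∧ (2 : ℝ) ^ i < 2 * L.length := by
    intro q hq hp
    obtain ⟨hpos, i, hi, hlt⟩ := hB.level q hq (hpend q hq hp)
    refine ⟨by rw [h.real_two]; exact hpos, ?_⟩
    by_cases hUq : U q
    · obtain ⟨i', hi', hlt', -⟩ := hU q hq hUq
      exact ⟨i', hi', hlt'⟩
    · exact ⟨i, by rw [h.level q (by lia), if_neg hUq, h.real_two]; exact hi, hlt⟩
  constructor
  · constructor
    · exact hB.released_le
    · exact fun q hq => (hB.release_le q hq).trans ht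
    · exact hal
    · intro q hq hp
      simp only
      rw [h.set_zero, h.real_two]
      exact hB.serves q hq (hpend q hq hp)
    · intro q hq hp
      simp only
      rw [h.real_two]
      exact hB.own_le q hq (hpend q hq hp)
    · exact hlevel
    · intro q hq
      simp only
      rw [h.offset q (by lia)]
      split_ifs
      · exact add_nonneg (hB.offset q hq) (residual_nonneg _ _ _ _)
      · exact hB.offset q hq
  · unfold progress
    simp only
    rw [add_assoc]
    refine Nat.add_le_add_left (Nat.succ_le_of_lt ?_) _
    have hmono : ∀ q < c.released,
        (if c.mem.nat 0 q ≠ 0 then rise γ c.mem q else 2 * L.length) ≤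
        (if s'.nat 0 q ≠ 0 then rise γ s' q else 2 * L.length) := by
      intro q hq
      by_cases hp : c.mem.nat 0 q ≠ 0
      · rw [if_pos hp]
        obtain ⟨hpos, i, hi, hlt⟩ := hB.level q hq hp
        rw [rise_eq hi]
        split_ifs with hp'
        · by_cases hUq : U q
          · obtain ⟨i', hi', -, hle⟩ := hU q hq hUq
            rw [rise_eq hi']
            rw [hi, hi', h.real_two] at hle
            have := (zpow_le_zpow_iff_right₀ (by norm_num)).1 hle
            lia
          · rw [rise_eq (i := i)]
            rw [h.level q (by lia), if_neg hUq, h.real_two]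
            exact hi
        · exact (lt_of_two_pow_lt hlt).le
      · rw [if_neg hp, if_neg fun hp' => hp (hpend q hq hp')]
    -- The request that has triggered the service is served, or its level doubles.
    refine Finset.sum_lt_sum (fun q hq => hmono q (Finset.mem_range.1 hq))
      ⟨q₀, Finset.mem_range.2 hq₀, ?_⟩
    rw [if_pos hp₀, rise_eq hi₀]
    split_ifs with hp'
    · have hv0 : 0 < v := hv ▸ hB.level_pos hq₀ hp₀
      have hU₀ : U q₀ := ((h.pending q₀ (by lia)).1 hp').2 (by rw [hv]; linarith)
      obtain ⟨i', hi', -, -⟩ := hU q₀ hq₀ hU₀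
      rw [rise_eq hi']
      rw [h.level q₀ (by lia), if_pos hU₀, hw, h.real_two] at hi'
      have := zpow_right_injective₀ (a := (2 : ℝ)) (by norm_num) (by norm_num) hi'
      lia
    · obtain ⟨-, j, hj, hlt⟩ := hB.level q₀ hq₀ hp₀
      have := rise_eq hi₀
      rw [rise_eq hj] at this
      subst this
      exact lt_of_two_pow_lt hlt

/-- The transitions between the configurations before and after an event. -/
inductive Event (γ : ℝ≥0) (L : List (Request N)) (c : Config N.numElems) :
    Config N.numElems → Prop
  | finished (h : c.released = L.length) (h' : c.mem.alarm = none) : Event γ L c c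
  | release (s' : Mem N.numElems) (h : c.released < L.length)
      (hx : ∀ a, c.mem.alarm = some a → releaseOf L c.released ≤ a)
      (hreg : IsRegistration γ (L.take (c.released + 1)) (releaseOf L c.released) c.released
        c.mem s')
      (hal : AlarmOK (L.take (c.released + 1)) (releaseOf L c.released) s') :
      Event γ L c ⟨s', c.released + 1, releaseOf L c.released⟩
  | alarm (s' : Mem N.numElems) (a v x : ℝ) (X : N.Sets) (U : ℕ → Prop)
      (ha : c.mem.alarm = some a) (hc : c.clock ≤ a)
      (hx : ∀ q, c.released ≤ q → q < L.length → a ≤ releaseOf L q)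
      (htrig : ∃ q < c.released, c.mem.nat 0 q ≠ 0 ∧ c.mem.real 0 q = v ∧
        load (L.take c.released) c.mem v a = v)
      (hserv : IsService γ (L.take c.released) a (v + v) x X U c.mem s')
      (hal : AlarmOK (L.take c.released) a s') :
      Event γ L c ⟨s', c.released, a⟩

theorem event_of_mem_nextEvent (hγ : 1 ≤ γ) (hL : IsInput L)
    (hA : ∀ E₀ Q S, ∀ x ∈ (A E₀ Q).support, N.pcCost E₀ Q x.1 ≤ γ * N.pcCost E₀ Q S)
    (hB : Basic γ L c) (h : c' ∈ (nextEvent algorithm γ A L c).support) : Event γ L c c' := by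
  have hrel : ∀ q, L[c.released]? = some q → (∀ a, c.mem.alarm = some a → q.release ≤ a) →
      c' ∈ (releaseEvent algorithm γ A L q.release c).support → Event γ L c c' := by
    intro q hq hx h
    obtain ⟨hr, -⟩ := List.getElem?_eq_some_iff.1 hq
    have hq' : q.release = releaseOf L c.released := by simp [releaseOf, hq]
    rw [hq'] at h hx
    unfold releaseEvent at h
    rw [mem_support_bind] at h
    obtain ⟨s', hs, hc'⟩ := h
    rw [mem_support_pure] at hc'
    subst hc'
    obtain ⟨s₁, h1, h2⟩ := runs_seq.1 (show Runs γ _ _ A algorithm.onRequest c.mem s' from hs)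
    have hreg := runs_registerProg hγ hA (r := c.released)
      (List.length_take_of_le hr) h1
    obtain ⟨k1, k2⟩ := runs_resetAlarmProg' h2 (hB.load_registration hr hx hreg)
    exact .release s' hr hx (hreg.congr k1) k2
  have halm : ∀ a, c.mem.alarm = some a → (∀ q, L[c.released]? = some q → a ≤ q.release) →
      c' ∈ (alarmEvent algorithm γ A L a c).support → Event γ L c c' := by
    intro a ha hx h
    rcases hB.alarm with ⟨h0, -⟩ | ⟨a', ha', hc, htrig, hload⟩
    · rw [ha] at h0
      cases h0
    obtain rfl : a' = a := by
      rw [ha] at ha'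
      exact (Option.some.inj ha').symm
    unfold alarmEvent at h
    rw [mem_support_bind, max_eq_right hc] at h
    obtain ⟨s', hs, hc'⟩ := h
    rw [mem_support_pure] at hc'
    subst hc'
    obtain ⟨s₁, h1, h2⟩ := runs_seq.1 (show Runs γ _ _ A algorithm.onAlarm _ s' from hs)
    have hlen := List.length_take_of_le hB.released_le
    rw [hlen] at htrig
    obtain ⟨q, hq, hp, hq7, hq'⟩ := htrig
    have hpos := hB.level_pos hq hp
    have hbound := hB.load_le_of_le (x := a') (fun b hb => by
      rw [ha] at hb
      exact (Option.some.inj hb).le)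
    obtain ⟨x, X, U, hserv⟩ := runs_serviceProg (w := c.mem.real 7 0 + c.mem.real 7 0) hγ
      (by rw [← hq7]; linarith) hA rfl (s := { c.mem with alarm := none })
      (by
        intro p hp hp'
        rw [hlen] at hp
        have := hB.serves p hp hp'
        rwa [serves_take hp])
      (load_le hbound (by rw [← hq7]; linarith)) h1
    have hserv : IsService γ (L.take c.released) a' (c.mem.real 7 0 + c.mem.real 7 0) x X U
        c.mem s₁ := by
      obtain ⟨a1, a2, a3, a4, a5, a6, a7, a8, a9, a10, a11, a12⟩ := hserv
      exact ⟨a1, a2, a3, a4, a5, a6, a7, a8, a9, a10, a11, a12⟩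
    obtain ⟨k1, k2⟩ := runs_resetAlarmProg' h2 (hB.load_service (by rw [← hq7]; linarith)
      (fun b hb => by
        rw [ha] at hb
        exact (Option.some.inj hb).le) hserv)
    refine .alarm s' a' (c.mem.real 7 0) x X U ha hc (fun p hp hp' => ?_)
      ⟨q, hq, hp, hq7, hq7 ▸ hq'⟩ (hserv.congr k1) k2
    refine le_trans ?_ (releaseOf_mono hL hp hp')
    have := hx _ (List.getElem?_eq_getElem (hp.trans_lt hp'))
    rwa [releaseOf, List.getElem?_eq_getElem (hp.trans_lt hp')]
  unfold nextEvent at h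
  split at h
  · next h1 h2 =>
    rw [mem_support_pure] at h
    subst h
    exact .finished (le_antisymm hB.released_le (List.getElem?_eq_none_iff.1 h1)) h2
  · next q h1 h2 =>
    exact hrel q h1 (by simp [h2]) h
  · next a h1 h2 =>
    exact halm a h2 (by simp [h1]) h
  · next q a h1 h2 =>
    split_ifs at h with hle
    · exact hrel q h1 (by simpa [h2] using hle) h
    · exact halm a h2 (by simpa [h1] using (not_le.1 hle).le) h

theorem Basic.event (hγ : 1 ≤ γ) (hL : IsInput L) (hB : Basic γ L c) (h : Event γ L c c') :
    Basic γ L c' ∧ (Finished L c ∧ c' = c ∨ progress γ L c + 1 ≤ progress γ L c') := by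
  cases h with
  | finished h h' => exact ⟨hB, Or.inl ⟨⟨h, h'⟩, rfl⟩⟩
  | release s' hr hx hreg hal =>
    obtain ⟨h1, h2⟩ := hB.registration hL hr rfl hreg hal
    exact ⟨h1, Or.inr h2⟩
  | alarm s' a v x X U ha hc hx htrig hserv hal =>
    obtain ⟨q, hq, hp, hv, -⟩ := htrig
    obtain ⟨h1, h2⟩ := hB.service hγ hc ⟨q, hq, hp, hv⟩ hserv hal
    exact ⟨h1, Or.inr h2⟩

theorem basic_start : Basic γ L (Config.start N.numElems) := by
  constructor
  · exact Nat.zero_le _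
  · intro q hq
    exact absurd hq (Nat.not_lt_zero q)
  · exact Or.inl ⟨rfl, fun _ _ => rfl⟩
  all_goals
    intro q hq
    exact absurd hq (Nat.not_lt_zero q)

theorem basic_runEvents (hγ : 1 ≤ γ) (hL : IsInput L)
    (hA : ∀ E₀ Q S, ∀ x ∈ (A E₀ Q).support, N.pcCost E₀ Q x.1 ≤ γ * N.pcCost E₀ Q S) (T : ℕ) :
    ∀ c ∈ (runEvents algorithm γ A L T).support,
      Basic γ L c ∧ (Finished L c ∨ T ≤ progress γ L c) := by
  induction T with
  | zero =>
    intro c hc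
    obtain rfl := mem_support_pure.1 hc
    exact ⟨basic_start, Or.inr (Nat.zero_le _)⟩
  | succ T ih =>
    intro c' hc'
    rw [runEvents, mem_support_bind] at hc'
    obtain ⟨c, hc, hc'⟩ := hc'
    obtain ⟨hB, h⟩ := ih c hc
    obtain ⟨hB', h'⟩ := hB.event hγ hL (event_of_mem_nextEvent hγ hL hA hB hc')
    refine ⟨hB', ?_⟩
    rcases h' with ⟨h', rfl⟩ | h'
    · exact Or.inl h'
    · rcases h with ⟨h1, h2⟩ | h
      · have : nextEvent algorithm γ A L c = pure c := by
          have : L[c.released]? = none := by simp [h1]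
          simp only [nextEvent, this, h2]
        rw [this, mem_support_pure] at hc'
        subst hc'
        exact Or.inl ⟨h1, h2⟩
      · exact Or.inr (by lia)

/-- A bound on the number of events on inputs of `k` requests: each of them increases `progress`. -/
def maxEvents (k : ℕ) : ℕ := k + k * (2 * k) + 1

theorem finished_of_mem_runEvents (hγ : 1 ≤ γ) (hL : IsInput L)
    (hA : ∀ E₀ Q S, ∀ x ∈ (A E₀ Q).support, N.pcCost E₀ Q x.1 ≤ γ * N.pcCost E₀ Q S) :
    ∀ c ∈ (runEvents algorithm γ A L (maxEvents L.length)).support, Finished L c := by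
  intro c hc
  obtain ⟨hB, h⟩ := basic_runEvents hγ hL hA _ c hc
  refine h.resolve_right fun h => ?_
  have := hB.progress_le
  unfold maxEvents at h
  lia

end

/-! ### Charging an offline solution -/

theorem tsum_add_le_tsum {α : Type*} {f g : α → ℝ≥0∞} (h : ∀ i, f i ≤ g i) {j : α} {x : ℝ≥0∞}
    (hj : f j + x ≤ g j) : ∑' i, f i + x ≤ ∑' i, g i := by
  classical
  rw [← tsum_ite_eq j fun _ => x, ← ENNReal.tsum_add]
  refine ENNReal.tsum_le_tsum fun i => ?_
  split_ifs with hi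
  · exact hi ▸ hj
  · rw [add_zero]
    exact h i

theorem add_tsum_update_zero {α : Type*} [DecidableEq α] (f : α → ℝ≥0∞) (j : α) :
    f j + ∑' i, Function.update f j 0 i = ∑' i, f i := by
  rw [ENNReal.tsum_eq_add_tsum_ite (f := f) j]
  refine congrArg _ (tsum_congr fun i => ?_)
  by_cases h : i = j <;> simp [h]

theorem tsum_update_le {α : Type*} [DecidableEq α] (f : α → ℝ≥0∞) (j : α) (x : ℝ≥0∞) :
    ∑' i, Function.update f j x i ≤ ∑' i, f i + x := by
  rw [ENNReal.tsum_eq_add_tsum_ite j, ← add_tsum_update_zero f j, Function.update_self, add_comm]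
  refine add_le_add (le_trans ?_ le_add_self) le_rfl
  refine ENNReal.tsum_le_tsum fun i => ?_
  simp only [Function.update_apply]
  split_ifs <;> simp

section
variable {N : Network.{u}} {γ : ℝ≥0} {L : List (Request N)} {t : ℝ}
variable {s s' : Mem N.numElems} {c c' : Config N.numElems} {σ : Schedule N}

/-- The delay paid by request number `q` under the schedule `σ`. -/
def delayCostOf (σ : Schedule N) (L : List (Request N)) (q : ℕ) : ℝ≥0∞ :=
  L[q]?.elim 0 (delayCost σ)

theorem le_delayCostOf {q : ℕ} {x : ℝ}
    (h : ∀ o ∈ σ, releaseOf L q ≤ o.1 → Serves L q o.2 → x ≤ o.1) :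
    (delayOf L q x : ℝ≥0∞) ≤ delayCostOf σ L q := by
  unfold releaseOf Serves at h
  unfold delayOf delayCostOf
  cases hq : L[q]? with
  | none => simp
  | some r =>
    simp only [hq, Option.elim_some, Option.mem_def, Option.some.injEq, forall_eq'] at h ⊢
    refine le_iInf₂ fun o ho => le_iInf fun h' => ?_
    exact_mod_cast r.delay_mono (h o ho h'.1 h'.2)

theorem delayCostOf_le {q : ℕ} {o : ℝ × N.Sets} (ho : o ∈ σ) (hr : releaseOf L q ≤ o.1)
    (hs : Serves L q o.2) : delayCostOf σ L q ≤ delayOf L q o.1 := by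
  unfold releaseOf at hr
  unfold Serves at hs
  unfold delayOf delayCostOf
  cases hq : L[q]? with
  | none => simp
  | some r =>
    rw [hq] at hr hs
    exact iInf₂_le_of_le o ho (iInf_le_of_le ⟨hr, hs r rfl⟩ le_rfl)

theorem delayCostOf_append_le (σ σ' : Schedule N) (L : List (Request N)) (q : ℕ) :
    delayCostOf (σ ++ σ') L q ≤ delayCostOf σ L q := by
  unfold delayCostOf
  cases L[q]? with
  | none => simp
  | some r =>
    refine le_iInf₂ fun o ho => ?_
    exact iInf₂_le o (List.mem_append_left _ ho)

theorem sum_delayCostOf (σ : Schedule N) (L : List (Request N)) :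
    ∑ q ∈ Finset.range L.length, delayCostOf σ L q = (L.map fun q => delayCost σ q).sum := by
  rw [sum_map_eq_sum_range]
  rfl

/-- The part of the delay of the requests under `σ` that the offsets have taken into account. -/
def covered (σ : Schedule N) (L : List (Request N)) (s : Mem N.numElems) (q : ℕ) : ℝ≥0∞ :=
  min (delayCostOf σ L q) (ENNReal.ofReal (s.real 1 q))

/-- The transmission cost so far. -/
def sentCost (s : Mem N.numElems) : ℝ≥0∞ := (s.sent.map fun o => (N.setCost o.2 : ℝ≥0∞)).sum

/-- The delay accounted for so far: the offset of request `q` while it is pending, the delay it has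
paid once served. -/
def paidDelay (L : List (Request N)) (s : Mem N.numElems) (q : ℕ) : ℝ≥0∞ :=
  if s.nat 0 q ≠ 0 then ENNReal.ofReal (s.real 1 q) else delayCostOf s.sent L q

/-- The shares, for all `j`, of the transmissions of `σ` before the time `last j`. -/
def charged (σ : Schedule N) (k : ℕ) (last : ℤ → WithBot ℝ) : ℝ≥0∞ :=
  ∑' j, windowShare σ k j fun o => (o : WithBot ℝ) < last j

/-- The justification of the level of request `q`: it is the initial one, or there is enough charge
on the transmissions of `σ` since the last service at this level, up to a time by which the delay of
`q` is its offset at most. -/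
def Justified (γ : ℝ≥0) (σ : Schedule N) (L : List (Request N)) (s : Mem N.numElems)
    (last : ℤ → WithBot ℝ) (cred : ℤ → ℝ≥0∞) (q : ℕ) : Prop :=
  s.real 0 q ≤ s.real 2 q / γ ∨
  ∃ (j : ℤ) (x : ℝ), s.real 0 q = 2 ^ j ∧ (delayOf L q x : ℝ) ≤ s.real 1 q ∧
    ENNReal.ofReal (2 ^ j) ≤
      windowShare σ L.length j (fun o => last j ≤ o ∧ o ≤ x) + cred j

/-- The cost of the run so far is charged to the offline solution `σ`.  A service is triggered when
the load of some level `2 ^ j` reaches `2 ^ j`; then `last j` is the time of the last such service,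
`cred j` is delay paid by `σ` set aside for the next one, and `used` is delay paid by `σ` that
has been charged.  Delay is counted twice at most, once for each of these two purposes. -/
structure Charge (γ : ℝ≥0) (σ : Schedule N) (L : List (Request N)) (c : Config N.numElems)
    (last : ℤ → WithBot ℝ) (cred : ℤ → ℝ≥0∞) (used : ℝ≥0∞) : Prop where
  future : ∀ q, c.released ≤ q → q < L.length → ∀ j, last j ≤ releaseOf L q
  last_le : ∀ q < c.released, c.mem.nat 0 q ≠ 0 → ∀ j : ℤ, c.mem.real 0 q ≤ 2 ^ j →
    last j ≤ releaseOf L q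
  justified : ∀ q < c.released, c.mem.nat 0 q ≠ 0 → Justified γ σ L c.mem last cred q
  credit : used + ∑' j, cred j ≤ 2 * ∑ q ∈ Finset.range c.released, covered σ L c.mem q
  cost : sentCost c.mem + ∑ q ∈ Finset.range c.released, paidDelay L c.mem q ≤
    ∑ q ∈ Finset.range c.released, (delayOf L q (releaseOf L q) : ℝ≥0∞) +
      24 * γ * (charged σ L.length last + used)

theorem charge_start : Charge γ σ L (Config.start N.numElems) (fun _ => ⊥) (fun _ => 0) 0 := by
  constructor
  · exact fun _ _ _ _ => bot_le
  · exact fun q hq => absurd hq (Nat.not_lt_zero q)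
  · exact fun q hq => absurd hq (Nat.not_lt_zero q)
  · simp
  · simp [Config.start, sentCost]

theorem Charge.registration {last : ℤ → WithBot ℝ} {cred : ℤ → ℝ≥0∞} {used : ℝ≥0∞} (hγ : 1 ≤ γ)
    (hC : Charge γ σ L c last cred used) (hr : c.released < L.length)
    (h : IsRegistration γ (L.take (c.released + 1)) (releaseOf L c.released) c.released c.mem s') :
    Charge γ σ L ⟨s', c.released + 1, releaseOf L c.released⟩ last cred used := by
  have hγ0 : (0 : ℝ) < γ := lt_of_lt_of_le one_pos (by exact_mod_cast hγ)
  have hoff : s'.real 1 c.released = delayOf L c.released (releaseOf L c.released) := by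
    rw [h.offset, delayOf_take (Nat.lt_succ_self _)]
  constructor
  · exact fun q hq => hC.future q (by simp only at hq; lia)
  · intro q hq hp j hj
    simp only at hp hj
    rcases Nat.lt_succ_iff_lt_or_eq.1 hq with hq | rfl
    · rw [h.nat q hq.ne] at hp
      rw [h.real 0 (by lia) q hq.ne] at hj
      exact hC.last_le q hq hp j hj
    · exact hC.future _ le_rfl hr j
  · intro q hq hp
    simp only at hp
    rcases Nat.lt_succ_iff_lt_or_eq.1 hq with hq | rfl
    · rw [h.nat q hq.ne] at hp
      have := hC.justified q hq hp
      simp only [Justified] at this ⊢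
      rwa [h.real 0 (by lia) q hq.ne, h.real 1 (by lia) q hq.ne, h.real 2 (by lia) q hq.ne]
    · left
      have := Int.zpow_log_le_self (b := 2) (by norm_num) (div_pos (h.pending.1 hp) hγ0)
      simp only [h.level]
      exact_mod_cast this
  · refine hC.credit.trans ?_
    simp only
    rw [Finset.sum_range_succ]
    gcongr
    refine le_trans (le_of_eq ?_) le_self_add
    refine Finset.sum_congr rfl fun q hq => ?_
    rw [covered, covered, h.real 1 (by lia) q (Finset.mem_range.1 hq).ne]
  · have hsent : sentCost s' = sentCost c.mem := by
      unfold sentCost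
      rw [h.sent]
      split_ifs with hp
      · rfl
      · -- An individual solution that is transmitted at once costs nothing.
        have h0 := (not_congr h.pending).1 hp
        rw [h.own, NNReal.coe_pos, not_lt, nonpos_iff_eq_zero] at h0
        simp [h0]
    have hold : ∀ q < c.released, paidDelay L s' q ≤ paidDelay L c.mem q := by
      intro q hq
      unfold paidDelay
      rw [h.nat q hq.ne, h.real 1 (by lia) q hq.ne]
      split_ifs
      · exact le_rfl
      · rw [h.sent]
        split_ifs
        · exact le_rfl
        · exact delayCostOf_append_le _ _ _ _
    have hnew : paidDelay L s' c.released ≤ delayOf L c.released (releaseOf L c.released) := by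
      unfold paidDelay
      split_ifs with hp
      · rw [hoff, ENNReal.ofReal_coe_nnreal]
      · rw [h.sent, if_neg hp]
        have hs := h.serves
        rw [serves_take (Nat.lt_succ_self _)] at hs
        exact delayCostOf_le (o := (releaseOf L c.released, s'.set 0 c.released)) (by simp)
          le_rfl hs
    simp only
    rw [Finset.sum_range_succ, Finset.sum_range_succ, hsent, ← add_assoc]
    calc _ ≤ sentCost c.mem + ∑ q ∈ Finset.range c.released, paidDelay L c.mem q +
          delayOf L c.released (releaseOf L c.released) := by
          gcongr with q hq
          exact hold q (Finset.mem_range.1 hq)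
      _ ≤ _ := by
          refine (add_le_add hC.cost le_rfl).trans (le_of_eq ?_)
          ring

end

/-! ### Charging a service -/

section
variable {N : Network.{u}} {γ : ℝ≥0} {L : List (Request N)} {a v x : ℝ}
variable {s s' : Mem N.numElems} {c c' : Config N.numElems} {σ : Schedule N}
variable {X : N.Sets} {U : ℕ → Prop}

open Classical in
/-- A service at level `w` costs at most `6γw`: `3γw` for the transmission, `w` for the delay of the
requests served, and `2γw` for the delay to which the other requests are forwarded. -/
theorem Basic.spent_service {w : ℝ} (hγ : 1 ≤ γ) (hw : 0 < w) (hB : Basic γ L c)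
    (hca : c.clock ≤ a) (ha : c.mem.alarm = some a)
    (h : IsService γ (L.take c.released) a w x X U c.mem s') :
    sentCost s' + ∑ q ∈ Finset.range c.released, paidDelay L s' q ≤
      sentCost c.mem + ∑ q ∈ Finset.range c.released, paidDelay L c.mem q +
        ENNReal.ofReal (6 * (γ * w)) := by
  have hγ1 : (1 : ℝ) ≤ γ := by exact_mod_cast hγ
  have hwB : w ≤ γ * w := le_mul_of_one_le_left hw.le hγ1
  have hlen := List.length_take_of_le hB.released_le
  have hload : load (L.take c.released) c.mem w a ≤ w := load_le (hB.load_le_of_le fun b hb => by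
    rw [ha] at hb
    exact (Option.some.inj hb).le) hw.le
  have hres := h.residual_le
  unfold load at hload
  rw [totalResidual_take hB.released_le] at hload hres
  have hterm : ∀ q < c.released, paidDelay L s' q ≤ paidDelay L c.mem q +
      (ENNReal.ofReal (if U q then residual L q (c.mem.real 1 q) x else 0) +
        ENNReal.ofReal (if Touched c.mem w q then residual L q (c.mem.real 1 q) a else 0)) := by
    intro q hq
    have hq' : q < (L.take c.released).length := by lia
    unfold paidDelay
    by_cases hp : c.mem.nat 0 q ≠ 0
    · rw [if_pos hp]
      by_cases hU : U q
      · have hp' : s'.nat 0 q ≠ 0 := (h.pending q hq').2 ⟨hp, fun _ => hU⟩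
        rw [if_pos hp', if_pos hU, h.offset q hq', if_pos (h.sub q hq' hU).1, residual_take hq,
          ENNReal.ofReal_add (hB.offset q hq) (residual_nonneg _ _ _ _), ← add_assoc]
        exact le_self_add
      · by_cases hT : Touched c.mem w q
        · have hp' : ¬ s'.nat 0 q ≠ 0 := fun hp' => hU (((h.pending q hq').1 hp').2 hT.2)
          have hs := h.serves q hq' hT hU
          rw [serves_take hq] at hs
          rw [if_neg hp', if_neg hU, if_pos hT, ENNReal.ofReal_zero, zero_add,
            ← ENNReal.ofReal_add (hB.offset q hq) (residual_nonneg _ _ _ _), add_residual]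
          refine (delayCostOf_le (o := (a, X)) (by simp [h.sent])
            ((hB.release_le q hq).trans hca) hs).trans ?_
          rw [← ENNReal.ofReal_coe_nnreal]
          exact ENNReal.ofReal_le_ofReal (le_max_right _ _)
        · have hp' : s'.nat 0 q ≠ 0 := (h.pending q hq').2 ⟨hp, fun hl => absurd ⟨hp, hl⟩ hT⟩
          rw [if_pos hp', h.offset q hq', if_neg hT]
          exact le_self_add
    · have hp' : ¬ s'.nat 0 q ≠ 0 := fun hp' => hp ((h.pending q hq').1 hp').1
      rw [if_neg hp, if_neg hp', h.sent]
      exact (delayCostOf_append_le _ _ _ _).trans le_self_add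
  have hsent : sentCost s' = sentCost c.mem + N.setCost X := by simp [sentCost, h.sent]
  rw [hsent]
  calc _ ≤ sentCost c.mem + N.setCost X + ∑ q ∈ Finset.range c.released, (paidDelay L c.mem q +
      (ENNReal.ofReal (if U q then residual L q (c.mem.real 1 q) x else 0) +
        ENNReal.ofReal (if Touched c.mem w q then residual L q (c.mem.real 1 q) a else 0))) := by
        gcongr with q hq
        exact hterm q (Finset.mem_range.1 hq)
    _ = sentCost c.mem + ∑ q ∈ Finset.range c.released, paidDelay L c.mem q +
        (ENNReal.ofReal (N.setCost X) + (ENNReal.ofReal (∑ q ∈ Finset.range c.released,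
          if U q then residual L q (c.mem.real 1 q) x else 0) +
        ENNReal.ofReal (∑ q ∈ Finset.range c.released,
          if Touched c.mem w q then residual L q (c.mem.real 1 q) a else 0))) := by
        rw [Finset.sum_add_distrib, Finset.sum_add_distrib, ENNReal.ofReal_sum_of_nonneg,
          ENNReal.ofReal_sum_of_nonneg, ENNReal.ofReal_coe_nnreal]
        · ring
        all_goals
          intro q _
          split_ifs
          · exact residual_nonneg _ _ _ _
          · exact le_rfl
    _ ≤ _ := by
        gcongr
        have h3 := h.cost_le
        rw [← ENNReal.ofReal_add, ← ENNReal.ofReal_add]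
        · refine ENNReal.ofReal_le_ofReal ?_
          change (∑ q ∈ Finset.range c.released,
            if Touched c.mem w q then residual L q (c.mem.real 1 q) a else 0) ≤ w at hload
          linarith
        · exact NNReal.coe_nonneg _
        · refine add_nonneg ?_ ?_ <;>
          · refine Finset.sum_nonneg fun q _ => ?_
            split_ifs
            · exact residual_nonneg _ _ _ _
            · exact le_rfl
        all_goals
          refine Finset.sum_nonneg fun q _ => ?_
          split_ifs
          · exact residual_nonneg _ _ _ _
          · exact le_rfl

/-- The delay of request `q` under `σ` that a service from `s` to `s'` has newly covered. -/
def newlyCovered (σ : Schedule N) (L : List (Request N)) (s s' : Mem N.numElems) (q : ℕ) : ℝ≥0∞ :=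
  covered σ L s' q - covered σ L s q

theorem covered_add_newlyCovered {q : ℕ} (h : s.real 1 q ≤ s'.real 1 q) :
    covered σ L s q + newlyCovered σ L s s' q = covered σ L s' q :=
  add_tsub_cancel_of_le (min_le_min le_rfl (ENNReal.ofReal_le_ofReal h))

/-- If `σ` serves `q` at time `y` at the earliest, and the offset is raised to the delay at `y` at
least, then the residual delay at `y` is newly covered. -/
theorem ofReal_residual_le_newlyCovered {q : ℕ} {y : ℝ} (h0 : 0 ≤ s.real 1 q)
    (hσ : (delayOf L q y : ℝ≥0∞) ≤ delayCostOf σ L q)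
    (h : s.real 1 q + residual L q (s.real 1 q) y ≤ s'.real 1 q) :
    ENNReal.ofReal (residual L q (s.real 1 q) y) ≤ newlyCovered σ L s s' q := by
  rw [add_residual, max_le_iff] at h
  unfold newlyCovered covered
  rcases le_total (delayOf L q y : ℝ) (s.real 1 q) with hy | hy
  · rw [residual, max_eq_left (sub_nonpos.2 hy)]
    simp
  · rw [residual, max_eq_right (sub_nonneg.2 hy), ENNReal.ofReal_sub _ h0,
      ENNReal.ofReal_coe_nnreal]
    refine tsub_le_tsub (le_min hσ ?_) (min_le_right _ _)
    rw [← ENNReal.ofReal_coe_nnreal]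
    exact ENNReal.ofReal_le_ofReal h.2

/-- The requests that remain pending after a service at level `2 ^ j` justify this level: otherwise
the non-cheap transmissions of `σ` in the window, without the free elements, would solve the
prize-collecting problem too cheaply. -/
theorem Charge.zpow_le {last : ℤ → WithBot ℝ} {cred : ℤ → ℝ≥0∞} {used : ℝ≥0∞} {j : ℤ}
    (hγ : 1 ≤ γ) (hB : Basic γ L c) (hC : Charge γ σ L c last cred used)
    (h : IsService γ (L.take c.released) a (2 ^ j) x X U c.mem s')
    (hne : ∃ q < c.released, U q) : ENNReal.ofReal (2 ^ j) ≤
      windowShare σ L.length j (fun o => last j ≤ o ∧ o ≤ x) +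
        ∑ q ∈ Finset.range c.released, newlyCovered σ L c.mem s' q := by
  classical
  have hγ0 : (0 : ℝ) < γ := lt_of_lt_of_le one_pos (by exact_mod_cast hγ)
  have hlen := List.length_take_of_le hB.released_le
  refine zpow_le_windowShare_add _ _ _ _ _ ?_
  set S := unionOf σ (fun s => (last j ≤ s.1 ∧ s.1 ≤ x) ∧ (2 : ℝ) ^ j < N.setCost s.2 * L.length)
    with hS
  have h1 := h.le_waitCost (by rwa [hlen]) S
  unfold waitCost at h1
  rw [totalResidual_take hB.released_le] at h1
  refine (ENNReal.ofReal_le_ofReal h1).trans ?_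
  rw [ENNReal.ofReal_add (NNReal.coe_nonneg _) (Finset.sum_nonneg fun q _ => by
    split_ifs
    · exact residual_nonneg _ _ _ _
    · exact le_rfl), ENNReal.ofReal_coe_nnreal, ENNReal.ofReal_sum_of_nonneg fun q _ => by
    split_ifs
    · exact residual_nonneg _ _ _ _
    · exact le_rfl]
  gcongr with q hq
  have hq := Finset.mem_range.1 hq
  have hq' : q < (L.take c.released).length := by lia
  split_ifs with hh
  · obtain ⟨⟨hT, hE⟩, hns⟩ := hh
    rw [serves_take hq] at hns
    refine ofReal_residual_le_newlyCovered (hB.offset q hq) (le_delayCostOf fun o ho hr hs => ?_) ?_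
    · -- An earlier transmission serving `q` is in the window, and not cheap.
      by_contra hox
      refine hns (hs.mono fun e he => ?_)
      refine mem_unionOf.2 ⟨o, ho, ⟨⟨?_, (not_le.1 hox).le⟩, ?_⟩, he⟩
      · exact (hC.last_le q hq hT.1 j hT.2).trans (by exact_mod_cast hr)
      · unfold Expensive at hE
        rw [hlen] at hE
        have h2 := hB.own_le q hq hT.1 _ hs
        have h3 : (c.released : ℝ) ≤ L.length := by exact_mod_cast hB.released_le
        refine lt_of_mul_lt_mul_left (hE.trans_le ?_) hγ0.le
        rw [← mul_assoc]
        gcongr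
    · rw [h.offset q hq', if_pos hT, residual_take hq]
  · simp

open Classical in
/-- A service triggered at level `v = 2 ^ j` can be charged to transmissions of `σ` that were not
charged at this level before, to the credit of this level, or to newly covered delay. -/
theorem Charge.trigger {last : ℤ → WithBot ℝ} {cred : ℤ → ℝ≥0∞} {used : ℝ≥0∞} {j : ℤ} {w : ℝ}
    (hγ : 1 ≤ γ) (hB : Basic γ L c) (hC : Charge γ σ L c last cred used)
    (ha : c.mem.alarm = some a) (hw : 2 ^ j ≤ w)
    (hload : load (L.take c.released) c.mem (2 ^ j) a = 2 ^ j)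
    (h : IsService γ (L.take c.released) a w x X U c.mem s') :
    ENNReal.ofReal (2 ^ j) ≤ windowShare σ L.length j (fun o => last j ≤ o ∧ o < a) + cred j ∨
    ENNReal.ofReal (2 ^ j) ≤ windowShare σ L.length j (fun o => last j ≤ o ∧ o < a) +
      2 * ∑ q ∈ Finset.range c.released, newlyCovered σ L c.mem s' q := by
  have hγ0 : (0 : ℝ) < γ := lt_of_lt_of_le one_pos (by exact_mod_cast hγ)
  have hlen := List.length_take_of_le hB.released_le
  have hbound := fun u (hu : 0 ≤ u) => load_le (hB.load_le_of_le (x := a) fun b hb => by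
    rw [ha] at hb
    exact (Option.some.inj hb).le) (v := u) hu
  by_cases hslot : ∃ q < c.released, c.mem.nat 0 q ≠ 0 ∧ c.mem.real 0 q = 2 ^ j ∧
      0 < residual L q (c.mem.real 1 q) a ∧ ¬ c.mem.real 0 q ≤ c.mem.real 2 q / γ
  · left
    obtain ⟨q, hq, hp, hl, hres, hnew⟩ := hslot
    obtain ⟨i, y, hi, hy, hle⟩ := (hC.justified q hq hp).resolve_left hnew
    obtain rfl : i = j := zpow_right_injective₀ (a := (2 : ℝ)) (by norm_num) (by norm_num)
      (hi.symm.trans hl)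
    -- The window of `q` ends before the service, as `q` has residual delay.
    have hya : y < a := by
      by_contra hya
      have h1 : (delayOf L q a : ℝ) ≤ delayOf L q y := by
        exact_mod_cast delayOf_mono L q (not_lt.1 hya)
      rw [residual, max_eq_left (by linarith)] at hres
      exact lt_irrefl _ hres
    refine hle.trans (add_le_add (windowShare_mono _ _ _ fun o ho => ?_) le_rfl)
    exact ⟨ho.1, ho.2.trans_lt hya⟩
  · right
    by_cases hearly : ∃ q < c.released, c.mem.nat 0 q ≠ 0 ∧ c.mem.real 0 q = 2 ^ j ∧
        c.mem.real 0 q ≤ c.mem.real 2 q / γ ∧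
        ∃ o ∈ σ, releaseOf L q ≤ o.1 ∧ Serves L q o.2 ∧ o.1 < a
    · obtain ⟨q, hq, hp, hl, hnew, o, ho, hr, hs, hoa⟩ := hearly
      have hcost : (2 : ℝ) ^ j ≤ N.setCost o.2 := by
        rw [← hl]
        refine hnew.trans ?_
        rw [div_le_iff₀ hγ0, mul_comm]
        exact hB.own_le q hq hp _ hs
      rw [← share_of_le (k := L.length) hcost]
      refine le_trans (share_le_windowShare (P := fun o => last j ≤ o ∧ o < a) ho ⟨?_, hoa⟩)
        le_self_add
      exact (hC.last_le q hq hp j hl.le).trans (by exact_mod_cast hr)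
    · -- Lower levels make at most half of the load, hence level `2 ^ j` at least half.
      have hlow : load (L.take c.released) c.mem (2 ^ (j - 1)) a ≤ 2 ^ (j - 1) :=
        hbound _ (by positivity)
      have hsplit : (2 : ℝ) ^ j ≤ 2 ^ (j - 1) + ∑ q ∈ Finset.range c.released,
          if c.mem.nat 0 q ≠ 0 ∧ c.mem.real 0 q = 2 ^ j then
            residual L q (c.mem.real 1 q) a else 0 := by
        refine hload.ge.trans (le_trans ?_ (add_le_add hlow le_rfl))
        rw [load, load, totalResidual_take hB.released_le,
          totalResidual_take hB.released_le, ← Finset.sum_add_distrib]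
        refine Finset.sum_le_sum fun q hq => ?_
        have hq := Finset.mem_range.1 hq
        have hr := residual_nonneg L q (c.mem.real 1 q) a
        by_cases hp : c.mem.nat 0 q ≠ 0 ∧ c.mem.real 0 q ≤ 2 ^ j
        · obtain ⟨-, i, hi, -⟩ := hB.level q hq hp.1
          have hle := hp.2
          rw [hi, zpow_le_zpow_iff_right₀ (by norm_num)] at hle
          rcases hle.eq_or_lt with he | hlt
          · rw [if_pos hp, if_pos (c := _ ∧ c.mem.real 0 q = 2 ^ j) ⟨hp.1, by rw [hi, he]⟩]
            split_ifs <;> linarith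
          · have : c.mem.real 0 q ≤ 2 ^ (j - 1) := by
              rw [hi, zpow_le_zpow_iff_right₀ (by norm_num)]
              lia
            rw [if_pos hp, if_pos ⟨hp.1, this⟩]
            split_ifs <;> linarith
        · rw [if_neg hp]
          split_ifs <;> linarith
      have hhalf : (2 : ℝ) ^ j = 2 * 2 ^ (j - 1) := by
        rw [zpow_sub_one₀ (by norm_num)]
        ring
      refine le_trans ?_ le_add_self
      rw [hhalf, ENNReal.ofReal_mul (by norm_num), ENNReal.ofReal_ofNat]
      gcongr
      refine (ENNReal.ofReal_le_ofReal (by linarith :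
        (2 : ℝ) ^ (j - 1) ≤ ∑ q ∈ Finset.range c.released,
          if c.mem.nat 0 q ≠ 0 ∧ c.mem.real 0 q = 2 ^ j then
            residual L q (c.mem.real 1 q) a else 0)).trans ?_
      rw [ENNReal.ofReal_sum_of_nonneg fun q _ => by
        split_ifs
        · exact residual_nonneg _ _ _ _
        · exact le_rfl]
      refine Finset.sum_le_sum fun q hq => ?_
      have hq := Finset.mem_range.1 hq
      split_ifs with hp
      · rcases (residual_nonneg L q (c.mem.real 1 q) a).eq_or_lt with h0 | h0
        · rw [← h0]
          simp
        · have hnew : c.mem.real 0 q ≤ c.mem.real 2 q / γ := by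
            by_contra hnew
            exact hslot ⟨q, hq, hp.1, hp.2, h0, hnew⟩
          refine ofReal_residual_le_newlyCovered (hB.offset q hq)
            (le_delayCostOf fun o ho hr hs => ?_) ?_
          · by_contra hoa
            exact hearly ⟨q, hq, hp.1, hp.2, hnew, o, ho, hr, hs, not_le.1 hoa⟩
          · rw [h.offset q (by lia), if_pos ⟨hp.1, hp.2.le.trans hw⟩, residual_take hq]
            gcongr
            exact residual_mono _ _ _ h.le_time
      · simp

end

section
variable {N : Network.{u}} {γ : ℝ≥0} {L : List (Request N)} {a v x : ℝ} {A : Solver PMF N}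
variable {s s' : Mem N.numElems} {c c' : Config N.numElems} {σ : Schedule N}
variable {X : N.Sets} {U : ℕ → Prop}

theorem Charge.service {last : ℤ → WithBot ℝ} {cred : ℤ → ℝ≥0∞} {used : ℝ≥0∞}
    (hγ : 1 ≤ γ) (hB : Basic γ L c) (hC : Charge γ σ L c last cred used)
    (ha : c.mem.alarm = some a) (hca : c.clock ≤ a)
    (hx : ∀ q, c.released ≤ q → q < L.length → a ≤ releaseOf L q)
    (htrig : ∃ q < c.released, c.mem.nat 0 q ≠ 0 ∧ c.mem.real 0 q = v ∧
      load (L.take c.released) c.mem v a = v)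
    (h : IsService γ (L.take c.released) a (v + v) x X U c.mem s') :
    ∃ last' cred' used', Charge γ σ L ⟨s', c.released, a⟩ last' cred' used' := by
  classical
  have hlen := List.length_take_of_le hB.released_le
  obtain ⟨q₀, hq₀, hp₀, hl₀, hload⟩ := htrig
  obtain ⟨-, i₀, hi₀, -⟩ := hB.level q₀ hq₀ hp₀
  rw [hl₀] at hi₀
  generalize Int.log 2 (c.mem.real 2 q₀ / γ) + i₀ = j at hi₀
  subst hi₀
  have hw : (2 : ℝ) ^ j + 2 ^ j = 2 ^ (j + 1) := by
    rw [zpow_add_one₀ (by norm_num)]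
    ring
  have hpos : (0 : ℝ) < 2 ^ j := by positivity
  have hlast : last j ≤ a := (hC.last_le q₀ hq₀ hp₀ j hl₀.le).trans
    (by exact_mod_cast (hB.release_le q₀ hq₀).trans hca)
  set P := ∑ q ∈ Finset.range c.released, newlyCovered σ L c.mem s' q with hP
  set W := windowShare σ L.length j (fun o => last j ≤ o ∧ o < a) with hW
  -- The delay `d` paid by `σ` that the service is charged to.
  obtain ⟨d, cred₀, hd, hsum, hcred⟩ : ∃ (d : ℝ≥0∞) (cred₀ : ℤ → ℝ≥0∞),
      ENNReal.ofReal (2 ^ j + 2 ^ j) ≤ 4 * (W + d) ∧ d + ∑' i, cred₀ i ≤ ∑' i, cred i + P ∧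
      ∀ i, i ≠ j → cred₀ i = cred i := by
    rw [ENNReal.ofReal_add hpos.le hpos.le]
    rcases hC.trigger hγ hB ha (by linarith) hload h with h1 | h1
    · refine ⟨cred j, Function.update cred j 0, ?_, ?_, fun i hi => Function.update_of_ne hi _ _⟩
      · refine (add_le_add h1 h1).trans ?_
        rw [← two_mul]
        gcongr
        norm_num
      · rw [add_tsum_update_zero]
        exact le_self_add
    · refine ⟨P, cred, ?_, (add_comm _ _).le, fun _ _ => rfl⟩
      calc _ ≤ W + 2 * P + (W + 2 * P) := add_le_add h1 h1
        _ ≤ W + 2 * P + (W + 2 * P) + 2 * W := le_self_add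
        _ = 4 * (W + P) := by ring
  have hjj : j + 1 ≠ j := by lia
  rw [hw] at h hd
  have hlevel : ∀ q < c.released, s'.nat 0 q ≠ 0 → c.mem.nat 0 q ≠ 0 ∧
      (U q ∧ s'.real 0 q = 2 ^ (j + 1) ∨
        ¬ Touched c.mem (2 ^ (j + 1)) q ∧ ¬ U q ∧ s'.real 0 q = c.mem.real 0 q ∧
          2 ^ (j + 1) < c.mem.real 0 q) := by
    intro q hq hp
    have hq' : q < (L.take c.released).length := by lia
    obtain ⟨h1, h2⟩ := (h.pending q hq').1 hp
    refine ⟨h1, ?_⟩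
    by_cases hU : U q
    · exact Or.inl ⟨hU, by rw [h.level q hq', if_pos hU]⟩
    · exact Or.inr ⟨fun hT => hU (h2 hT.2), hU, by rw [h.level q hq', if_neg hU],
        not_le.1 fun hl => hU (h2 hl)⟩
  refine ⟨Function.update last j a, Function.update cred₀ (j + 1) P, used + d, ?_, ?_, ?_, ?_, ?_⟩
  · intro q hq hqL i
    rcases eq_or_ne i j with rfl | hi
    · rw [Function.update_self]
      exact_mod_cast hx q hq hqL
    · rw [Function.update_of_ne hi]
      exact hC.future q hq hqL i
  · intro q hq hp i hi
    simp only at hp hi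
    obtain ⟨h1, h2⟩ := hlevel q hq hp
    rcases eq_or_ne i j with rfl | hij
    · exfalso
      rcases h2 with ⟨-, h2⟩ | ⟨-, -, h2, h3⟩ <;> linarith
    · rw [Function.update_of_ne hij]
      refine hC.last_le q hq h1 i (le_trans ?_ hi)
      rcases h2 with ⟨h2, h3⟩ | ⟨-, -, h2, -⟩
      · rw [h3]
        exact (h.sub q (by lia) h2).1.2
      · exact h2.ge
  · intro q hq hp
    simp only at hp
    have hq' : q < (L.take c.released).length := by lia
    obtain ⟨h1, h2⟩ := hlevel q hq hp
    rcases h2 with ⟨hU, h3⟩ | ⟨hT, hU, h3, h4⟩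
    · refine Or.inr ⟨j + 1, x, h3, ?_, ?_⟩
      · simp only
        rw [h.offset q hq', if_pos (h.sub q hq' hU).1, add_residual, delayOf_take hq]
        exact le_max_right _ _
      · rw [Function.update_of_ne hjj, Function.update_self]
        exact hC.zpow_le hγ hB h ⟨q, hq, hU⟩
    · rcases hC.justified q hq h1 with h5 | ⟨i, y, h5, h6, h7⟩
      · left
        simp only
        rwa [h3, h.real_two]
      · have hij : j + 1 < i := by
          rw [h5] at h4
          exact (zpow_lt_zpow_iff_right₀ (by norm_num)).1 h4
        refine Or.inr ⟨i, y, by simp only [h3, h5], ?_, ?_⟩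
        · simp only
          rwa [h.offset q hq', if_neg hT]
        · rwa [Function.update_of_ne (by lia), Function.update_of_ne (by lia), hcred i (by lia)]
  · simp only
    have hcov : ∑ q ∈ Finset.range c.released, covered σ L s' q =
        ∑ q ∈ Finset.range c.released, covered σ L c.mem q + P := by
      rw [hP, ← Finset.sum_add_distrib]
      refine Finset.sum_congr rfl fun q hq => (covered_add_newlyCovered ?_).symm
      have hq := Finset.mem_range.1 hq
      rw [h.offset q (by lia)]
      split_ifs
      · exact le_add_of_nonneg_right (residual_nonneg _ _ _ _)
      · exact le_rfl
    rw [hcov]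
    calc _ ≤ used + d + (∑' i, cred₀ i + P) := by
          gcongr
          exact tsum_update_le _ _ _
      _ = used + (d + ∑' i, cred₀ i) + P := by ring
      _ ≤ used + (∑' i, cred i + P) + P := by gcongr
      _ = used + ∑' i, cred i + 2 * P := by ring
      _ ≤ _ := by
          rw [mul_add]
          exact add_le_add hC.credit le_rfl
  · have h1 := hB.spent_service hγ (w := 2 ^ (j + 1)) (by positivity) hca ha h
    have h2 : charged σ L.length last + W ≤ charged σ L.length (Function.update last j a) := by
      refine tsum_add_le_tsum (j := j) (fun i => windowShare_mono _ _ _ fun o ho => ?_) ?_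
      · rcases eq_or_ne i j with rfl | hi
        · rw [Function.update_self]
          exact ho.trans_le hlast
        · rwa [Function.update_of_ne hi]
      · rw [Function.update_self]
        refine windowShare_add_le _ _ _ (fun o ho => ho.trans_le hlast)
          (fun o ho => by exact_mod_cast ho.2) fun o ho ho' => not_le.2 ho ho'.1
    simp only
    have h3 : ENNReal.ofReal (6 * (γ * 2 ^ (j + 1))) = 6 * γ * ENNReal.ofReal (2 ^ (j + 1)) := by
      rw [ENNReal.ofReal_mul (by norm_num), ENNReal.ofReal_mul (NNReal.coe_nonneg _),
        ENNReal.ofReal_coe_nnreal, ENNReal.ofReal_ofNat, mul_assoc]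
    rw [h3] at h1
    calc _ ≤ _ := h1
      _ ≤ ∑ q ∈ Finset.range c.released, (delayOf L q (releaseOf L q) : ℝ≥0∞) +
          24 * γ * (charged σ L.length last + used) + 6 * γ * (4 * (W + d)) := by
          refine add_le_add hC.cost ?_
          gcongr
      _ = ∑ q ∈ Finset.range c.released, (delayOf L q (releaseOf L q) : ℝ≥0∞) +
          24 * γ * (charged σ L.length last + W + (used + d)) := by ring
      _ ≤ _ := by gcongr

theorem exists_charge_of_mem_runEvents (hγ : 1 ≤ γ) (hL : IsInput L)
    (hA : ∀ E₀ Q S, ∀ x ∈ (A E₀ Q).support, N.pcCost E₀ Q x.1 ≤ γ * N.pcCost E₀ Q S)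
    (σ : Schedule N) (T : ℕ) : ∀ c ∈ (runEvents algorithm γ A L T).support,
      ∃ last cred used, Charge γ σ L c last cred used := by
  induction T with
  | zero =>
    intro c hc
    obtain rfl := mem_support_pure.1 hc
    exact ⟨_, _, _, charge_start⟩
  | succ T ih =>
    intro c' hc'
    rw [runEvents, mem_support_bind] at hc'
    obtain ⟨c, hc, hc'⟩ := hc'
    obtain ⟨last, cred, used, hC⟩ := ih c hc
    have hB := (basic_runEvents hγ hL hA T c hc).1
    cases event_of_mem_nextEvent hγ hL hA hB hc' with
    | finished h h' => exact ⟨last, cred, used, hC⟩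
    | release s' hr hx hreg hal => exact ⟨last, cred, used, hC.registration hγ hr hreg⟩
    | alarm s' a v x X U ha hca hx htrig hserv hal =>
      exact hC.service hγ hB ha hca hx htrig hserv

theorem charged_le (σ : Schedule N) (k : ℕ) (last : ℤ → WithBot ℝ) : charged σ k last ≤
    (3 + Nat.log 2 (min k N.numElems) : ℕ) * (σ.map fun o => (N.setCost o.2 : ℝ≥0∞)).sum := by
  have h1 : ∀ j, windowShare σ k j (fun o => (o : WithBot ℝ) < last j) ≤
      (σ.map fun o => share N k j o.2).sum := fun j => by
    refine list_sum_map_le _ fun o _ => ?_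
    split_ifs
    · exact le_rfl
    · exact zero_le
  refine (ENNReal.tsum_le_tsum h1).trans ?_
  clear h1
  induction σ with
  | nil => simp
  | cons o σ ih =>
    simp only [List.map_cons, List.sum_cons]
    rw [ENNReal.tsum_add, mul_add]
    exact add_le_add (tsum_share_le k o.2) ih

theorem Charge.scheduleCost_le {last : ℤ → WithBot ℝ} {cred : ℤ → ℝ≥0∞} {used : ℝ≥0∞}
    (hγ : 1 ≤ γ) (hB : Basic γ L c) (hC : Charge γ σ L c last cred used) (hF : Finished L c) :
    scheduleCost L c.mem.sent ≤
      24 * γ * (3 + Nat.log 2 (min L.length N.numElems) : ℕ) * scheduleCost L σ := by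
  obtain ⟨hr, hal⟩ := hF
  have hlen := List.length_take_of_le hB.released_le
  have hserved : ∀ q < c.released, c.mem.nat 0 q = 0 := by
    rcases hB.alarm with ⟨-, h⟩ | ⟨a, ha, -⟩
    · exact fun q hq => h q (by lia)
    · rw [hal] at ha
      cases ha
  have h1 := hC.cost
  rw [Finset.sum_congr rfl fun q hq => show paidDelay L c.mem q = delayCostOf c.mem.sent L q by
    rw [paidDelay, hserved q (Finset.mem_range.1 hq), if_neg (by simp)], hr, sum_delayCostOf] at h1
  have h2 : ∑ q ∈ Finset.range L.length, (delayOf L q (releaseOf L q) : ℝ≥0∞) ≤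
      (L.map fun q => delayCost σ q).sum := by
    rw [← sum_delayCostOf]
    exact Finset.sum_le_sum fun q _ => le_delayCostOf fun o _ ho _ => ho
  have h3 : used ≤ 2 * (L.map fun q => delayCost σ q).sum := by
    refine le_self_add.trans (hC.credit.trans ?_)
    rw [hr, ← sum_delayCostOf]
    gcongr
    exact min_le_left _ _
  have h4 := charged_le σ L.length last
  unfold scheduleCost
  set D := (L.map fun q => delayCost σ q).sum
  set K := (σ.map fun o => (N.setCost o.2 : ℝ≥0∞)).sum
  set m := Nat.log 2 (min L.length N.numElems)
  have hγ' : (1 : ℝ≥0∞) ≤ γ := by exact_mod_cast hγ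
  calc _ ≤ _ := h1
    _ ≤ 1 * D + 24 * γ * ((3 + m : ℕ) * K + 2 * D) := by
        rw [one_mul]
        gcongr
    _ ≤ 24 * γ * D + 24 * γ * ((3 + m : ℕ) * K + 2 * D) := by
        gcongr
        calc (1 : ℝ≥0∞) = 1 * 1 := by norm_num
          _ ≤ 24 * γ := by
              gcongr
              norm_num
    _ ≤ 24 * γ * D + 24 * γ * ((3 + m : ℕ) * K + 2 * D) + 24 * γ * m * D := le_self_add
    _ = 24 * γ * (3 + m : ℕ) * (K + D) := by
        push_cast
        ring

end

/-! ### Guarantees of the algorithm -/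

section
variable {ι : Type v} {N : ι → Network.{u}} {γ : ι → ℝ≥0}

theorem natLog_two_le (m : ℕ) : (24 * (3 + Nat.log 2 m : ℕ) : ℝ) ≤ 72 * (1 + Real.log m) := by
  have h1 := Real.natLog_le_logb m 2
  have h2 := Real.log_two_gt_d9
  have h3 : 0 ≤ Real.log m := Real.log_natCast_nonneg m
  rw [Real.logb, Nat.cast_ofNat, le_div_iff₀ (by linarith)] at h1
  have h4 : (0 : ℝ) ≤ Nat.log 2 m := Nat.cast_nonneg _
  push_cast
  nlinarith

theorem randCompetitive_algorithm (hγ : ∀ i, 1 ≤ γ i) {A : ∀ i, Solver PMF (N i)}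
    (hA : RandApprox A γ) : RandCompetitive algorithm A γ
      (fun i k => 72 * γ i * (1 + Real.log (min k (N i).numElems : ℕ))) := by
  intro i L hL
  refine ⟨maxEvents L.length, fun c hc => ?_⟩
  have hF := finished_of_mem_runEvents (hγ i) hL (hA i) c hc
  have hB := (basic_runEvents (hγ i) hL (hA i) _ c hc).1
  refine ⟨hF, ?_⟩
  set m := min L.length (N i).numElems
  have hlog : 0 ≤ Real.log m := Real.log_natCast_nonneg m
  have hρ : 0 < 72 * (γ i : ℝ) * (1 + Real.log m) := by
    have : (1 : ℝ) ≤ γ i := by exact_mod_cast hγ i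
    positivity
  unfold opt
  rw [ENNReal.mul_iInf_of_ne (ENNReal.ofReal_pos.2 hρ).ne' ENNReal.ofReal_ne_top]
  refine le_iInf fun σ => ?_
  obtain ⟨last, cred, used, hC⟩ :=
    exists_charge_of_mem_runEvents (hγ i) hL (hA i) σ (maxEvents L.length) c hc
  refine (hC.scheduleCost_le (hγ i) hB hF).trans ?_
  gcongr
  have h := natLog_two_le m
  have h24 : (24 : ℝ≥0∞) = ENNReal.ofReal (24 : ℝ) := by simp
  rw [← ENNReal.ofReal_coe_nnreal, ← ENNReal.ofReal_natCast, h24,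
    ← ENNReal.ofReal_mul (by norm_num), ← ENNReal.ofReal_mul (by positivity)]
  refine ENNReal.ofReal_le_ofReal ?_
  have := mul_le_mul_of_nonneg_left h (γ i).2
  change _ * (γ i : ℝ) * ((3 + Nat.log 2 m : ℕ) : ℝ) ≤ _
  simp only [NNReal.val_eq_coe] at this
  linarith

theorem exists_expect_nextEvent_le {A : ∀ i, Solver PMF (N i)} (hA : RandSolverPolyTime A) :
    ∃ p : Polynomial ℕ, ∀ i (L : List (Request (N i))) (c : Config (N i).numElems),
      expect (nextEvent algorithm (γ i) (A i) L c) (fun c' => (c'.mem.steps : ℝ≥0∞)) ≤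
        c.mem.steps + (p.eval ((N i).size + L.length) : ℕ) := by
  obtain ⟨p, hp⟩ := exists_expect_steps_le A γ hA algorithm_isStatic.1
  obtain ⟨p', hp'⟩ := exists_expect_steps_le A γ hA algorithm_isStatic.2
  refine ⟨p + p', fun i L c => ?_⟩
  have hlen : ∀ r, (N i).size + (L.take r).length ≤ (N i).size + L.length := fun r =>
    Nat.add_le_add_left (List.length_take_le' _ _) _
  have hrel : ∀ t, expect (releaseEvent algorithm (γ i) (A i) L t c)
      (fun c' => (c'.mem.steps : ℝ≥0∞)) ≤
      c.mem.steps + ((p + p').eval ((N i).size + L.length) : ℕ) := by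
    intro t
    unfold releaseEvent
    rw [expect_bind]
    simp only [expect_pure]
    refine (hp i _ t c.mem).trans ?_
    gcongr
    rw [Polynomial.eval_add]
    exact (polynomial_eval_mono p (hlen _)).trans (Nat.le_add_right _ _)
  have halm : ∀ t, expect (alarmEvent algorithm (γ i) (A i) L t c)
      (fun c' => (c'.mem.steps : ℝ≥0∞)) ≤
      c.mem.steps + ((p + p').eval ((N i).size + L.length) : ℕ) := by
    intro t
    unfold alarmEvent
    rw [expect_bind]
    simp only [expect_pure]
    refine (hp' i _ _ { c.mem with alarm := none }).trans ?_
    gcongr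
    rw [Polynomial.eval_add]
    exact (polynomial_eval_mono p' (hlen _)).trans (Nat.le_add_left _ _)
  unfold nextEvent
  split
  · rw [expect_pure]
    exact le_self_add
  · exact hrel _
  · exact halm _
  · split_ifs
    · exact hrel _
    · exact halm _

theorem randPolyTime_algorithm (hγ : ∀ i, 1 ≤ γ i) {A : ∀ i, Solver PMF (N i)}
    (hA : RandApprox A γ) (hT : RandSolverPolyTime A) : RandPolyTime algorithm A γ := by
  obtain ⟨p, hp⟩ := exists_expect_nextEvent_le (γ := γ) hT
  refine ⟨(.X + .X * (2 * .X) + 1) * p, fun i L hL T => ?_⟩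
  change expect _ (fun c : Config (N i).numElems => (c.mem.steps : ℝ≥0∞)) ≤ _
  set y := (N i).size + L.length with hy
  have hle : ∀ T, expect (runEvents algorithm (γ i) (A i) L T) (fun c => (c.mem.steps : ℝ≥0∞)) ≤
      T * (p.eval y : ℕ) := by
    intro T
    induction T with
    | zero => simp [runEvents, expect_pure, Config.start]
    | succ T ih =>
      rw [runEvents, expect_bind]
      refine (expect_mono _ fun c _ => hp i L c).trans ?_
      rw [expect_add_const]
      push_cast
      rw [add_mul, one_mul]
      gcongr
  -- After `maxEvents` events nothing happens any more.
  have hidle : ∀ n, expect (runEvents algorithm (γ i) (A i) L (maxEvents L.length + n))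
      (fun c => (c.mem.steps : ℝ≥0∞)) ≤
      expect (runEvents algorithm (γ i) (A i) L (maxEvents L.length))
        (fun c => (c.mem.steps : ℝ≥0∞)) := by
    intro n
    induction n with
    | zero => exact le_rfl
    | succ n ih =>
      refine le_trans ?_ ih
      rw [← add_assoc, runEvents, expect_bind]
      refine expect_mono _ fun c hc => ?_
      obtain ⟨hB, hF⟩ := basic_runEvents (hγ i) hL (hA i) _ c hc
      obtain ⟨h1, h2⟩ := hF.resolve_right fun h => by
        have := hB.progress_le
        unfold maxEvents at h
        lia
      have h3 : L[c.released]? = none := by simp [h1]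
      simp only [nextEvent, h3, h2]
      rw [expect_pure]
  have hmax : maxEvents L.length ≤ y + y * (2 * y) + 1 := by
    have : L.length ≤ y := Nat.le_add_left _ _
    unfold maxEvents
    gcongr
  have hfin : ∀ T ≤ maxEvents L.length, (T * (p.eval y : ℕ) : ℝ≥0∞) ≤
      (((.X + .X * (2 * .X) + 1) * p : Polynomial ℕ).eval y : ℕ) := by
    intro T hT
    simp only [Polynomial.eval_mul, Polynomial.eval_add, Polynomial.eval_X, Polynomial.eval_one,
      Polynomial.eval_ofNat]
    exact_mod_cast Nat.mul_le_mul_right _ (hT.trans hmax)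
  rcases le_total T (maxEvents L.length) with h | h
  · exact (hle T).trans (hfin T h)
  · obtain ⟨n, rfl⟩ := Nat.exists_eq_add_of_le h
    exact (hidle n).trans ((hle _).trans (hfin _ le_rfl))

/-! ### Deterministic subroutines -/

theorem randApprox_toPMF {A : ∀ i, Solver Id (N i)} (hA : DetApprox A γ) :
    RandApprox (fun i => (A i).toPMF) γ := by
  intro i E₀ Q S x hx
  obtain rfl := mem_support_pure.1 hx
  exact hA i E₀ Q S

theorem randSolverPolyTime_toPMF {A : ∀ i, Solver Id (N i)} (hA : DetSolverPolyTime A) :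
    RandSolverPolyTime fun i => (A i).toPMF := by
  obtain ⟨p, hp⟩ := hA
  refine ⟨p, fun i E₀ Q => ?_⟩
  refine (expect_pure (Id.run (A i E₀ Q)) fun x => (x.2 : ℝ≥0∞)).le.trans ?_
  exact_mod_cast hp i E₀ Q

theorem RandCompetitive.of_toPMF {B : OnlineAlg} {A : ∀ i, Solver Id (N i)} {ρ : ι → ℕ → ℝ}
    (h : RandCompetitive B (fun i => (A i).toPMF) γ ρ) : DetCompetitive B A γ ρ := by
  intro i L hL
  obtain ⟨T, hT⟩ := h i L hL
  refine ⟨T, hT _ ?_⟩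
  rw [runEvents_toPMF]
  exact mem_support_pure.2 rfl

theorem RandPolyTime.of_toPMF {B : OnlineAlg} {A : ∀ i, Solver Id (N i)}
    (h : RandPolyTime B (fun i => (A i).toPMF) γ) : DetPolyTime B A γ := by
  obtain ⟨p, hp⟩ := h
  refine ⟨p, fun i L hL T => ?_⟩
  have := hp i L hL T
  rw [runEvents_toPMF] at this
  have := (expect_pure (Id.run (runEvents B (γ i) (A i) L T))
    fun c => (c.mem.steps : ℝ≥0∞)).ge.trans this
  exact_mod_cast this

end

end

end NDDelay

theorem mainTheorem4 :
    ∃ C : ℝ, ∀ (ι : Type v) (N : ι → NDDelay.Network.{u}) (γ : ι → ℝ≥0), (∀ i, 1 ≤ γ i) →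
      (∀ A : ∀ i, NDDelay.Solver Id (N i), NDDelay.DetApprox A γ →
        ∃ B : NDDelay.OnlineAlg,
          NDDelay.DetCompetitive B A γ
            (fun i k => C * γ i * (1 + Real.log (min k (N i).numElems : ℕ))) ∧
          (NDDelay.DetSolverPolyTime A → NDDelay.DetPolyTime B A γ)) ∧
      (∀ A : ∀ i, NDDelay.Solver PMF (N i), NDDelay.RandApprox A γ →
        ∃ B : NDDelay.OnlineAlg,
          NDDelay.RandCompetitive B A γ
            (fun i k => C * γ i * (1 + Real.log (min k (N i).numElems : ℕ))) ∧
          (NDDelay.RandSolverPolyTime A → NDDelay.RandPolyTime B A γ)) := by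
  refine ⟨72, fun ι N γ hγ => ⟨fun A hA => ⟨NDDelay.algorithm, ?_, fun hT => ?_⟩,
    fun A hA => ⟨NDDelay.algorithm, NDDelay.randCompetitive_algorithm hγ hA,
      NDDelay.randPolyTime_algorithm hγ hA⟩⟩⟩
  · exact (NDDelay.randCompetitive_algorithm hγ (NDDelay.randApprox_toPMF hA)).of_toPMF
  · exact (NDDelay.randPolyTime_algorithm hγ (NDDelay.randApprox_toPMF hA)
      (NDDelay.randSolverPolyTime_toPMF hT)).of_toPMF
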